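/- Fix $p\ge 1$ and a compact set $\mathbb{Z}\subset\mathbb{R}$. For every $n$ let $Z_{ij}=Z^{(n)}_{ij}\in\mathbb{Z}^p$ ($1\le i\ne j\le n$) be given covariates, and let $\boldsymbol{\eta}^*=(\alpha_1^*,\dots,\alpha_n^*,\beta_1^*,\dots,\beta_{n-1}^*)\in\mathbb{R}^{2n-1}$ and $\boldsymbol{\gamma}^*\in\mathbb{R}^p$ be the true parameters (both may depend on $n$). For $\boldsymbol\eta=(\alpha_1,\dots,\alpha_n,\beta_1,\dots,\beta_{n-1})$ and $\boldsymbol\gamma\in\mathbb{R}^p$ put $\beta_n=0$, $\pi_{ij}=\alpha_i+\beta_j+Z_{ij}^\top\boldsymbol\gamma$ and $\mu(x)=e^x/(1+e^x)$. Let $(a_{ij})_{i,j\le n}$ be the adjacency matrix of a random directed graph without self-loops ($a_{ii}=0$) in which the $a_{ij}\in\{0,1\}$, $i\neq j$, are independent with $P(a_{ij}=1)=\mu(\pi_{ij}^*)$, where $\pi_{ij}^*$ is $\pi_{ij}$ at $(\boldsymbol\eta^*,\boldsymbol\gamma^*)$. The maximum likelihood estimator (MLE) $(\widehat{\boldsymbol\eta},\widehat{\boldsymbol\gamma})$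 is a maximizer over $\mathbb{R}^{2n-1}\times\mathbb{R}^p$ of $$\ell(\boldsymbol\eta,\boldsymbol\gamma)=\sum_{i\ne j}\bigl[a_{ij}\pi_{ij}-\log(1+e^{\pi_{ij}})\bigr];$$ where no maximizer exists, $(\widehat{\boldsymbol\eta},\widehat{\boldsymbol\gamma})$ is given arbitrary values. Let $u_{ij}=\mu'(\pi_{ij})$ for $i\ne j$, $u_{ii}=0$, $u_{i\cdot}=\sum_j u_{ij}$, $u_{\cdot j}=\sum_i u_{ij}$. Let $V=V(\boldsymbol\eta,\boldsymbol\gamma)$ be the $(2n-1)\times(2n-1)$ Fisher information matrix of $\boldsymbol\eta$: it is symmetric, with $v_{ii}=u_{i\cdot}$ for $i\le n$, $v_{n+j,n+j}=u_{\cdot j}$ for $j\le n-1$, $v_{i,n+j}=v_{n+j,i}=u_{ij}$ for $i\le n$, $j\le n-1$, and all other entries $0$. Its approximate inverse $S=S(\boldsymbol\eta,\boldsymbol\gamma)=(s_{ij})$ is $$s_{ij}=\begin{cases}\delta_{ij}/u_{i\cdot}+1/u_{\cdot n}, & i,j\le n,\\ -1/u_{\cdot n}, & \text{exactly one of } i,j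 \text{ is} \le n,\\ \delta_{ij}/u_{\cdot(j-n)}+1/u_{\cdot n}, & n+1\le i,j\le 2n-1.\end{cases}$$ Let $V_{\gamma\gamma}=\sum_{i\ne j}u_{ij}Z_{ij}Z_{ij}^\top$, let $V_{\eta\gamma}$ be the $(2n-1)\times p$ matrix with rows $\sum_{j}u_{ij}Z_{ij}^\top$ ($i\le n$) followed by $\sum_{i}u_{ij}Z_{ij}^\top$ ($j\le n-1$), and let $H(\boldsymbol\eta,\boldsymbol\gamma)=V_{\gamma\gamma}-V_{\eta\gamma}^\top V^{-1}V_{\eta\gamma}$ be the information matrix of the profiled log-likelihood. Let $B(x,\epsilon)$ be the closed $\ell_\infty$-ball, $z_{\max}=\max_{i\ne j}\|Z_{ij}\|_\infty$, and let $\epsilon_{n1}>0$, $\epsilon_{n1}=o(1)$, and $0<\epsilon_{n2}\le(\log n/n)^{1/2}/(p z_{\max})$. Put $$b_n=\sup_{\boldsymbol\eta\in B(\boldsymbol\eta^*,\epsilon_{n1}),\,\boldsymbol\gamma\in B(\boldsymbol\gamma^*,\epsilon_{n2}),\,i\ne j}\frac{(1+e^{\pi_{ij}})^2}{e^{\pi_{ij}}},$$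 and assume that, for all large $n$ and all $\boldsymbol\eta\in B(\boldsymbol\eta^*,\epsilon_{n1})$, the matrix $H(\boldsymbol\eta,\boldsymbol\gamma^*)$ is positive definite and $\|H(\boldsymbol\eta,\boldsymbol\gamma^*)^{-1}\|_\infty\le\kappa_n/n^2$, where $\|\cdot\|_\infty$ is the maximal absolute row sum. If $\kappa_n b_n^{12}=o(n^{1/2}/\log n)$, then the MLE exists with probability tending to $1$, and for every fixed $k\ge1$ the vector of the first $k$ coordinates of $\widehat{\boldsymbol\eta}-\boldsymbol\eta^*$ is asymptotically multivariate normal with mean $\mathbf 0$ and covariance matrix the upper left $k\times k$ block $S_k$ of $S(\boldsymbol\eta^*,\boldsymbol\gamma^*)$; that is, $S_k$ is positive definite for all large $n$, and as $n\to\infty$, $$S_k^{-1/2}\bigl(\widehat\eta_1-\eta_1^*,\dots,\widehat\eta_k-\eta_k^*\bigr)^\top\ \xrightarrow{\ d\ }\ N(\mathbf 0,I_k).$$ -/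

import Mathlib

open MeasureTheory ProbabilityTheory Filter Topology Asymptotics
open scoped Matrix MatrixOrder

noncomputable section

namespace CovP0

/-- Index set of the free node parameters `(α_1, …, α_n, β_1, …, β_{n-1})`; under the
identification condition, `β_n = 0` is not a free parameter. -/
abbrev Idx (n : ℕ) : Type := Fin n ⊕ Fin (n - 1)

/-- A directed graph on `n` nodes: `a i j = true` iff there is an edge from `i` to `j`. -/
abbrev Adj (n : ℕ) : Type := Fin n → Fin n → Bool

/-- The logistic function `μ(x) = e^x / (1 + e^x)`. -/
def mu (x : ℝ) : ℝ := Real.exp x / (1 + Real.exp x)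

/-- Its derivative `μ'(x) = e^x / (1 + e^x)^2`. -/
def muDeriv (x : ℝ) : ℝ := Real.exp x / (1 + Real.exp x) ^ 2

/-- The outgoingness parameter `α_i`. -/
def alpha {n : ℕ} (η : Idx n → ℝ) (i : Fin n) : ℝ := η (Sum.inl i)

/-- The incomingness parameter `β_j`, with `β_n = 0`. -/
def beta {n : ℕ} (η : Idx n → ℝ) (j : Fin n) : ℝ :=
  if h : (j : ℕ) < n - 1 then η (Sum.inr ⟨j, h⟩) else 0

/-- The linear predictor `π_{ij} = α_i + β_j + Z_{ij}ᵀ γ`. -/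
def linPred {n p : ℕ} (Z : Fin n → Fin n → Fin p → ℝ) (η : Idx n → ℝ) (γ : Fin p → ℝ)
    (i j : Fin n) : ℝ :=
  alpha η i + beta η j + Z i j ⬝ᵥ γ

/-- The log-likelihood of the graph `a`; its terms run over the ordered pairs `i ≠ j`. -/
def logLik {n p : ℕ} (Z : Fin n → Fin n → Fin p → ℝ) (a : Adj n) (η : Idx n → ℝ)
    (γ : Fin p → ℝ) : ℝ :=
  ∑ i, ∑ j ∈ Finset.univ.erase i,
    ((if a i j = true then linPred Z η γ i j else 0)
      - Real.log (1 + Real.exp (linPred Z η γ i j)))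

/-- `(η, γ)` is an (unrestricted) maximum likelihood estimate for the graph `a`. -/
def IsMLE {n p : ℕ} (Z : Fin n → Fin n → Fin p → ℝ) (a : Adj n) (η : Idx n → ℝ)
    (γ : Fin p → ℝ) : Prop :=
  ∀ (η' : Idx n → ℝ) (γ' : Fin p → ℝ), logLik Z a η' γ' ≤ logLik Z a η γ

/-- `A` is a random directed graph without self-loops that follows the model with parameters
`(η, γ)`: the edge indicators are independent Bernoulli variables with success probabilities
`μ(π_{ij})`. -/
structure IsModel {n p : ℕ} {Ω : Type*} [MeasurableSpace Ω] (P : Measure Ω) (A : Ω → Adj n)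
    (Z : Fin n → Fin n → Fin p → ℝ) (η : Idx n → ℝ) (γ : Fin p → ℝ) : Prop where
  measurable : Measurable A
  no_loops : ∀ ω i, A ω i i = false
  indep : iIndepFun
    (fun (q : {q : Fin n × Fin n // q.1 ≠ q.2}) (ω : Ω) => A ω q.1.1 q.1.2) P
  prob : ∀ i j, i ≠ j →
    P {ω | A ω i j = true} = ENNReal.ofReal (mu (linPred Z η γ i j))

/-- `u_{ij} = μ'(π_{ij})` for `i ≠ j`, and `u_{ii} = 0`. -/
def u {n p : ℕ} (Z : Fin n → Fin n → Fin p → ℝ) (η : Idx n → ℝ) (γ : Fin p → ℝ)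
    (i j : Fin n) : ℝ :=
  if i = j then 0 else muDeriv (linPred Z η γ i j)

/-- The row sum `u_{i·}`. -/
def uRow {n p : ℕ} (Z : Fin n → Fin n → Fin p → ℝ) (η : Idx n → ℝ) (γ : Fin p → ℝ)
    (i : Fin n) : ℝ := ∑ j, u Z η γ i j

/-- The column sum `u_{·j}`. -/
def uCol {n p : ℕ} (Z : Fin n → Fin n → Fin p → ℝ) (η : Idx n → ℝ) (γ : Fin p → ℝ)
    (j : Fin n) : ℝ := ∑ i, u Z η γ i j

/-- The column sum `u_{·n}` of the last node. -/
def uLast {n p : ℕ} (Z : Fin n → Fin n → Fin p → ℝ) (η : Idx n → ℝ) (γ : Fin p → ℝ) : ℝ :=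
  if h : 0 < n then uCol Z η γ ⟨n - 1, Nat.sub_lt h Nat.one_pos⟩ else 0

/-- The inclusion of `{1, …, n-1}` into `{1, …, n}`. -/
def incl {n : ℕ} (j : Fin (n - 1)) : Fin n := Fin.castLE (Nat.sub_le n 1) j

/-- The Fisher information matrix `V` of the node parameter, which is also the Jacobian
`∂F/∂η` of the likelihood equations
`F_i = ∑_{k ≠ i} μ(π_{ik}) - d_i`, `F_{n+j} = ∑_{k ≠ j} μ(π_{kj}) - b_j`. -/
def V {n p : ℕ} (Z : Fin n → Fin n → Fin p → ℝ) (η : Idx n → ℝ) (γ : Fin p → ℝ) :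
    Matrix (Idx n) (Idx n) ℝ :=
  Matrix.fromBlocks
    (Matrix.diagonal (uRow Z η γ))
    (Matrix.of fun (i : Fin n) (j : Fin (n - 1)) => u Z η γ i (incl j))
    (Matrix.of fun (j : Fin (n - 1)) (i : Fin n) => u Z η γ i (incl j))
    (Matrix.diagonal fun j : Fin (n - 1) => uCol Z η γ (incl j))

/-- The approximate inverse `S` of `V`. -/
def S {n p : ℕ} (Z : Fin n → Fin n → Fin p → ℝ) (η : Idx n → ℝ) (γ : Fin p → ℝ) :
    Matrix (Idx n) (Idx n) ℝ :=
  Matrix.fromBlocks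
    (Matrix.of fun i j : Fin n => (if i = j then 1 / uRow Z η γ i else 0) + 1 / uLast Z η γ)
    (Matrix.of fun (_ : Fin n) (_ : Fin (n - 1)) => -(1 / uLast Z η γ))
    (Matrix.of fun (_ : Fin (n - 1)) (_ : Fin n) => -(1 / uLast Z η γ))
    (Matrix.of fun i j : Fin (n - 1) =>
      (if i = j then 1 / uCol Z η γ (incl j) else 0) + 1 / uLast Z η γ)

/-- The Jacobian `∂F/∂γ`; its transpose is `∂Q/∂η`, where
`Q = ∑_{i ≠ j} Z_{ij} (μ(π_{ij}) - a_{ij})`. -/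
def Vηγ {n p : ℕ} (Z : Fin n → Fin n → Fin p → ℝ) (η : Idx n → ℝ) (γ : Fin p → ℝ) :
    Matrix (Idx n) (Fin p) ℝ :=
  Matrix.of fun r l =>
    Sum.elim (fun i : Fin n => ∑ j, u Z η γ i j * Z i j l)
      (fun j : Fin (n - 1) => ∑ i, u Z η γ i (incl j) * Z i (incl j) l) r

/-- The Jacobian `∂Q/∂γ`. -/
def Vγγ {n p : ℕ} (Z : Fin n → Fin n → Fin p → ℝ) (η : Idx n → ℝ) (γ : Fin p → ℝ) :
    Matrix (Fin p) (Fin p) ℝ :=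
  Matrix.of fun l m => ∑ i, ∑ j, u Z η γ i j * Z i j l * Z i j m

/-- `H = ∂Q/∂γ - ∂Q/∂η (∂F/∂η)⁻¹ ∂F/∂γ`, the Fisher information matrix of the profiled
log-likelihood. -/
def H {n p : ℕ} (Z : Fin n → Fin n → Fin p → ℝ) (η : Idx n → ℝ) (γ : Fin p → ℝ) :
    Matrix (Fin p) (Fin p) ℝ :=
  Vγγ Z η γ - (Vηγ Z η γ)ᵀ * (V Z η γ)⁻¹ * Vηγ Z η γ

/-- `z_max`, the largest absolute value of a covariate. -/
def zmax {n p : ℕ} (Z : Fin n → Fin n → Fin p → ℝ) : ℝ :=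
  ⨆ q : {q : Fin n × Fin n // q.1 ≠ q.2}, ‖Z q.1.1 q.1.2‖

/-- `b_n`: the supremum of `(1 + e^{π_{ij}})^2 / e^{π_{ij}}` over all pairs `i ≠ j` and all
`(η, γ)` in the closed sup-norm balls of radii `ε₁` and `ε₂` around `(η₀, γ₀)`. -/
def bn {n p : ℕ} (Z : Fin n → Fin n → Fin p → ℝ) (η₀ : Idx n → ℝ) (γ₀ : Fin p → ℝ)
    (ε₁ ε₂ : ℝ) : ℝ :=
  sSup {x : ℝ | ∃ η ∈ Metric.closedBall η₀ ε₁, ∃ γ ∈ Metric.closedBall γ₀ ε₂,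
    ∃ i j : Fin n, i ≠ j ∧
      x = (1 + Real.exp (linPred Z η γ i j)) ^ 2 / Real.exp (linPred Z η γ i j)}

section
attribute [local instance] Matrix.linftyOpNormedAddCommGroup

/-- The matrix norm induced by the sup norm on vectors (the maximal absolute row sum). -/
def infNorm {p : ℕ} (M : Matrix (Fin p) (Fin p) ℝ) : ℝ := ‖M‖

end

/-- The first `k` coordinates of a node parameter (used for `k ≤ n`). -/
def firstCoords {n : ℕ} (k : ℕ) (η : Idx n → ℝ) (i : Fin k) : ℝ :=
  if h : k ≤ n then η (Sum.inl (Fin.castLE h i)) else 0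

/-- The upper left `k × k` block of a matrix (used for `k ≤ n`). -/
def upperLeft {n : ℕ} (k : ℕ) (M : Matrix (Idx n) (Idx n) ℝ) : Matrix (Fin k) (Fin k) ℝ :=
  Matrix.of fun i j =>
    if h : k ≤ n then M (Sum.inl (Fin.castLE h i)) (Sum.inl (Fin.castLE h j)) else 0

/-- The random vectors `X n` in `ℝ^k` are asymptotically normal with mean `0` and covariance
matrices `C n`: eventually `C n` is positive definite, and `(C n)^{-1/2} X n` converges in
distribution to the standard normal law on `ℝ^k`. -/
def AsympNormal {k : ℕ} {Ω : ℕ → Type*} [∀ n, MeasurableSpace (Ω n)]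
    (P : ∀ n, Measure (Ω n)) [∀ n, IsProbabilityMeasure (P n)]
    (X : ∀ n, Ω n → Fin k → ℝ) (C : ℕ → Matrix (Fin k) (Fin k) ℝ) : Prop :=
  (∀ᶠ n in atTop, (C n).PosDef) ∧
  TendstoInDistribution
    (fun n ω => (WithLp.toLp 2 ((CFC.sqrt (C n))⁻¹ *ᵥ X n ω) : EuclideanSpace ℝ (Fin k)))
    atTop id P (stdGaussian (EuclideanSpace ℝ (Fin k)))

end CovP0

end

/-!
Linearizing the likelihood equations at the true parameter, their solutions are the fixed points
of `θ ↦ I⁻¹ (score - remainder θ)`, where `I` is the Fisher information of the full parameter. In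
the sup norm `I⁻¹` is controlled by `κ` and by the two-way additive structure of `V`: the row
equations of `V x = y` contract the oscillation of the column part of `x`, and conversely.
Subtracting from the residuals their weighted row and column means removes the leading part of the
score, and by Hoeffding's inequality the rest has size `√(log n) / n`. Hence, outside an event of
vanishing probability, the map above is a contraction of a small ball; by strict concavity its
fixed point is the only maximum likelihood estimate, and `α̂_i - α_i` equals the weighted mean of
the residuals in row `i` plus the one in column `n`, up to `o(n^{-1/2})`. These sums of
independent variables have covariance close to `S_k`, so a comparison of characteristic functions
yields the normal limit.
-/

namespace CovP0

/-! ### The logistic function -/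

lemma mu_eq_sigmoid : mu = Real.sigmoid := by
  ext x
  rw [mu, Real.sigmoid_def, Real.exp_neg]
  field_simp
  ring

lemma muDeriv_eq_mu_mul (x : ℝ) : muDeriv x = mu x * (1 - mu x) := by
  unfold mu muDeriv
  field_simp
  ring

lemma mu_pos (x : ℝ) : 0 < mu x := mu_eq_sigmoid ▸ Real.sigmoid_pos x

lemma mu_lt_one (x : ℝ) : mu x < 1 := mu_eq_sigmoid ▸ Real.sigmoid_lt_one x

lemma hasDerivAt_mu (x : ℝ) : HasDerivAt mu (muDeriv x) x := by
  rw [muDeriv_eq_mu_mul, mu_eq_sigmoid]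
  exact Real.hasDerivAt_sigmoid x

lemma muDeriv_pos (x : ℝ) : 0 < muDeriv x := by
  unfold muDeriv
  positivity

lemma muDeriv_le_quarter (x : ℝ) : muDeriv x ≤ 1 / 4 := by
  rw [muDeriv_eq_mu_mul]
  linarith [sq_nonneg (mu x - 1 / 2)]

lemma inv_muDeriv (x : ℝ) : (muDeriv x)⁻¹ = Real.exp x + 2 + Real.exp (-x) := by
  rw [muDeriv, Real.exp_neg]
  field_simp
  ring

lemma muDeriv_le_exp_mul (x y : ℝ) : muDeriv y ≤ Real.exp |y - x| * muDeriv x := by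
  have exp_pos_part : Real.exp x ≤ Real.exp |y - x| * Real.exp y := by
    rw [← Real.exp_add]
    gcongr
    linarith [neg_abs_le (y - x)]
  have exp_neg_part : Real.exp (-x) ≤ Real.exp |y - x| * Real.exp (-y) := by
    rw [← Real.exp_add]
    gcongr
    linarith [le_abs_self (y - x)]
  have inv_le : (muDeriv x)⁻¹ ≤ Real.exp |y - x| * (muDeriv y)⁻¹ := by
    rw [inv_muDeriv, inv_muDeriv]
    linarith [Real.one_le_exp (abs_nonneg (y - x))]
  rwa [← div_eq_mul_inv, le_div_iff₀ (muDeriv_pos y), inv_mul_le_iff₀ (muDeriv_pos x), mul_comm]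
    at inv_le

lemma abs_muDeriv_sub_le {x y ρ : ℝ} (h : |y - x| ≤ ρ) (hρ : ρ ≤ 1) :
    |muDeriv y - muDeriv x| ≤ 2 * ρ * muDeriv x := by
  have exp_le : Real.exp |y - x| ≤ 1 + 2 * ρ := by
    have := Real.abs_exp_sub_one_le (x := |y - x|) (by rw [abs_abs]; linarith)
    rw [abs_abs] at this
    linarith [le_abs_self (Real.exp |y - x| - 1)]
  have upper := muDeriv_le_exp_mul x y
  have lower : Real.exp (-|y - x|) * muDeriv x ≤ muDeriv y := by
    rw [Real.exp_neg, inv_mul_le_iff₀ (Real.exp_pos _), abs_sub_comm]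
    exact muDeriv_le_exp_mul y x
  have le_exp_neg := Real.one_sub_le_exp_neg |y - x|
  have := muDeriv_pos x
  rw [abs_le]
  constructor <;> nlinarith [abs_nonneg (y - x)]

lemma abs_mu_sub_mu_sub_le {x₀ x y ρ : ℝ} (hx : |x - x₀| ≤ ρ) (hy : |y - x₀| ≤ ρ) (hρ : ρ ≤ 1) :
    |mu x - mu y - muDeriv x₀ * (x - y)| ≤ 2 * ρ * muDeriv x₀ * |x - y| := by
  have mem_Icc {z : ℝ} (hz : |z - x₀| ≤ ρ) : z ∈ Set.Icc (x₀ - ρ) (x₀ + ρ) := by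
    rw [abs_le] at hz
    constructor <;> linarith
  have mean_value := (convex_Icc (x₀ - ρ) (x₀ + ρ)).norm_image_sub_le_of_norm_hasDerivWithin_le
    (f := fun z => mu z - muDeriv x₀ * z) (f' := fun z => muDeriv z - muDeriv x₀)
    (C := 2 * ρ * muDeriv x₀)
    (fun z _ => by
      simpa using! ((hasDerivAt_mu z).sub
        ((hasDerivAt_id z).const_mul (muDeriv x₀))).hasDerivWithinAt)
    (fun z hz => abs_muDeriv_sub_le (abs_le.2 ⟨by linarith [hz.1], by linarith [hz.2]⟩) hρ)
    (mem_Icc hy) (mem_Icc hx)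
  rw [Real.norm_eq_abs, Real.norm_eq_abs] at mean_value
  convert mean_value using 2
  ring

lemma log_one_add_exp_add_mu_mul_lt {x y : ℝ} (h : y ≠ x) :
    Real.log (1 + Real.exp x) + mu x * (y - x) < Real.log (1 + Real.exp y) := by
  have convexity : Real.exp (mu x * (y - x)) < 1 - mu x + mu x * Real.exp (y - x) := by
    simpa using strictConvexOn_exp.2 (Set.mem_univ 0) (Set.mem_univ (y - x)) (sub_ne_zero.2 h).symm
      (sub_pos.2 (mu_lt_one x)) (mu_pos x) (by ring)
  have ratio : 1 - mu x + mu x * Real.exp (y - x) = (1 + Real.exp y) / (1 + Real.exp x) := by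
    rw [mu, Real.exp_sub]
    field_simp
    ring
  rw [ratio, ← Real.lt_log_iff_exp_lt (by positivity),
    Real.log_div (by positivity) (by positivity)] at convexity
  linarith

/-! ### Two-way additive systems -/

section TwoWay

variable {ι : Type*} [Fintype ι]

/- The common mass `c` on `s` cancels from the two averages; only the rest sees the oscillation. -/
lemma weighted_average_sub_le {p q y : ι → ℝ} {c R : ℝ} (s : Finset ι) (hp : ∀ j, 0 ≤ p j)
    (hq : ∀ j, 0 ≤ q j) (hp_sum : ∑ j, p j = 1) (hq_sum : ∑ j, q j = 1) (hps : ∀ j ∈ s, c ≤ p j)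
    (hqs : ∀ j ∈ s, c ≤ q j) (hy : ∀ j k, y j - y k ≤ R) :
    ∑ j, p j * y j - ∑ j, q j * y j ≤ (1 - c * s.card) * R := by
  have : Nonempty ι := by
    by_contra h
    simp [not_nonempty_iff.1 h] at hp_sum
  obtain ⟨a, ha⟩ := Finite.exists_max y
  obtain ⟨b, hb⟩ := Finite.exists_min y
  have mass_le_one : c * s.card ≤ 1 := by
    have := (Finset.sum_le_sum hps).trans (Finset.sum_le_univ_sum_of_nonneg hp)
    rwa [Finset.sum_const, nsmul_eq_mul, hp_sum, mul_comm] at this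
  have below_max : ∑ j ∈ s, c * (y a - y j) ≤ ∑ j, p j * (y a - y j) :=
    (Finset.sum_le_sum fun j hj =>
      mul_le_mul_of_nonneg_right (hps j hj) (sub_nonneg.2 (ha j))).trans
      (Finset.sum_le_univ_sum_of_nonneg fun j => mul_nonneg (hp j) (sub_nonneg.2 (ha j)))
  have above_min : ∑ j ∈ s, c * (y j - y b) ≤ ∑ j, q j * (y j - y b) :=
    (Finset.sum_le_sum fun j hj =>
      mul_le_mul_of_nonneg_right (hqs j hj) (sub_nonneg.2 (hb j))).trans
      (Finset.sum_le_univ_sum_of_nonneg fun j => mul_nonneg (hq j) (sub_nonneg.2 (hb j)))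
  have on_s : ∑ j ∈ s, c * (y a - y j) + ∑ j ∈ s, c * (y j - y b) = c * s.card * (y a - y b) := by
    rw [← Finset.sum_add_distrib, Finset.sum_congr rfl (g := fun _ => c * (y a - y b))
      (fun j _ => by ring), Finset.sum_const, nsmul_eq_mul]
    ring
  simp only [mul_sub, Finset.sum_sub_distrib, ← Finset.sum_mul, hp_sum, hq_sum, one_mul]
    at below_max above_min
  simp only [mul_sub, Finset.sum_sub_distrib, ← Finset.sum_mul] at on_s
  have := mul_le_mul_of_nonneg_left (hy a b) (sub_nonneg.2 mass_le_one)
  linarith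

lemma abs_add_weighted_average_le {w y : ι → ℝ} {x δ : ℝ} (hw : 0 < ∑ j, w j)
    (h : |∑ j, w j * (x + y j)| ≤ δ * ∑ j, w j) :
    |x + ∑ j, w j / (∑ j, w j) * y j| ≤ δ := by
  have average_eq : x + ∑ j, w j / (∑ j, w j) * y j = (∑ j, w j * (x + y j)) / ∑ j, w j := by
    simp only [mul_add, Finset.sum_add_distrib, ← Finset.sum_mul, add_div, div_mul_eq_mul_div,
      ← Finset.sum_div]
    field_simp
  rwa [average_eq, abs_div, abs_of_pos hw, div_le_iff₀ hw]

lemma sum_pos_of_offDiag [Nontrivial ι] {w : ι → ι → ℝ} {m : ℝ} (hm : 0 < m)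
    (hw : ∀ i j, 0 ≤ w i j) (hwm : ∀ i j, i ≠ j → m ≤ w i j) (i : ι) : 0 < ∑ j, w i j := by
  obtain ⟨j, hj⟩ := exists_ne i
  exact Finset.sum_pos' (fun j _ => hw i j) ⟨j, Finset.mem_univ _, hm.trans_le (hwm i j hj.symm)⟩

variable {w : ι → ι → ℝ} {m L δ : ℝ} {x y : ι → ℝ}

lemma div_mul_card_le_div_sum (hm : 0 ≤ m) {i j : ι} (hwL : ∀ j, w i j ≤ L)
    (hsum : 0 < ∑ j, w i j) (hwm : m ≤ w i j) :
    m / (L * Fintype.card ι) ≤ w i j / ∑ j, w i j := by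
  have sum_le : ∑ j, w i j ≤ L * Fintype.card ι := by
    refine (Finset.sum_le_sum fun j _ => hwL j).trans_eq ?_
    rw [Finset.sum_const, Finset.card_univ, nsmul_eq_mul, mul_comm]
  have : 0 ≤ w i j := hm.trans hwm
  gcongr

lemma half_card_le_card_compl_pair [DecidableEq ι] (hι : 4 ≤ Fintype.card ι) (i k : ι) :
    (Fintype.card ι : ℝ) / 2 ≤ (({i, k} : Finset ι)ᶜ.card : ℝ) := by
  have card_pair : ({i, k} : Finset ι).card ≤ 2 := Finset.card_le_two
  have card_compl := Finset.card_compl ({i, k} : Finset ι)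
  have : Fintype.card ι ≤ 2 * ({i, k} : Finset ι)ᶜ.card := by omega
  have : (Fintype.card ι : ℝ) ≤ 2 * ({i, k} : Finset ι)ᶜ.card := by exact_mod_cast this
  linarith

lemma sub_le_of_row_equations (hι : 4 ≤ Fintype.card ι) (hm : 0 < m) (hw : ∀ i j, 0 ≤ w i j)
    (hwL : ∀ i j, w i j ≤ L) (hwm : ∀ i j, i ≠ j → m ≤ w i j)
    (hrow : ∀ i, |∑ j, w i j * (x i + y j)| ≤ δ * ∑ j, w i j) {R : ℝ}
    (hy : ∀ j k, y j - y k ≤ R) (i k : ι) :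
    x i - x k ≤ 2 * δ + (1 - m / (2 * L)) * R := by
  classical
  have : Nontrivial ι := Fintype.one_lt_card_iff_nontrivial.1 (by omega)
  have hsum := sum_pos_of_offDiag hm hw hwm
  have hL : 0 < L := by
    obtain ⟨j, hj⟩ := exists_ne i
    exact hm.trans_le ((hwm i j hj.symm).trans (hwL i j))
  have hR : 0 ≤ R := by simpa using hy i i
  have averages_close := weighted_average_sub_le (p := fun j => w k j / ∑ j, w k j)
    (q := fun j => w i j / ∑ j, w i j) {i, k}ᶜ
    (fun j => div_nonneg (hw k j) (hsum k).le) (fun j => div_nonneg (hw i j) (hsum i).le)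
    (by rw [← Finset.sum_div, div_self (hsum k).ne'])
    (by rw [← Finset.sum_div, div_self (hsum i).ne'])
    (fun j hj => div_mul_card_le_div_sum hm.le (hwL k) (hsum k)
      (hwm k j (by rintro rfl; simp at hj)))
    (fun j hj => div_mul_card_le_div_sum hm.le (hwL i) (hsum i)
      (hwm i j (by rintro rfl; simp at hj))) hy
  have common_mass : m / (2 * L) ≤ m / (L * Fintype.card ι) * ({i, k} : Finset ι)ᶜ.card := by
    have : (0 : ℝ) < Fintype.card ι := by exact_mod_cast (by omega : 0 < Fintype.card ι)
    calc m / (2 * L) = m / (L * Fintype.card ι) * (Fintype.card ι / 2) := by field_simp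
      _ ≤ _ := by gcongr; exact half_card_le_card_compl_pair hι i k
  have contraction := mul_le_mul_of_nonneg_right (sub_le_sub_left common_mass 1) hR
  have near_i := abs_le.1 (abs_add_weighted_average_le (hsum i) (hrow i))
  have near_k := abs_le.1 (abs_add_weighted_average_le (hsum k) (hrow k))
  linarith [near_i.2, near_k.1]

/- The row equations bound the oscillation of `x` by a strict contraction of that of `y`, and the
column equations conversely; combining the two bounds both oscillations. -/
lemma sub_le_of_two_way (hι : 4 ≤ Fintype.card ι) (hm : 0 < m) (hw : ∀ i j, 0 ≤ w i j)
    (hwL : ∀ i j, w i j ≤ L) (hwm : ∀ i j, i ≠ j → m ≤ w i j)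
    (hrow : ∀ i, |∑ j, w i j * (x i + y j)| ≤ δ * ∑ j, w i j)
    (hcol : ∀ j, |∑ i, w i j * (x i + y j)| ≤ δ * ∑ i, w i j) (j k : ι) :
    y j - y k ≤ 8 * L * δ / m := by
  have : Nonempty ι := ⟨j⟩
  have : Nontrivial ι := Fintype.one_lt_card_iff_nontrivial.1 (by omega)
  obtain ⟨a, ha⟩ := Finite.exists_max x
  obtain ⟨b, hb⟩ := Finite.exists_min x
  obtain ⟨c, hc⟩ := Finite.exists_max y
  obtain ⟨d, hd⟩ := Finite.exists_min y
  have osc_x := sub_le_of_row_equations hι hm hw hwL hwm hrow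
    (R := y c - y d) (fun i k => by linarith [hc i, hd k]) a b
  have osc_y := sub_le_of_row_equations (w := fun i j => w j i) (x := y) (y := x) hι hm
    (fun i j => hw j i) (fun i j => hwL j i) (fun i j h => hwm j i h.symm)
    (fun i => by simpa only [add_comm] using hcol i)
    (R := x a - x b) (fun i k => by linarith [ha i, hb k]) c d
  have hL : 0 < L := by
    obtain ⟨l, hl⟩ := exists_ne j
    exact hm.trans_le ((hwm j l hl.symm).trans (hwL j l))
  have osc_sum : m / (2 * L) * ((x a - x b) + (y c - y d)) ≤ 4 * δ := by linarith
  have osc_y_le : m / (2 * L) * (y c - y d) ≤ 4 * δ :=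
    (mul_le_mul_of_nonneg_left (by linarith [hb a]) (by positivity)).trans osc_sum
  calc y j - y k ≤ y c - y d := by linarith [hc j, hd k]
    _ ≤ 4 * δ / (m / (2 * L)) := by rwa [le_div_iff₀' (by positivity)]
    _ = 8 * L * δ / m := by field_simp; ring

lemma abs_le_of_two_way (hι : 4 ≤ Fintype.card ι) (hm : 0 < m) (hw : ∀ i j, 0 ≤ w i j)
    (hwL : ∀ i j, w i j ≤ L) (hwm : ∀ i j, i ≠ j → m ≤ w i j)
    (hrow : ∀ i, |∑ j, w i j * (x i + y j)| ≤ δ * ∑ j, w i j)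
    (hcol : ∀ j, |∑ i, w i j * (x i + y j)| ≤ δ * ∑ i, w i j) {j₀ : ι} (hy₀ : y j₀ = 0) :
    (∀ i, |x i| ≤ 9 * L * δ / m) ∧ ∀ j, |y j| ≤ 9 * L * δ / m := by
  have : Nontrivial ι := Fintype.one_lt_card_iff_nontrivial.1 (by omega)
  have hsum := sum_pos_of_offDiag hm hw hwm
  have hδ : 0 ≤ δ := nonneg_of_mul_nonneg_left ((abs_nonneg _).trans (hrow j₀)) (hsum j₀)
  have hL : m ≤ L := by
    obtain ⟨j, hj⟩ := exists_ne j₀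
    exact (hwm j₀ j hj.symm).trans (hwL j₀ j)
  have δ_le : δ ≤ L * δ / m := by
    rw [le_div_iff₀ hm, mul_comm]
    exact mul_le_mul_of_nonneg_right hL hδ
  have sum_bound : 8 * L * δ / m + L * δ / m = 9 * L * δ / m := by ring
  have hy (j : ι) : |y j| ≤ 8 * L * δ / m := by
    have upper := sub_le_of_two_way hι hm hw hwL hwm hrow hcol j j₀
    have lower := sub_le_of_two_way hι hm hw hwL hwm hrow hcol j₀ j
    rw [abs_le]
    constructor <;> linarith
  have average_le (i : ι) : |∑ j, w i j / (∑ j, w i j) * y j| ≤ 8 * L * δ / m := by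
    refine (Finset.abs_sum_le_sum_abs _ _).trans ?_
    calc ∑ j, |w i j / (∑ j, w i j) * y j|
        ≤ ∑ j, w i j / (∑ j, w i j) * (8 * L * δ / m) := by
          gcongr with j
          rw [abs_mul, abs_of_nonneg (div_nonneg (hw i j) (hsum i).le)]
          exact mul_le_mul_of_nonneg_left (hy j) (div_nonneg (hw i j) (hsum i).le)
      _ = 8 * L * δ / m := by
          rw [← Finset.sum_mul, ← Finset.sum_div, div_self (hsum i).ne', one_mul]
  refine ⟨fun i => ?_, fun j => (hy j).trans (by linarith)⟩
  have near := abs_le.1 (abs_add_weighted_average_le (hsum i) (hrow i))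
  have average := abs_le.1 (average_le i)
  rw [abs_le]
  constructor <;> linarith [near.1, near.2, average.1, average.2]

end TwoWay

/-! ### The linear predictor and the Fisher information -/

section LinearStructure

variable {n p : ℕ}

/-- The full parameter `(η, γ)`, with the sup norm. -/
abbrev Param (n p : ℕ) : Type := (Idx n → ℝ) × (Fin p → ℝ)

lemma beta_add (η η' : Idx n → ℝ) (j : Fin n) : beta (η + η') j = beta η j + beta η' j := by
  unfold beta
  split_ifs <;> simp

lemma beta_smul (c : ℝ) (η : Idx n → ℝ) (j : Fin n) : beta (c • η) j = c * beta η j := by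
  unfold beta
  split_ifs <;> simp

lemma beta_zero (j : Fin n) : beta (0 : Idx n → ℝ) j = 0 := by simp [beta]

lemma beta_last (η : Idx n → ℝ) {j : Fin n} (hj : (j : ℕ) = n - 1) : beta η j = 0 := by
  rw [beta, dif_neg (by omega)]

lemma beta_incl (η : Idx n → ℝ) (j : Fin (n - 1)) : beta η (incl j) = η (Sum.inr j) :=
  dif_pos j.isLt

lemma abs_alpha_le (η : Idx n → ℝ) (i : Fin n) : |alpha η i| ≤ ‖η‖ := norm_le_pi_norm η _

lemma abs_beta_le (η : Idx n → ℝ) (j : Fin n) : |beta η j| ≤ ‖η‖ := by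
  unfold beta
  split_ifs
  · exact norm_le_pi_norm η _
  · simp

lemma sum_eq_sum_incl_add_last {E : Type*} [AddCommMonoid E] {i : Fin n} (hi : (i : ℕ) = n - 1)
    (f : Fin n → E) : ∑ j, f j = ∑ j : Fin (n - 1), f (incl j) + f i := by
  obtain ⟨m, rfl⟩ : ∃ m, n = m + 1 := ⟨n - 1, by have := i.2; omega⟩
  obtain rfl : i = Fin.last m := Fin.ext hi
  exact Fin.sum_univ_castSucc f

lemma sum_mul_beta (f : Fin n → ℝ) (η : Idx n → ℝ) :
    ∑ j, f j * beta η j = ∑ j : Fin (n - 1), f (incl j) * η (Sum.inr j) := by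
  rcases Nat.eq_zero_or_pos n with rfl | hn
  · simp
  · rw [sum_eq_sum_incl_add_last (i := ⟨n - 1, by omega⟩) rfl, beta_last η rfl]
    simp [beta_incl]

lemma sum_mul_dotProduct {ι m R : Type*} [Fintype m] [CommSemiring R] (s : Finset ι) (c : ι → R)
    (f : ι → m → R) (v : m → R) :
    ∑ i ∈ s, c i * (f i ⬝ᵥ v) = (fun l => ∑ i ∈ s, c i * f i l) ⬝ᵥ v := by
  simp only [dotProduct, Finset.mul_sum, Finset.sum_mul, mul_assoc]
  exact Finset.sum_comm

/-- The linear predictor as a linear map of the parameter. -/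
def linPredMap (Z : Fin n → Fin n → Fin p → ℝ) : Param n p →ₗ[ℝ] Fin n → Fin n → ℝ where
  toFun θ := linPred Z θ.1 θ.2
  map_add' θ θ' := by
    ext i j
    simp only [linPred, alpha, Prod.fst_add, Prod.snd_add, beta_add, Pi.add_apply, dotProduct_add]
    ring
  map_smul' c θ := by
    ext i j
    simp only [linPred, alpha, Prod.smul_fst, Prod.smul_snd, beta_smul, Pi.smul_apply,
      dotProduct_smul, smul_eq_mul, RingHom.id_apply]
    ring

lemma linPredMap_apply (Z : Fin n → Fin n → Fin p → ℝ) (θ : Param n p) (i j : Fin n) :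
    linPredMap Z θ i j = linPred Z θ.1 θ.2 i j := rfl

/-- The transpose of `linPredMap`: the row sums, the column sums (except the last one) and the
covariate sums of an array. Applied to the adjacency matrix it gives the sufficient statistic. -/
def linPredTranspose (Z : Fin n → Fin n → Fin p → ℝ) : (Fin n → Fin n → ℝ) →ₗ[ℝ] Param n p where
  toFun w := (Sum.elim (fun i => ∑ j, w i j) (fun j => ∑ i, w i (incl j)),
    fun l => ∑ i, ∑ j, w i j * Z i j l)
  map_add' w w' := by
    ext x
    · rcases x with x | x <;> simp [Finset.sum_add_distrib]
    · simp [Finset.sum_add_distrib, add_mul]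
  map_smul' c w := by
    ext x
    · rcases x with x | x <;> simp [Finset.mul_sum]
    · simp [Finset.mul_sum, mul_assoc]

lemma linPredTranspose_inl (Z : Fin n → Fin n → Fin p → ℝ) (w : Fin n → Fin n → ℝ) (i : Fin n) :
    (linPredTranspose Z w).1 (Sum.inl i) = ∑ j, w i j := rfl

lemma linPredTranspose_inr (Z : Fin n → Fin n → Fin p → ℝ) (w : Fin n → Fin n → ℝ)
    (j : Fin (n - 1)) : (linPredTranspose Z w).1 (Sum.inr j) = ∑ i, w i (incl j) := rfl

lemma linPredTranspose_snd (Z : Fin n → Fin n → Fin p → ℝ) (w : Fin n → Fin n → ℝ) (l : Fin p) :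
    (linPredTranspose Z w).2 l = ∑ i, ∑ j, w i j * Z i j l := rfl

lemma sum_mul_linPredMap (Z : Fin n → Fin n → Fin p → ℝ) (w : Fin n → Fin n → ℝ)
    (θ : Param n p) :
    ∑ i, ∑ j, w i j * linPredMap Z θ i j
      = (linPredTranspose Z w).1 ⬝ᵥ θ.1 + (linPredTranspose Z w).2 ⬝ᵥ θ.2 := by
  have beta_part : ∑ i, ∑ j, w i j * beta θ.1 j
      = ∑ j : Fin (n - 1), (∑ i, w i (incl j)) * θ.1 (Sum.inr j) := by
    rw [Finset.sum_comm, ← sum_mul_beta (fun j => ∑ i, w i j)]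
    simp only [Finset.sum_mul]
  have covariate_part : ∑ i, ∑ j, w i j * (Z i j ⬝ᵥ θ.2) = (linPredTranspose Z w).2 ⬝ᵥ θ.2 := by
    simp only [sum_mul_dotProduct, ← sum_dotProduct]
    congr 1
    ext l
    rw [Finset.sum_apply, linPredTranspose_snd]
  simp only [linPredMap_apply, linPred, mul_add, Finset.sum_add_distrib, beta_part, covariate_part]
  simp only [dotProduct, Fintype.sum_sum_type, linPredTranspose_inl, linPredTranspose_inr, alpha,
    Finset.sum_mul]

/- The last column sum is the total minus the other ones, and the total is read off the rows. -/
lemma sum_col_eq_of_linPredTranspose_fst_eq {Z : Fin n → Fin n → Fin p → ℝ}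
    {w w' : Fin n → Fin n → ℝ} (h : (linPredTranspose Z w).1 = (linPredTranspose Z w').1)
    (j : Fin n) : ∑ i, w i j = ∑ i, w' i j := by
  have rows (i : Fin n) : ∑ j, w i j = ∑ j, w' i j := congrFun h (Sum.inl i)
  have cols (j : Fin (n - 1)) : ∑ i, w i (incl j) = ∑ i, w' i (incl j) := congrFun h (Sum.inr j)
  by_cases hj : (j : ℕ) < n - 1
  · exact cols ⟨j, hj⟩
  · have hj' : (j : ℕ) = n - 1 := by have := j.2; omega
    have total : ∑ j, ∑ i, w i j = ∑ j, ∑ i, w' i j := by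
      rw [Finset.sum_comm, Finset.sum_congr rfl fun i _ => rows i, Finset.sum_comm]
    rw [sum_eq_sum_incl_add_last hj' (fun j => ∑ i, w i j),
      sum_eq_sum_incl_add_last hj' (fun j => ∑ i, w' i j),
      Finset.sum_congr rfl fun j _ => cols j] at total
    exact add_left_cancel total

variable {Z : Fin n → Fin n → Fin p → ℝ} {η₀ : Idx n → ℝ} {γ₀ : Fin p → ℝ}

/-- The Fisher information of the full parameter at `(η₀, γ₀)`, as a linear map; its blocks are
`V`, `Vηγ` and `Vγγ`. -/
noncomputable def fisherInfo (Z : Fin n → Fin n → Fin p → ℝ) (η₀ : Idx n → ℝ) (γ₀ : Fin p → ℝ) :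
    Param n p →ₗ[ℝ] Param n p :=
  linPredTranspose Z ∘ₗ LinearMap.mulLeft ℝ (u Z η₀ γ₀) ∘ₗ linPredMap Z

lemma fisherInfo_apply (θ : Param n p) :
    fisherInfo Z η₀ γ₀ θ = linPredTranspose Z (fun i j => u Z η₀ γ₀ i j * linPredMap Z θ i j) :=
  rfl

lemma fisherInfo_eta_fst (η : Idx n → ℝ) : (fisherInfo Z η₀ γ₀ (η, 0)).1 = V Z η₀ γ₀ *ᵥ η := by
  ext x
  rw [fisherInfo_apply]
  rcases x with i | j
  · rw [linPredTranspose_inl]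
    simp only [linPredMap_apply, linPred, dotProduct_zero, add_zero, mul_add,
      Finset.sum_add_distrib, sum_mul_beta, ← Finset.sum_mul]
    simp [V, Matrix.mulVec, dotProduct, Fintype.sum_sum_type, Matrix.diagonal_apply, alpha, uRow]
  · rw [linPredTranspose_inr]
    simp only [linPredMap_apply, linPred, dotProduct_zero, add_zero, mul_add,
      Finset.sum_add_distrib, ← Finset.sum_mul, beta_incl]
    simp [V, Matrix.mulVec, dotProduct, Fintype.sum_sum_type, Matrix.diagonal_apply, alpha, uCol]

lemma linPredMap_gamma (γ : Fin p → ℝ) (i j : Fin n) : linPredMap Z (0, γ) i j = Z i j ⬝ᵥ γ := by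
  simp [linPredMap_apply, linPred, alpha, beta_zero]

lemma fisherInfo_gamma_fst (γ : Fin p → ℝ) :
    (fisherInfo Z η₀ γ₀ (0, γ)).1 = Vηγ Z η₀ γ₀ *ᵥ γ := by
  ext x
  rw [fisherInfo_apply]
  rcases x with i | j
  · simp only [linPredTranspose_inl, linPredMap_gamma, sum_mul_dotProduct]
    rfl
  · simp only [linPredTranspose_inr, linPredMap_gamma, sum_mul_dotProduct]
    rfl

lemma fisherInfo_eta_snd (η : Idx n → ℝ) :
    (fisherInfo Z η₀ γ₀ (η, 0)).2 = (Vηγ Z η₀ γ₀)ᵀ *ᵥ η := by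
  ext l
  rw [fisherInfo_apply, linPredTranspose_snd]
  calc ∑ i, ∑ j, u Z η₀ γ₀ i j * linPredMap Z (η, 0) i j * Z i j l
      = ∑ i, ∑ j, u Z η₀ γ₀ i j * Z i j l * linPredMap Z (η, 0) i j := by
        simp only [mul_right_comm]
    _ = ((Vηγ Z η₀ γ₀)ᵀ *ᵥ η) l := by
        rw [sum_mul_linPredMap, dotProduct_zero, add_zero]
        refine Finset.sum_congr rfl fun x _ => ?_
        rcases x with i | j <;> rfl

lemma fisherInfo_gamma_snd (γ : Fin p → ℝ) :
    (fisherInfo Z η₀ γ₀ (0, γ)).2 = Vγγ Z η₀ γ₀ *ᵥ γ := by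
  ext l
  rw [fisherInfo_apply, linPredTranspose_snd]
  simp only [linPredMap_gamma, mul_right_comm, sum_mul_dotProduct, ← sum_dotProduct]
  simp only [Vγγ, Matrix.mulVec, Matrix.of_apply]
  congr 1
  ext m
  simp only [Finset.sum_apply]

lemma fisherInfo_eq (θ : Param n p) :
    fisherInfo Z η₀ γ₀ θ = (V Z η₀ γ₀ *ᵥ θ.1 + Vηγ Z η₀ γ₀ *ᵥ θ.2,
      (Vηγ Z η₀ γ₀)ᵀ *ᵥ θ.1 + Vγγ Z η₀ γ₀ *ᵥ θ.2) := by
  have split : θ = (θ.1, 0) + (0, θ.2) := by simp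
  rw [← fisherInfo_eta_fst, ← fisherInfo_gamma_fst, ← fisherInfo_eta_snd, ← fisherInfo_gamma_snd]
  conv_lhs => rw [split, map_add]
  rfl

end LinearStructure

/-! ### Sup-norm bounds for the inverse Fisher information -/

section InverseInformation

variable {n p : ℕ} {Z : Fin n → Fin n → Fin p → ℝ} {η₀ : Idx n → ℝ} {γ₀ : Fin p → ℝ}

section infNorm

attribute [local instance] Matrix.linftyOpNormedAddCommGroup

lemma infNorm_nonneg (A : Matrix (Fin p) (Fin p) ℝ) : 0 ≤ infNorm A := norm_nonneg A

lemma norm_mulVec_le_infNorm_mul (A : Matrix (Fin p) (Fin p) ℝ) (v : Fin p → ℝ) :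
    ‖A *ᵥ v‖ ≤ infNorm A * ‖v‖ :=
  Matrix.linfty_opNorm_mulVec A v

end infNorm

lemma inv_mulVec_mulVec {ι : Type*} [Fintype ι] [DecidableEq ι] {A : Matrix ι ι ℝ} (hA : IsUnit A)
    (v : ι → ℝ) : A⁻¹ *ᵥ (A *ᵥ v) = v := by
  rw [Matrix.mulVec_mulVec, Matrix.nonsing_inv_mul _ ((Matrix.isUnit_iff_isUnit_det _).1 hA),
    Matrix.one_mulVec]

lemma mulVec_inv_mulVec {ι : Type*} [Fintype ι] [DecidableEq ι] {A : Matrix ι ι ℝ} (hA : IsUnit A)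
    (v : ι → ℝ) : A *ᵥ (A⁻¹ *ᵥ v) = v := by
  rw [Matrix.mulVec_mulVec, Matrix.mul_nonsing_inv _ ((Matrix.isUnit_iff_isUnit_det _).1 hA),
    Matrix.one_mulVec]

lemma abs_sum_sum_le_mul_sq {f : Fin n → Fin n → ℝ} {c : ℝ} (h : ∀ i j, |f i j| ≤ c) :
    |∑ i, ∑ j, f i j| ≤ c * (n : ℝ) ^ 2 :=
  calc |∑ i, ∑ j, f i j| ≤ ∑ i, ∑ j, |f i j| :=
        (Finset.abs_sum_le_sum_abs _ _).trans
          (Finset.sum_le_sum fun _ _ => Finset.abs_sum_le_sum_abs _ _)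
    _ ≤ ∑ _ : Fin n, ∑ _ : Fin n, c :=
        Finset.sum_le_sum fun i _ => Finset.sum_le_sum fun j _ => h i j
    _ = c * (n : ℝ) ^ 2 := by
        simp only [Finset.sum_const, Finset.card_univ, Fintype.card_fin, nsmul_eq_mul]
        ring

lemma abs_dotProduct_le {x y : Fin p → ℝ} {M : ℝ} (hx : ∀ l, |x l| ≤ M) :
    |x ⬝ᵥ y| ≤ p * M * ‖y‖ :=
  calc |x ⬝ᵥ y| ≤ ∑ l, |x l * y l| := Finset.abs_sum_le_sum_abs _ _
    _ ≤ ∑ _ : Fin p, M * ‖y‖ := Finset.sum_le_sum fun l _ => by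
        rw [abs_mul]
        exact mul_le_mul (hx l) (norm_le_pi_norm y l) (abs_nonneg _) ((abs_nonneg _).trans (hx l))
    _ = p * M * ‖y‖ := by
        simp only [Finset.sum_const, Finset.card_univ, Fintype.card_fin, nsmul_eq_mul]
        ring

lemma u_self (i : Fin n) : u Z η₀ γ₀ i i = 0 := if_pos rfl

lemma u_nonneg (i j : Fin n) : 0 ≤ u Z η₀ γ₀ i j := by
  unfold u
  split_ifs
  exacts [le_rfl, (muDeriv_pos _).le]

lemma u_le_quarter (i j : Fin n) : u Z η₀ γ₀ i j ≤ 1 / 4 := by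
  unfold u
  split_ifs
  exacts [by norm_num, muDeriv_le_quarter _]

lemma abs_u_mul_le {c x : ℝ} {i j : Fin n} (hx : i ≠ j → |x| ≤ c) :
    |u Z η₀ γ₀ i j * x| ≤ c * u Z η₀ γ₀ i j := by
  rw [abs_mul, abs_of_nonneg (u_nonneg i j), mul_comm]
  rcases eq_or_ne i j with rfl | hij
  · simp [u_self]
  · exact mul_le_mul_of_nonneg_right (hx hij) (u_nonneg i j)

lemma abs_u_mul_mul_le {c M x z : ℝ} (hc : 0 ≤ c) (hM : 0 ≤ M) {i j : Fin n}
    (hx : i ≠ j → |x| ≤ c) (hz : i ≠ j → |z| ≤ M) : |u Z η₀ γ₀ i j * x * z| ≤ 1 / 4 * M * c := by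
  rw [mul_assoc]
  refine (abs_u_mul_le (c := c * M) fun hij => ?_).trans ?_
  · rw [abs_mul]
    exact mul_le_mul (hx hij) (hz hij) (abs_nonneg _) hc
  · calc c * M * u Z η₀ γ₀ i j ≤ c * M * (1 / 4) := by gcongr; exact u_le_quarter i j
      _ = 1 / 4 * M * c := by ring

lemma abs_sum_row_u_mul_le {c : ℝ} {g : Fin n → Fin n → ℝ} (hg : ∀ i j, i ≠ j → |g i j| ≤ c)
    (i : Fin n) : |∑ j, u Z η₀ γ₀ i j * g i j| ≤ c * uRow Z η₀ γ₀ i := by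
  rw [uRow, Finset.mul_sum]
  exact (Finset.abs_sum_le_sum_abs _ _).trans (Finset.sum_le_sum fun j _ => abs_u_mul_le (hg i j))

lemma abs_sum_col_u_mul_le {c : ℝ} {g : Fin n → Fin n → ℝ} (hg : ∀ i j, i ≠ j → |g i j| ≤ c)
    (j : Fin n) : |∑ i, u Z η₀ γ₀ i j * g i j| ≤ c * uCol Z η₀ γ₀ j := by
  rw [uCol, Finset.mul_sum]
  exact (Finset.abs_sum_le_sum_abs _ _).trans (Finset.sum_le_sum fun i _ => abs_u_mul_le (hg i j))

lemma uRow_le (i : Fin n) : uRow Z η₀ γ₀ i ≤ n / 4 := by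
  refine (Finset.sum_le_sum fun j _ => u_le_quarter i j).trans_eq ?_
  rw [Finset.sum_const, Finset.card_univ, Fintype.card_fin, nsmul_eq_mul]
  ring

lemma linPredMap_eta (η : Idx n → ℝ) (i j : Fin n) :
    linPredMap Z (η, 0) i j = alpha η i + beta η j := by
  simp [linPredMap_apply, linPred]

lemma abs_linPredMap_eta_le (η : Idx n → ℝ) (i j : Fin n) :
    |linPredMap Z (η, 0) i j| ≤ 2 * ‖η‖ := by
  rw [linPredMap_eta]
  linarith [abs_add_le (alpha η i) (beta η j), abs_alpha_le η i, abs_beta_le η j]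

/-- The edge variances at `(η₀, γ₀)` are at least `1 / B`, on at least four nodes. -/
structure VarianceBound (Z : Fin n → Fin n → Fin p → ℝ) (η₀ : Idx n → ℝ) (γ₀ : Fin p → ℝ)
    (B : ℝ) : Prop where
  four_le : 4 ≤ n
  B_pos : 0 < B
  u_ge : ∀ i j, i ≠ j → 1 / B ≤ u Z η₀ γ₀ i j

/-- Quantitative regularity of the model at `(η₀, γ₀)`: the edge variances are at least `1 / B`,
the covariates are bounded by `M`, and the inverse profile information is at most `κ / n ^ 2`. -/
structure Regular (Z : Fin n → Fin n → Fin p → ℝ) (η₀ : Idx n → ℝ) (γ₀ : Fin p → ℝ)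
    (B M κ : ℝ) : Prop extends VarianceBound Z η₀ γ₀ B where
  one_le_p : 1 ≤ p
  one_le_M : 1 ≤ M
  Z_le : ∀ i j, i ≠ j → ∀ l, |Z i j l| ≤ M
  H_posDef : (H Z η₀ γ₀).PosDef
  H_inv_le : infNorm (H Z η₀ γ₀)⁻¹ ≤ κ / (n : ℝ) ^ 2

namespace VarianceBound

variable {B : ℝ}

lemma n_pos (h : VarianceBound Z η₀ γ₀ B) : (0 : ℝ) < n := by
  have := h.four_le
  exact_mod_cast (by omega : 0 < n)

lemma four_le_B (h : VarianceBound Z η₀ γ₀ B) : 4 ≤ B := by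
  have hn := h.four_le
  have := (h.u_ge ⟨0, by omega⟩ ⟨1, by omega⟩ (by simp)).trans (u_le_quarter _ _)
  rwa [div_le_div_iff₀ h.B_pos (by norm_num), one_mul, one_mul] at this

lemma norm_eta_le (h : VarianceBound Z η₀ γ₀ B) {η : Idx n → ℝ} {w : Fin n → Fin n → ℝ} {δ : ℝ}
    (hη : V Z η₀ γ₀ *ᵥ η = (linPredTranspose Z w).1)
    (hrow : ∀ i, |∑ j, w i j| ≤ δ * uRow Z η₀ γ₀ i)
    (hcol : ∀ j, |∑ i, w i j| ≤ δ * uCol Z η₀ γ₀ j) : ‖η‖ ≤ 9 / 4 * B * δ := by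
  have hn := h.four_le
  have hB := h.B_pos
  rw [← fisherInfo_eta_fst, fisherInfo_apply] at hη
  simp only [linPredMap_eta] at hη
  have row_eq (i : Fin n) : ∑ j, u Z η₀ γ₀ i j * (alpha η i + beta η j) = ∑ j, w i j :=
    congrFun hη (Sum.inl i)
  have col_eq := sum_col_eq_of_linPredTranspose_fst_eq hη
  have coord_le := abs_le_of_two_way (w := u Z η₀ γ₀) (L := 1 / 4) (x := alpha η) (y := beta η)
    (δ := δ) (j₀ := ⟨n - 1, by omega⟩) (by simpa using hn) (one_div_pos.2 hB) u_nonneg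
    u_le_quarter h.u_ge (fun i => (row_eq i).symm ▸ hrow i) (fun j => (col_eq j).symm ▸ hcol j)
    (beta_last η rfl)
  rw [show 9 * (1 / 4) * δ / (1 / B) = 9 / 4 * B * δ by field_simp] at coord_le
  refine (pi_norm_le_iff_of_nonneg ((abs_nonneg _).trans (coord_le.1 ⟨0, by omega⟩))).2 fun x => ?_
  rcases x with i | j
  · exact coord_le.1 i
  · exact beta_incl η j ▸ coord_le.2 (incl j)

lemma isUnit_V (h : VarianceBound Z η₀ γ₀ B) : IsUnit (V Z η₀ γ₀) := by
  rw [← Matrix.mulVec_injective_iff_isUnit]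
  refine (injective_iff_map_eq_zero (Matrix.mulVecLin (V Z η₀ γ₀))).2 fun η hη => ?_
  simpa using h.norm_eta_le (η := η) (w := 0) (δ := 0) (by rw [map_zero]; exact hη) (by simp)
    (by simp)

lemma sum_ge_of_offDiag (h : VarianceBound Z η₀ γ₀ B) {v : Fin n → ℝ} {i : Fin n}
    (hv : ∀ j, j ≠ i → 1 / B ≤ v j) (hvi : v i = 0) : n / (2 * B) ≤ ∑ j, v j := by
  have hB := h.B_pos
  have hn : (4 : ℝ) ≤ n := by exact_mod_cast h.four_le
  calc (n : ℝ) / (2 * B) ≤ (n - 1) * (1 / B) := by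
        rw [mul_one_div, div_le_div_iff₀ (by positivity) hB]
        nlinarith
    _ = ∑ _ ∈ Finset.univ.erase i, 1 / B := by
        rw [Finset.sum_const, Finset.card_erase_of_mem (Finset.mem_univ i), Finset.card_univ,
          Fintype.card_fin, nsmul_eq_mul, Nat.cast_pred (by exact_mod_cast h.n_pos)]
    _ ≤ ∑ j ∈ Finset.univ.erase i, v j :=
        Finset.sum_le_sum fun j hj => hv j (Finset.ne_of_mem_erase hj)
    _ = ∑ j, v j := Finset.sum_erase _ hvi

lemma uRow_ge (h : VarianceBound Z η₀ γ₀ B) (i : Fin n) : n / (2 * B) ≤ uRow Z η₀ γ₀ i :=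
  h.sum_ge_of_offDiag (fun j hj => h.u_ge i j hj.symm) (u_self i)

lemma uCol_ge (h : VarianceBound Z η₀ γ₀ B) (j : Fin n) : n / (2 * B) ≤ uCol Z η₀ γ₀ j :=
  h.sum_ge_of_offDiag (fun i hi => h.u_ge i j hi) (u_self j)

lemma half_div_pos (h : VarianceBound Z η₀ γ₀ B) : 0 < n / (2 * B) :=
  div_pos h.n_pos (mul_pos two_pos h.B_pos)

lemma uRow_pos (h : VarianceBound Z η₀ γ₀ B) (i : Fin n) : 0 < uRow Z η₀ γ₀ i :=
  h.half_div_pos.trans_le (h.uRow_ge i)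

lemma uCol_pos (h : VarianceBound Z η₀ γ₀ B) (j : Fin n) : 0 < uCol Z η₀ γ₀ j :=
  h.half_div_pos.trans_le (h.uCol_ge j)

end VarianceBound

lemma H_mulVec (γ : Fin p → ℝ) : H Z η₀ γ₀ *ᵥ γ =
    Vγγ Z η₀ γ₀ *ᵥ γ - (Vηγ Z η₀ γ₀)ᵀ *ᵥ ((V Z η₀ γ₀)⁻¹ *ᵥ (Vηγ Z η₀ γ₀ *ᵥ γ)) := by
  rw [H, Matrix.sub_mulVec, Matrix.mulVec_mulVec, Matrix.mulVec_mulVec, Matrix.mul_assoc]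

lemma eta_eq_of_fisherInfo_eq (hV : IsUnit (V Z η₀ γ₀)) {θ s : Param n p}
    (hθ : fisherInfo Z η₀ γ₀ θ = s) :
    θ.1 = (V Z η₀ γ₀)⁻¹ *ᵥ s.1 - (V Z η₀ γ₀)⁻¹ *ᵥ (Vηγ Z η₀ γ₀ *ᵥ θ.2) := by
  rw [← hθ, fisherInfo_eq, Matrix.mulVec_add, inv_mulVec_mulVec hV, add_sub_cancel_right]

lemma H_mulVec_eq_of_fisherInfo_eq (hV : IsUnit (V Z η₀ γ₀)) {θ s : Param n p}
    (hθ : fisherInfo Z η₀ γ₀ θ = s) :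
    H Z η₀ γ₀ *ᵥ θ.2 = s.2 - (Vηγ Z η₀ γ₀)ᵀ *ᵥ ((V Z η₀ γ₀)⁻¹ *ᵥ s.1) := by
  have snd_eq : (Vηγ Z η₀ γ₀)ᵀ *ᵥ θ.1 + Vγγ Z η₀ γ₀ *ᵥ θ.2 = s.2 := by rw [← hθ, fisherInfo_eq]
  rw [H_mulVec, ← snd_eq, eta_eq_of_fisherInfo_eq hV hθ, Matrix.mulVec_sub]
  abel

lemma norm_Vηγ_transpose_mulVec_le {M : ℝ} (hM : 0 ≤ M)
    (hZ : ∀ i j, i ≠ j → ∀ l, |Z i j l| ≤ M) (η : Idx n → ℝ) :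
    ‖(Vηγ Z η₀ γ₀)ᵀ *ᵥ η‖ ≤ 1 / 4 * M * (2 * ‖η‖) * (n : ℝ) ^ 2 := by
  refine (pi_norm_le_iff_of_nonneg (by positivity)).2 fun l => ?_
  rw [← fisherInfo_eta_snd, fisherInfo_apply, linPredTranspose_snd]
  exact abs_sum_sum_le_mul_sq fun i j => abs_u_mul_mul_le (by positivity) hM
    (fun _ => abs_linPredMap_eta_le η i j) (fun hij => hZ i j hij l)

/-- The bound on the inverse Fisher information of the full parameter, from the weighted norm in
`Regular.norm_le_of_fisherInfo_eq` to the sup norm. -/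
noncomputable def fisherInvBound (p : ℕ) (B M κ : ℝ) : ℝ := 9 * p * M ^ 2 * κ * B ^ 2

namespace Regular

variable {B M κ : ℝ}

lemma M_pos (h : Regular Z η₀ γ₀ B M κ) : 0 < M := zero_lt_one.trans_le h.one_le_M

lemma abs_linPredMap_gamma_le (h : Regular Z η₀ γ₀ B M κ) (γ : Fin p → ℝ) {i j : Fin n}
    (hij : i ≠ j) : |linPredMap Z (0, γ) i j| ≤ p * M * ‖γ‖ := by
  rw [linPredMap_gamma]
  exact abs_dotProduct_le (h.Z_le i j hij)

lemma abs_linPredMap_le (h : Regular Z η₀ γ₀ B M κ) (θ : Param n p) {i j : Fin n} (hij : i ≠ j) :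
    |linPredMap Z θ i j| ≤ (2 + p * M) * ‖θ‖ := by
  have hM := h.M_pos
  have split : linPredMap Z θ = linPredMap Z (θ.1, 0) + linPredMap Z (0, θ.2) := by
    rw [← map_add, Prod.mk_add_mk, add_zero, zero_add]
  calc |linPredMap Z θ i j| ≤ |linPredMap Z (θ.1, 0) i j| + |linPredMap Z (0, θ.2) i j| := by
        rw [split]
        exact abs_add_le _ _
    _ ≤ 2 * ‖θ.1‖ + p * M * ‖θ.2‖ :=
        add_le_add (abs_linPredMap_eta_le _ _ _) (h.abs_linPredMap_gamma_le _ hij)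
    _ ≤ 2 * ‖θ‖ + p * M * ‖θ‖ := by gcongr; exacts [norm_fst_le θ, norm_snd_le θ]
    _ = (2 + p * M) * ‖θ‖ := by ring

lemma norm_V_inv_mulVec_Vηγ_mulVec_le (h : Regular Z η₀ γ₀ B M κ) (γ : Fin p → ℝ) :
    ‖(V Z η₀ γ₀)⁻¹ *ᵥ (Vηγ Z η₀ γ₀ *ᵥ γ)‖ ≤ 9 / 4 * B * (p * M * ‖γ‖) := by
  have hg (i j : Fin n) (hij : i ≠ j) := h.abs_linPredMap_gamma_le γ hij
  refine h.norm_eta_le (w := fun i j => u Z η₀ γ₀ i j * linPredMap Z (0, γ) i j) ?_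
    (abs_sum_row_u_mul_le hg) (abs_sum_col_u_mul_le hg)
  rw [mulVec_inv_mulVec h.isUnit_V, ← fisherInfo_gamma_fst, fisherInfo_apply]

lemma norm_Vγγ_mulVec_le (h : Regular Z η₀ γ₀ B M κ) (γ : Fin p → ℝ) :
    ‖Vγγ Z η₀ γ₀ *ᵥ γ‖ ≤ 1 / 4 * M * (p * M * ‖γ‖) * (n : ℝ) ^ 2 := by
  have hM := h.M_pos
  refine (pi_norm_le_iff_of_nonneg (by positivity)).2 fun l => ?_
  rw [← fisherInfo_gamma_snd, fisherInfo_apply, linPredTranspose_snd]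
  exact abs_sum_sum_le_mul_sq fun i j => abs_u_mul_mul_le (by positivity) hM.le
    (fun hij => h.abs_linPredMap_gamma_le γ hij) (fun hij => h.Z_le i j hij l)

lemma norm_gamma_le_of_H_mulVec (h : Regular Z η₀ γ₀ B M κ) {γ : Fin p → ℝ} {c : ℝ}
    (hγ : ‖H Z η₀ γ₀ *ᵥ γ‖ ≤ c * (n : ℝ) ^ 2) : ‖γ‖ ≤ κ * c := by
  have hn := h.n_pos
  calc ‖γ‖ = ‖(H Z η₀ γ₀)⁻¹ *ᵥ (H Z η₀ γ₀ *ᵥ γ)‖ := by rw [inv_mulVec_mulVec h.H_posDef.isUnit]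
    _ ≤ infNorm (H Z η₀ γ₀)⁻¹ * ‖H Z η₀ γ₀ *ᵥ γ‖ := norm_mulVec_le_infNorm_mul _ _
    _ ≤ κ / (n : ℝ) ^ 2 * (c * (n : ℝ) ^ 2) :=
        mul_le_mul h.H_inv_le hγ (norm_nonneg _) ((infNorm_nonneg _).trans h.H_inv_le)
    _ = κ * c := by field_simp

/- Test the bound for `H⁻¹` on the image of a unit vector. -/
lemma one_le_kappa_mul (h : Regular Z η₀ γ₀ B M κ) : 1 ≤ κ * (2 * p * M ^ 2 * B) := by
  have hM := h.M_pos
  have hB := h.four_le_B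
  have : Nonempty (Fin p) := ⟨⟨0, h.one_le_p⟩⟩
  have norm_one : ‖(fun _ => 1 : Fin p → ℝ)‖ = 1 := by rw [pi_norm_const, norm_one]
  rw [← norm_one]
  refine h.norm_gamma_le_of_H_mulVec ?_
  rw [H_mulVec]
  calc _ ≤ _ := norm_sub_le _ _
    _ ≤ 1 / 4 * M * (p * M * ‖(fun _ => 1 : Fin p → ℝ)‖) * (n : ℝ) ^ 2
        + 1 / 4 * M * (2 * (9 / 4 * B * (p * M * ‖(fun _ => 1 : Fin p → ℝ)‖))) * (n : ℝ) ^ 2 := by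
        refine add_le_add (h.norm_Vγγ_mulVec_le _)
          ((norm_Vηγ_transpose_mulVec_le hM.le h.Z_le _).trans ?_)
        gcongr
        exact h.norm_V_inv_mulVec_Vηγ_mulVec_le _
    _ = p * M ^ 2 * (1 / 4 + 9 / 8 * B) * (n : ℝ) ^ 2 := by rw [norm_one]; ring
    _ ≤ p * M ^ 2 * (2 * B) * (n : ℝ) ^ 2 := by gcongr; linarith
    _ = 2 * p * M ^ 2 * B * (n : ℝ) ^ 2 := by ring

lemma kappa_pos (h : Regular Z η₀ γ₀ B M κ) : 0 < κ := by
  have hM := h.M_pos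
  have hB := h.B_pos
  refine pos_of_mul_pos_left (zero_lt_one.trans_le h.one_le_kappa_mul) ?_
  positivity

lemma norm_gamma_le_of_fisherInfo_eq (h : Regular Z η₀ γ₀ B M κ) {θ s : Param n p} {δ : ℝ}
    (hδ : 0 ≤ δ) (hθ : fisherInfo Z η₀ γ₀ θ = s)
    (hη : ‖(V Z η₀ γ₀)⁻¹ *ᵥ s.1‖ ≤ 9 / 4 * B * δ) (hcov : ‖s.2‖ ≤ M * δ * (n : ℝ) ^ 2) :
    ‖θ.2‖ ≤ κ * (2 * M * B * δ) := by
  have hM := h.M_pos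
  have hB := h.four_le_B
  refine h.norm_gamma_le_of_H_mulVec ?_
  rw [H_mulVec_eq_of_fisherInfo_eq h.isUnit_V hθ]
  calc _ ≤ _ := norm_sub_le _ _
    _ ≤ M * δ * (n : ℝ) ^ 2 + 1 / 4 * M * (2 * (9 / 4 * B * δ)) * (n : ℝ) ^ 2 := by
        refine add_le_add hcov ((norm_Vηγ_transpose_mulVec_le hM.le h.Z_le _).trans ?_)
        gcongr
    _ = M * δ * (1 + 9 / 8 * B) * (n : ℝ) ^ 2 := by ring
    _ ≤ M * δ * (2 * B) * (n : ℝ) ^ 2 := by gcongr; linarith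
    _ = 2 * M * B * δ * (n : ℝ) ^ 2 := by ring

lemma norm_eta_le_of_fisherInfo_eq (h : Regular Z η₀ γ₀ B M κ) {θ s : Param n p} {δ : ℝ}
    (hδ : 0 ≤ δ) (hθ : fisherInfo Z η₀ γ₀ θ = s)
    (hη : ‖(V Z η₀ γ₀)⁻¹ *ᵥ s.1‖ ≤ 9 / 4 * B * δ) (hγ : ‖θ.2‖ ≤ κ * (2 * M * B * δ)) :
    ‖θ.1‖ ≤ fisherInvBound p B M κ * δ := by
  have hM := h.M_pos
  have hB := h.B_pos
  rw [eta_eq_of_fisherInfo_eq h.isUnit_V hθ]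
  calc _ ≤ _ := norm_sub_le _ _
    _ ≤ 9 / 4 * B * δ * (κ * (2 * p * M ^ 2 * B)) +
          9 / 4 * B * (p * M * (κ * (2 * M * B * δ))) := by
        refine add_le_add
          (hη.trans (le_mul_of_one_le_right (by positivity) h.one_le_kappa_mul))
          ((h.norm_V_inv_mulVec_Vηγ_mulVec_le _).trans ?_)
        gcongr
    _ = fisherInvBound p B M κ * δ := by rw [fisherInvBound]; ring

lemma norm_le_of_fisherInfo_eq (h : Regular Z η₀ γ₀ B M κ) {θ : Param n p}
    {w : Fin n → Fin n → ℝ} {δ : ℝ} (hθ : fisherInfo Z η₀ γ₀ θ = linPredTranspose Z w)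
    (hrow : ∀ i, |∑ j, w i j| ≤ δ * uRow Z η₀ γ₀ i)
    (hcol : ∀ j, |∑ i, w i j| ≤ δ * uCol Z η₀ γ₀ j)
    (hcov : ∀ l, |∑ i, ∑ j, w i j * Z i j l| ≤ M * δ * (n : ℝ) ^ 2) :
    ‖θ‖ ≤ fisherInvBound p B M κ * δ := by
  have hM := h.one_le_M
  have hB := h.four_le_B
  have hκ := h.kappa_pos
  have hp : (1 : ℝ) ≤ p := by exact_mod_cast h.one_le_p
  have hη := h.norm_eta_le (mulVec_inv_mulVec h.isUnit_V (linPredTranspose Z w).1) hrow hcol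
  have hδ : 0 ≤ δ := nonneg_of_mul_nonneg_right ((norm_nonneg _).trans hη) (by linarith)
  have hγ := h.norm_gamma_le_of_fisherInfo_eq hδ hθ hη
    ((pi_norm_le_iff_of_nonneg (by positivity)).2 hcov)
  refine max_le (h.norm_eta_le_of_fisherInfo_eq hδ hθ hη hγ) (hγ.trans ?_)
  calc κ * (2 * M * B * δ) = 2 * 1 * (M * 1) * κ * (B * 1) * δ := by ring
    _ ≤ 9 * p * (M * M) * κ * (B * B) * δ := by gcongr <;> linarith
    _ = fisherInvBound p B M κ * δ := by rw [fisherInvBound]; ring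

lemma fisherInvBound_nonneg (h : Regular Z η₀ γ₀ B M κ) : 0 ≤ fisherInvBound p B M κ := by
  have := h.kappa_pos
  unfold fisherInvBound
  positivity

lemma fisherInfo_injective (h : Regular Z η₀ γ₀ B M κ) :
    Function.Injective (fisherInfo Z η₀ γ₀) := by
  refine (injective_iff_map_eq_zero _).2 fun θ hθ => ?_
  simpa using h.norm_le_of_fisherInfo_eq (θ := θ) (w := 0) (δ := 0) (by rw [hθ, map_zero])
    (by simp) (by simp) (by simp)

end Regular

end InverseInformation

/-! ### The likelihood equations -/

section Likelihood

variable {n p : ℕ} {Z : Fin n → Fin n → Fin p → ℝ}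

/-- The residuals `a_{ij} - μ(π_{ij})`, with zero diagonal. -/
noncomputable def resid (Z : Fin n → Fin n → Fin p → ℝ) (a : Adj n) (η : Idx n → ℝ)
    (γ : Fin p → ℝ) (i j : Fin n) : ℝ :=
  if i = j then 0 else (if a i j = true then 1 else 0) - mu (linPred Z η γ i j)

lemma resid_self (a : Adj n) (η : Idx n → ℝ) (γ : Fin p → ℝ) (i : Fin n) :
    resid Z a η γ i i = 0 := if_pos rfl

/-- The contribution of the ordered pair `(i, j)` to the log-likelihood, with zero diagonal. -/
noncomputable def entryLogLik (Z : Fin n → Fin n → Fin p → ℝ) (a : Adj n) (η : Idx n → ℝ)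
    (γ : Fin p → ℝ) (i j : Fin n) : ℝ :=
  if i = j then 0 else (if a i j = true then linPred Z η γ i j else 0)
    - Real.log (1 + Real.exp (linPred Z η γ i j))

lemma logLik_eq_sum_entryLogLik (a : Adj n) (η : Idx n → ℝ) (γ : Fin p → ℝ) :
    logLik Z a η γ = ∑ i, ∑ j, entryLogLik Z a η γ i j := by
  refine Finset.sum_congr rfl fun i _ => ?_
  rw [← Finset.sum_erase Finset.univ (f := entryLogLik Z a η γ i) (if_pos rfl)]
  exact Finset.sum_congr rfl fun j hj => (if_neg (Finset.ne_of_mem_erase hj).symm).symm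

lemma entryLogLik_lt (a : Adj n) {η η' : Idx n → ℝ} {γ γ' : Fin p → ℝ} {i j : Fin n} (hij : i ≠ j)
    (hne : linPred Z η' γ' i j ≠ linPred Z η γ i j) :
    entryLogLik Z a η' γ' i j
      < entryLogLik Z a η γ i j
        + resid Z a η γ i j * (linPred Z η' γ' i j - linPred Z η γ i j) := by
  have tangent := log_one_add_exp_add_mu_mul_lt hne
  simp only [entryLogLik, resid, if_neg hij]
  split_ifs <;> linarith

lemma entryLogLik_le (a : Adj n) (η η' : Idx n → ℝ) (γ γ' : Fin p → ℝ) (i j : Fin n) :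
    entryLogLik Z a η' γ' i j
      ≤ entryLogLik Z a η γ i j
        + resid Z a η γ i j * (linPred Z η' γ' i j - linPred Z η γ i j) := by
  rcases eq_or_ne i j with rfl | hij
  · simp [entryLogLik, resid]
  rcases eq_or_ne (linPred Z η' γ' i j) (linPred Z η γ i j) with heq | hne
  · simp [entryLogLik, heq]
  · exact (entryLogLik_lt a hij hne).le

lemma sum_resid_mul_linPred_sub_eq_zero {a : Adj n} {η : Idx n → ℝ} {γ : Fin p → ℝ}
    (h : linPredTranspose Z (resid Z a η γ) = 0) (η' : Idx n → ℝ) (γ' : Fin p → ℝ) :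
    ∑ i, ∑ j, resid Z a η γ i j * (linPred Z η' γ' i j - linPred Z η γ i j) = 0 := by
  have duality := sum_mul_linPredMap Z (resid Z a η γ) ((η', γ') - (η, γ))
  rw [h, map_sub] at duality
  simpa [linPredMap_apply] using duality

lemma isMLE_of_linPredTranspose_resid_eq_zero {a : Adj n} {η : Idx n → ℝ} {γ : Fin p → ℝ}
    (h : linPredTranspose Z (resid Z a η γ) = 0) : IsMLE Z a η γ := fun η' γ' =>
  calc logLik Z a η' γ' = ∑ i, ∑ j, entryLogLik Z a η' γ' i j := logLik_eq_sum_entryLogLik a η' γ'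
    _ ≤ ∑ i, ∑ j, (entryLogLik Z a η γ i j
          + resid Z a η γ i j * (linPred Z η' γ' i j - linPred Z η γ i j)) :=
        Finset.sum_le_sum fun i _ => Finset.sum_le_sum fun j _ => entryLogLik_le a η η' γ γ' i j
    _ = logLik Z a η γ := by
        simp only [Finset.sum_add_distrib, sum_resid_mul_linPred_sub_eq_zero h, add_zero,
          logLik_eq_sum_entryLogLik]

lemma linPred_eq_of_isMLE {a : Adj n} {η η' : Idx n → ℝ} {γ γ' : Fin p → ℝ}
    (h : linPredTranspose Z (resid Z a η γ) = 0) (h' : IsMLE Z a η' γ') {i j : Fin n}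
    (hij : i ≠ j) : linPred Z η' γ' i j = linPred Z η γ i j := by
  by_contra hne
  refine (h' η γ).not_gt ?_
  calc logLik Z a η' γ' = ∑ i, ∑ j, entryLogLik Z a η' γ' i j := logLik_eq_sum_entryLogLik a η' γ'
    _ < ∑ i, ∑ j, (entryLogLik Z a η γ i j
          + resid Z a η γ i j * (linPred Z η' γ' i j - linPred Z η γ i j)) :=
        Finset.sum_lt_sum
          (fun i _ => Finset.sum_le_sum fun j _ => entryLogLik_le a η η' γ γ' i j)
          ⟨i, Finset.mem_univ i, Finset.sum_lt_sum
            (fun j _ => entryLogLik_le a η η' γ γ' i j)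
            ⟨j, Finset.mem_univ j, entryLogLik_lt a hij hne⟩⟩
    _ = logLik Z a η γ := by
        simp only [Finset.sum_add_distrib, sum_resid_mul_linPred_sub_eq_zero h, add_zero,
          logLik_eq_sum_entryLogLik]

lemma Regular.eta_eq_of_isMLE {η₀ : Idx n → ℝ} {γ₀ : Fin p → ℝ} {B M κ : ℝ}
    (hreg : Regular Z η₀ γ₀ B M κ) {a : Adj n} {η η' : Idx n → ℝ} {γ γ' : Fin p → ℝ}
    (h : linPredTranspose Z (resid Z a η γ) = 0) (h' : IsMLE Z a η' γ') : η' = η := by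
  have fisherInfo_eq : fisherInfo Z η₀ γ₀ (η', γ') = fisherInfo Z η₀ γ₀ (η, γ) := by
    simp only [fisherInfo_apply, linPredMap_apply]
    congr 1
    ext i j
    rcases eq_or_ne i j with rfl | hij
    · simp [u_self]
    · rw [linPred_eq_of_isMLE h h' hij]
  exact congrArg Prod.fst (hreg.fisherInfo_injective fisherInfo_eq)

end Likelihood

/-! ### Expansion of the maximum likelihood estimate -/

section Expansion

lemma exists_isFixedPt_of_contracting_closedBall {E : Type*} [NormedAddCommGroup E]
    [CompleteSpace E] {f : E → E} {q r : ℝ} (hq0 : 0 ≤ q) (hq : q < 1) (hr : 0 ≤ r)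
    (hf : ∀ x y, ‖x‖ ≤ r → ‖y‖ ≤ r → ‖f x - f y‖ ≤ q * ‖x - y‖) (h0 : ‖f 0‖ ≤ (1 - q) * r) :
    ∃ x, ‖x‖ ≤ r ∧ Function.IsFixedPt f x := by
  lift q to NNReal using hq0
  have zero_mem : (0 : E) ∈ Metric.closedBall 0 r := Metric.mem_closedBall_self hr
  have maps : Set.MapsTo f (Metric.closedBall 0 r) (Metric.closedBall 0 r) := fun x hx => by
    rw [mem_closedBall_zero_iff] at hx ⊢
    calc ‖f x‖ ≤ ‖f x - f 0‖ + ‖f 0‖ := norm_le_norm_sub_add _ _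
      _ ≤ q * ‖x - 0‖ + (1 - q) * r := by gcongr; exact hf x 0 hx (by simpa using hr)
      _ ≤ q * r + (1 - q) * r := by rw [sub_zero]; gcongr
      _ = r := by ring
  have lipschitz : LipschitzOnWith q f (Metric.closedBall 0 r) :=
    LipschitzOnWith.of_dist_le_mul fun x hx y hy => by
      simpa only [dist_eq_norm] using
        hf x y (mem_closedBall_zero_iff.1 hx) (mem_closedBall_zero_iff.1 hy)
  obtain ⟨x, hx, hfix, -⟩ := ContractingWith.exists_fixedPoint'
    Metric.isClosed_closedBall.isComplete maps
    ⟨by exact_mod_cast hq, lipschitz.mapsToRestrict maps⟩ zero_mem (edist_ne_top _ _)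
  exact ⟨x, mem_closedBall_zero_iff.1 hx, hfix⟩

variable {n p : ℕ} {Z : Fin n → Fin n → Fin p → ℝ} {η₀ : Idx n → ℝ} {γ₀ : Fin p → ℝ}

/-- The remainder of the linearization of the means at `(η₀, γ₀)`, with zero diagonal. -/
noncomputable def remainder (Z : Fin n → Fin n → Fin p → ℝ) (η₀ : Idx n → ℝ) (γ₀ : Fin p → ℝ)
    (θ : Param n p) (i j : Fin n) : ℝ :=
  if i = j then 0 else mu (linPred Z η₀ γ₀ i j + linPredMap Z θ i j) - mu (linPred Z η₀ γ₀ i j)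
    - muDeriv (linPred Z η₀ γ₀ i j) * linPredMap Z θ i j

lemma remainder_zero : remainder Z η₀ γ₀ 0 = 0 := by
  ext i j
  simp [remainder]

lemma resid_add (a : Adj n) (θ : Param n p) :
    resid Z a (η₀ + θ.1) (γ₀ + θ.2) = resid Z a η₀ γ₀ - remainder Z η₀ γ₀ θ
      - fun i j => u Z η₀ γ₀ i j * linPredMap Z θ i j := by
  ext i j
  have linPred_add :
      linPred Z (η₀ + θ.1) (γ₀ + θ.2) i j = linPred Z η₀ γ₀ i j + linPredMap Z θ i j :=
    congrFun (congrFun (map_add (linPredMap Z) (η₀, γ₀) θ) i) j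
  simp only [resid, remainder, u, linPred_add, Pi.sub_apply]
  split_ifs <;> ring

/-- The leading term of the row effects in the expansion of the estimate: the weighted row means
of `w`. -/
noncomputable def rowEffect (Z : Fin n → Fin n → Fin p → ℝ) (η₀ : Idx n → ℝ) (γ₀ : Fin p → ℝ)
    (w : Fin n → Fin n → ℝ) (i : Fin n) : ℝ := (∑ j, w i j) / uRow Z η₀ γ₀ i

/-- The leading term of the column effects in the expansion of the estimate: the weighted column
means of `w`. -/
noncomputable def colEffect (Z : Fin n → Fin n → Fin p → ℝ) (η₀ : Idx n → ℝ) (γ₀ : Fin p → ℝ)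
    (w : Fin n → Fin n → ℝ) (j : Fin n) : ℝ := (∑ i, w i j) / uCol Z η₀ γ₀ j

/-- What is left of `w` after its row and column effects are removed. -/
noncomputable def interaction (Z : Fin n → Fin n → Fin p → ℝ) (η₀ : Idx n → ℝ) (γ₀ : Fin p → ℝ)
    (w : Fin n → Fin n → ℝ) (i j : Fin n) : ℝ :=
  w i j - u Z η₀ γ₀ i j * (rowEffect Z η₀ γ₀ w i + colEffect Z η₀ γ₀ w j)

/-- The noise `w` has row and column effects of size at most `τ`, and its interaction is smaller:
relative to the weights, its row sums, column sums and covariate sums are of size at most `δ`. -/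
structure SmallNoise (Z : Fin n → Fin n → Fin p → ℝ) (η₀ : Idx n → ℝ) (γ₀ : Fin p → ℝ)
    (M τ δ : ℝ) (w : Fin n → Fin n → ℝ) : Prop where
  rowEffect_le : ∀ i, |rowEffect Z η₀ γ₀ w i| ≤ τ
  colEffect_le : ∀ j, |colEffect Z η₀ γ₀ w j| ≤ τ
  sum_colEffect_le : ∀ i, |∑ j, u Z η₀ γ₀ i j * colEffect Z η₀ γ₀ w j| ≤ δ * uRow Z η₀ γ₀ i
  sum_rowEffect_le : ∀ j, |∑ i, u Z η₀ γ₀ i j * rowEffect Z η₀ γ₀ w i| ≤ δ * uCol Z η₀ γ₀ j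
  sum_cov_le : ∀ l, |∑ i, ∑ j, interaction Z η₀ γ₀ w i j * Z i j l| ≤ M * δ * (n : ℝ) ^ 2

/-- The node parameter with row effects `F` and column effects `G`, shifted so that the last column
effect vanishes. -/
noncomputable def effectsParam (F G : Fin n → ℝ) (last : Fin n) : Idx n → ℝ :=
  Sum.elim (fun i => F i + G last) (fun j => G (incl j) - G last)

lemma linPredMap_effectsParam (F G : Fin n → ℝ) {last : Fin n} (hlast : (last : ℕ) = n - 1)
    (i j : Fin n) : linPredMap Z (effectsParam F G last, 0) i j = F i + G j := by
  have beta_eq : beta (effectsParam F G last) j = G j - G last := by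
    by_cases hj : (j : ℕ) < n - 1
    · exact dif_pos hj
    · obtain rfl : j = last := Fin.ext (by omega)
      rw [beta_last _ hlast, sub_self]
  rw [linPredMap_eta, beta_eq]
  change F i + G last + (G j - G last) = F i + G j
  ring

lemma norm_effectsParam_le {F G : Fin n → ℝ} {τ : ℝ} (hF : ∀ i, |F i| ≤ τ) (hG : ∀ j, |G j| ≤ τ)
    (last : Fin n) : ‖effectsParam F G last‖ ≤ 2 * τ := by
  have hτ : 0 ≤ τ := (abs_nonneg _).trans (hF last)
  refine (pi_norm_le_iff_of_nonneg (by positivity)).2 ?_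
  rintro (i | j)
  · exact (abs_add_le _ _).trans (by linarith [hF i, hG last])
  · exact (abs_sub _ _).trans (by linarith [hG (incl j), hG last])

namespace VarianceBound

variable {B : ℝ}

lemma sum_row_interaction (h : VarianceBound Z η₀ γ₀ B) (w : Fin n → Fin n → ℝ) (i : Fin n) :
    ∑ j, interaction Z η₀ γ₀ w i j = -∑ j, u Z η₀ γ₀ i j * colEffect Z η₀ γ₀ w j := by
  have cancel : (∑ j, u Z η₀ γ₀ i j) * rowEffect Z η₀ γ₀ w i = ∑ j, w i j :=
    mul_div_cancel₀ _ (h.uRow_pos i).ne'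
  simp only [interaction, mul_add, Finset.sum_sub_distrib, Finset.sum_add_distrib,
    ← Finset.sum_mul, cancel]
  ring

lemma sum_col_interaction (h : VarianceBound Z η₀ γ₀ B) (w : Fin n → Fin n → ℝ) (j : Fin n) :
    ∑ i, interaction Z η₀ γ₀ w i j = -∑ i, u Z η₀ γ₀ i j * rowEffect Z η₀ γ₀ w i := by
  have cancel : (∑ i, u Z η₀ γ₀ i j) * colEffect Z η₀ γ₀ w j = ∑ i, w i j :=
    mul_div_cancel₀ _ (h.uCol_pos j).ne'
  simp only [interaction, mul_add, Finset.sum_sub_distrib, Finset.sum_add_distrib,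
    ← Finset.sum_mul, cancel]
  ring

end VarianceBound

/-- The Lipschitz constant, on the ball of radius `r`, of the Newton iteration
`θ ↦ fisherInfo⁻¹ (score - remainder θ)` whose fixed points solve the likelihood equations. -/
noncomputable def newtonLip (p : ℕ) (B M κ r : ℝ) : ℝ :=
  fisherInvBound p B M κ * (2 * (2 + p * M) ^ 2 * r)

/-- Existence of the maximum likelihood estimate, and the expansion
`α̂_i - α_i ≈ rowEffect i + colEffect n` up to the error `e`. -/
def MLEExpansion (Z : Fin n → Fin n → Fin p → ℝ) (η₀ : Idx n → ℝ) (γ₀ : Fin p → ℝ) (last : Fin n)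
    (e : ℝ) (a : Adj n) : Prop :=
  (∃ η γ, IsMLE Z a η γ) ∧ ∀ η γ, IsMLE Z a η γ → ∀ i,
    |η (Sum.inl i) - η₀ (Sum.inl i)
      - (rowEffect Z η₀ γ₀ (resid Z a η₀ γ₀) i + colEffect Z η₀ γ₀ (resid Z a η₀ γ₀) last)| ≤ e

namespace Regular

variable {B M κ : ℝ}

lemma abs_remainder_sub_le (h : Regular Z η₀ γ₀ B M κ) {r : ℝ} (hr : (2 + p * M) * r ≤ 1)
    {θ θ' : Param n p} (hθ : ‖θ‖ ≤ r) (hθ' : ‖θ'‖ ≤ r) (i j : Fin n) :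
    |remainder Z η₀ γ₀ θ i j - remainder Z η₀ γ₀ θ' i j|
      ≤ u Z η₀ γ₀ i j * (2 * (2 + p * M) ^ 2 * r * ‖θ - θ'‖) := by
  have hM := h.M_pos
  have hr0 : 0 ≤ r := (norm_nonneg θ).trans hθ
  unfold remainder u
  split_ifs with hij
  · simp
  set π := linPred Z η₀ γ₀ i j
  have near {ϑ : Param n p} (hϑ : ‖ϑ‖ ≤ r) :
      |π + linPredMap Z ϑ i j - π| ≤ (2 + p * M) * r := by
    rw [add_sub_cancel_left]
    exact (h.abs_linPredMap_le ϑ hij).trans (by gcongr)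
  have diff_le := h.abs_linPredMap_le (θ - θ') hij
  rw [map_sub, Pi.sub_apply, Pi.sub_apply] at diff_le
  have hπ := muDeriv_pos π
  calc _ = |mu (π + linPredMap Z θ i j) - mu (π + linPredMap Z θ' i j)
          - muDeriv π * (π + linPredMap Z θ i j - (π + linPredMap Z θ' i j))| := by
        congr 1; ring
    _ ≤ 2 * ((2 + p * M) * r) * muDeriv π
          * |π + linPredMap Z θ i j - (π + linPredMap Z θ' i j)| :=
        abs_mu_sub_mu_sub_le (near hθ) (near hθ') hr
    _ ≤ 2 * ((2 + p * M) * r) * muDeriv π * ((2 + p * M) * ‖θ - θ'‖) := by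
        rw [add_sub_add_left_eq_sub]
        gcongr
    _ = muDeriv π * (2 * (2 + p * M) ^ 2 * r * ‖θ - θ'‖) := by ring

lemma norm_le_of_abs_le_u_mul (h : Regular Z η₀ γ₀ B M κ) {θ : Param n p} {w : Fin n → Fin n → ℝ}
    {δ : ℝ} (hδ : 0 ≤ δ) (hθ : fisherInfo Z η₀ γ₀ θ = linPredTranspose Z w)
    (hw : ∀ i j, |w i j| ≤ u Z η₀ γ₀ i j * δ) : ‖θ‖ ≤ fisherInvBound p B M κ * δ := by
  have hM := h.M_pos
  refine h.norm_le_of_fisherInfo_eq hθ (fun i => ?_) (fun j => ?_) (fun l => ?_)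
  · rw [uRow, mul_comm, Finset.sum_mul]
    exact (Finset.abs_sum_le_sum_abs _ _).trans (Finset.sum_le_sum fun j _ => hw i j)
  · rw [uCol, mul_comm, Finset.sum_mul]
    exact (Finset.abs_sum_le_sum_abs _ _).trans (Finset.sum_le_sum fun i _ => hw i j)
  · refine abs_sum_sum_le_mul_sq fun i j => ?_
    rw [abs_mul]
    rcases eq_or_ne i j with rfl | hij
    · have w_zero : |w i i| ≤ 0 := by simpa [u_self] using hw i i
      calc |w i i| * |Z i i l| ≤ 0 * |Z i i l| := by gcongr
        _ ≤ M * δ := by rw [zero_mul]; positivity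
    · calc |w i j| * |Z i j l| ≤ (1 * δ) * M := by
            gcongr
            · exact (hw i j).trans
                (by gcongr; linarith [u_le_quarter (Z := Z) (η₀ := η₀) (γ₀ := γ₀) i j])
            · exact h.Z_le i j hij l
        _ = M * δ := by ring

lemma newtonLip_nonneg (h : Regular Z η₀ γ₀ B M κ) {r : ℝ} (hr : 0 ≤ r) :
    0 ≤ newtonLip p B M κ r :=
  mul_nonneg h.fisherInvBound_nonneg (by positivity)

lemma exists_linPredTranspose_resid_eq_zero (h : Regular Z η₀ γ₀ B M κ) {a : Adj n}
    {θ₁ : Param n p} {r : ℝ} (hθ₁ : fisherInfo Z η₀ γ₀ θ₁ = linPredTranspose Z (resid Z a η₀ γ₀))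
    (hr₁ : ‖θ₁‖ ≤ r / 2) (hr : (2 + p * M) * r ≤ 1) (hq : newtonLip p B M κ r ≤ 1 / 2) :
    ∃ θ : Param n p, linPredTranspose Z (resid Z a (η₀ + θ.1) (γ₀ + θ.2)) = 0 ∧
      ‖θ - θ₁‖ ≤ newtonLip p B M κ r * r := by
  have hr0 : 0 ≤ r := by linarith [norm_nonneg θ₁]
  let e := LinearEquiv.ofInjectiveEndo (fisherInfo Z η₀ γ₀) h.fisherInfo_injective
  have fisherInfo_symm (x : Param n p) : fisherInfo Z η₀ γ₀ (e.symm x) = x := e.apply_symm_apply x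
  let newton (θ : Param n p) : Param n p := θ₁ - e.symm (linPredTranspose Z (remainder Z η₀ γ₀ θ))
  have newton_sub_le (θ θ' : Param n p) (hθ : ‖θ‖ ≤ r) (hθ' : ‖θ'‖ ≤ r) :
      ‖newton θ - newton θ'‖ ≤ newtonLip p B M κ r * ‖θ - θ'‖ := by
    have newton_sub : newton θ - newton θ'
        = e.symm (linPredTranspose Z (remainder Z η₀ γ₀ θ' - remainder Z η₀ γ₀ θ)) := by
      simp only [newton, map_sub]
      abel
    rw [newton_sub, newtonLip, mul_assoc]
    refine h.norm_le_of_abs_le_u_mul (by positivity) (fisherInfo_symm _) fun i j => ?_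
    rw [Pi.sub_apply, Pi.sub_apply, abs_sub_comm]
    exact h.abs_remainder_sub_le hr hθ hθ' i j
  have newton_zero : newton 0 = θ₁ := by simp [newton, remainder_zero]
  obtain ⟨θ, hθ, hfix⟩ := exists_isFixedPt_of_contracting_closedBall (f := newton)
    (h.newtonLip_nonneg hr0) (hq.trans_lt one_half_lt_one) hr0 newton_sub_le
    (by rw [newton_zero]; nlinarith)
  refine ⟨θ, ?_, ?_⟩
  · rw [resid_add, map_sub, map_sub, ← fisherInfo_apply, ← hθ₁,
      ← fisherInfo_symm (linPredTranspose Z (remainder Z η₀ γ₀ θ)), ← map_sub, ← map_sub,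
      show θ₁ - e.symm _ = θ from hfix, sub_self, map_zero]
  · have := h.newtonLip_nonneg hr0
    calc ‖θ - θ₁‖ = ‖newton θ - newton 0‖ := by rw [hfix.eq, newton_zero]
      _ ≤ newtonLip p B M κ r * ‖θ - 0‖ := newton_sub_le θ 0 hθ (by simpa using hr0)
      _ ≤ newtonLip p B M κ r * r := by rw [sub_zero]; gcongr

lemma norm_sub_effectsParam_le (h : Regular Z η₀ γ₀ B M κ) {w : Fin n → Fin n → ℝ} {τ δ : ℝ}
    (hw : SmallNoise Z η₀ γ₀ M τ δ w) {last : Fin n} (hlast : (last : ℕ) = n - 1)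
    {θ : Param n p} (hθ : fisherInfo Z η₀ γ₀ θ = linPredTranspose Z w) :
    ‖θ - (effectsParam (rowEffect Z η₀ γ₀ w) (colEffect Z η₀ γ₀ w) last, 0)‖
      ≤ fisherInvBound p B M κ * δ := by
  refine h.norm_le_of_fisherInfo_eq (w := interaction Z η₀ γ₀ w) ?_ (fun i => ?_) (fun j => ?_)
    hw.sum_cov_le
  · rw [map_sub, hθ, fisherInfo_apply, ← map_sub]
    simp only [linPredMap_effectsParam _ _ hlast]
    rfl
  · rw [h.sum_row_interaction, abs_neg]
    exact hw.sum_colEffect_le i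
  · rw [h.sum_col_interaction, abs_neg]
    exact hw.sum_rowEffect_le j

theorem mleExpansion (h : Regular Z η₀ γ₀ B M κ) {a : Adj n} {τ δ r : ℝ}
    (hw : SmallNoise Z η₀ γ₀ M τ δ (resid Z a η₀ γ₀)) {last : Fin n} (hlast : (last : ℕ) = n - 1)
    (hτr : 2 * τ + fisherInvBound p B M κ * δ ≤ r / 2)
    (hr : (2 + p * M) * r ≤ 1) (hq : newtonLip p B M κ r ≤ 1 / 2) :
    MLEExpansion Z η₀ γ₀ last (fisherInvBound p B M κ * δ + newtonLip p B M κ r * r) a := by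
  obtain ⟨θ₁, hθ₁⟩ := (LinearMap.injective_iff_surjective.1 h.fisherInfo_injective)
    (linPredTranspose Z (resid Z a η₀ γ₀))
  set ξ : Param n p := (effectsParam (rowEffect Z η₀ γ₀ (resid Z a η₀ γ₀))
    (colEffect Z η₀ γ₀ (resid Z a η₀ γ₀)) last, 0) with hξ
  have dist_ξ : ‖θ₁ - ξ‖ ≤ fisherInvBound p B M κ * δ := h.norm_sub_effectsParam_le hw hlast hθ₁
  have norm_ξ : ‖ξ‖ ≤ 2 * τ := by
    have := norm_effectsParam_le hw.rowEffect_le hw.colEffect_le last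
    exact max_le this (by simpa [hξ] using (norm_nonneg _).trans this)
  have norm_θ₁ : ‖θ₁‖ ≤ r / 2 := by linarith [norm_le_norm_sub_add θ₁ ξ]
  obtain ⟨θ, hθ, dist_θ⟩ := h.exists_linPredTranspose_resid_eq_zero hθ₁ norm_θ₁ hr hq
  refine ⟨⟨_, _, isMLE_of_linPredTranspose_resid_eq_zero hθ⟩, fun η γ hη i => ?_⟩
  rw [h.eta_eq_of_isMLE hθ hη, Pi.add_apply, add_sub_cancel_left]
  calc |(θ - ξ).1 (Sum.inl i)| ≤ ‖θ - ξ‖ := (norm_le_pi_norm (θ - ξ).1 _).trans (norm_fst_le _)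
    _ ≤ ‖θ - θ₁‖ + ‖θ₁ - ξ‖ := norm_sub_le_norm_sub_add_norm_sub _ _ _
    _ ≤ _ := by linarith

end Regular

end Expansion

/-! ### Linear statistics of the residuals -/

section LinearStatistics

lemma hasSubgaussianMGF_mono {Ω : Type*} [MeasurableSpace Ω] {P : Measure Ω} {X : Ω → ℝ}
    {c d : NNReal} (h : HasSubgaussianMGF X c P) (hcd : c ≤ d) : HasSubgaussianMGF X d P where
  integrable_exp_mul := h.integrable_exp_mul
  mgf_le t := (h.mgf_le t).trans (by gcongr)

lemma measureReal_le_abs_le_of_hasSubgaussianMGF {Ω : Type*} [MeasurableSpace Ω] {P : Measure Ω}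
    {X : Ω → ℝ} {c : NNReal} (h : HasSubgaussianMGF X c P) {t : ℝ} (ht : 0 ≤ t) :
    P.real {ω | t ≤ |X ω|} ≤ 2 * Real.exp (-t ^ 2 / (2 * c)) := by
  have hsplit : {ω | t ≤ |X ω|} = {ω | t ≤ X ω} ∪ {ω | t ≤ (-X) ω} := by
    ext ω
    simp only [Set.mem_ofPred_eq, Set.mem_union, le_abs, Pi.neg_apply]
  calc P.real {ω | t ≤ |X ω|} ≤ P.real {ω | t ≤ X ω} + P.real {ω | t ≤ (-X) ω} :=
        hsplit ▸ measureReal_union_le _ _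
    _ ≤ 2 * Real.exp (-t ^ 2 / (2 * c)) := by
        linarith [h.measure_ge_le ht, h.neg.measure_ge_le ht]

variable {n p : ℕ}

/-- The ordered pairs of distinct nodes. -/
abbrev Pair (n : ℕ) : Type := {q : Fin n × Fin n // q.1 ≠ q.2}

lemma sum_pair {E : Type*} [AddCommMonoid E] {f : Fin n → Fin n → E} (hf : ∀ i, f i i = 0) :
    ∑ q : Pair n, f q.1.1 q.1.2 = ∑ i, ∑ j, f i j := by
  rw [← Finset.sum_product', Finset.univ_product_univ,
    ← Finset.sum_subtype (Finset.univ.filter fun q : Fin n × Fin n => q.1 ≠ q.2) (by simp)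
      (fun q : Fin n × Fin n => f q.1 q.2), Finset.sum_filter_of_ne]
  rintro ⟨i, j⟩ - hne (rfl : i = j)
  exact hne (hf i)

lemma sum_pair_le {f : Fin n → Fin n → ℝ} (hf : ∀ i, 0 ≤ f i i) :
    ∑ q : Pair n, f q.1.1 q.1.2 ≤ ∑ i, ∑ j, f i j := by
  calc ∑ q : Pair n, f q.1.1 q.1.2
      = ∑ q : Pair n, if q.1.1 = q.1.2 then 0 else f q.1.1 q.1.2 :=
        Finset.sum_congr rfl fun q _ => (if_neg q.2).symm
    _ = ∑ i, ∑ j, if i = j then 0 else f i j :=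
        sum_pair (f := fun i j => if i = j then 0 else f i j) fun i => if_pos rfl
    _ ≤ ∑ i, ∑ j, f i j := by
        gcongr with i _ j
        split_ifs with hij
        · exact hij ▸ hf i
        · exact le_rfl

variable {Z : Fin n → Fin n → Fin p → ℝ} {η₀ : Idx n → ℝ} {γ₀ : Fin p → ℝ}

/-- The linear statistic `∑ c_{ij} (a_{ij} - μ(π_{ij}))` of the graph `a` with weights `c`. -/
noncomputable def linStat (Z : Fin n → Fin n → Fin p → ℝ) (η₀ : Idx n → ℝ) (γ₀ : Fin p → ℝ)
    (c : Fin n → Fin n → ℝ) (a : Adj n) : ℝ :=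
  ∑ i, ∑ j, c i j * resid Z a η₀ γ₀ i j

/-- The variance `∑ c_{ij}² u_{ij}` of the linear statistic with weights `c`. -/
noncomputable def linVar (Z : Fin n → Fin n → Fin p → ℝ) (η₀ : Idx n → ℝ) (γ₀ : Fin p → ℝ)
    (c : Fin n → Fin n → ℝ) : ℝ :=
  ∑ i, ∑ j, c i j ^ 2 * u Z η₀ γ₀ i j

lemma linStat_eq_sum_pair (c : Fin n → Fin n → ℝ) (a : Adj n) :
    linStat Z η₀ γ₀ c a
      = ∑ q : Pair n, c q.1.1 q.1.2 * resid Z a η₀ γ₀ q.1.1 q.1.2 :=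
  (sum_pair (f := fun i j => c i j * resid Z a η₀ γ₀ i j) fun i => by
    rw [resid_self, mul_zero]).symm

lemma linVar_eq_sum_pair (c : Fin n → Fin n → ℝ) :
    linVar Z η₀ γ₀ c = ∑ q : Pair n, c q.1.1 q.1.2 ^ 2 * u Z η₀ γ₀ q.1.1 q.1.2 :=
  (sum_pair (f := fun i j => c i j ^ 2 * u Z η₀ γ₀ i j) fun i => by
    rw [u_self, mul_zero]).symm

namespace IsModel

variable {Ω : Type*} [MeasurableSpace Ω] {P : Measure Ω} {A : Ω → Adj n}

lemma measurable_entry (hA : IsModel P A Z η₀ γ₀) (i j : Fin n) : Measurable fun ω => A ω i j :=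
  (measurable_pi_apply j).comp ((measurable_pi_apply i).comp hA.measurable)

lemma measurable_resid (hA : IsModel P A Z η₀ γ₀) (i j : Fin n) :
    Measurable fun ω => resid Z (A ω) η₀ γ₀ i j :=
  (measurable_of_finite fun b : Bool =>
    if i = j then (0 : ℝ) else (if b = true then 1 else 0) - mu (linPred Z η₀ γ₀ i j)).comp
    (hA.measurable_entry i j)

lemma iIndepFun_mul_resid (hA : IsModel P A Z η₀ γ₀) (c : Fin n → Fin n → ℝ) :
    iIndepFun (fun (q : Pair n) ω =>
      c q.1.1 q.1.2 * resid Z (A ω) η₀ γ₀ q.1.1 q.1.2) P :=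
  hA.indep.comp (fun q (b : Bool) => c q.1.1 q.1.2 * (if q.1.1 = q.1.2 then 0 else
    (if b = true then 1 else 0) - mu (linPred Z η₀ γ₀ q.1.1 q.1.2)))
    fun _ => measurable_of_finite _

variable [IsProbabilityMeasure P]

lemma integral_entry (hA : IsModel P A Z η₀ γ₀) {i j : Fin n} (hij : i ≠ j)
    {E : Type*} [NormedAddCommGroup E] [NormedSpace ℝ E] [CompleteSpace E] (f : Bool → E) :
    ∫ ω, f (A ω i j) ∂P = mu (linPred Z η₀ γ₀ i j) • f true
      + (1 - mu (linPred Z η₀ γ₀ i j)) • f false := by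
  have hedge : MeasurableSet {ω | A ω i j = true} :=
    hA.measurable_entry i j (measurableSet_singleton true)
  have hf : ∀ ω, f (A ω i j)
      = {ω | A ω i j = true}.indicator (fun _ => f true - f false) ω + f false := fun ω => by
    cases hω : A ω i j <;> simp [Set.indicator, hω]
  simp only [hf]
  rw [integral_add ((integrable_const _).indicator hedge) (integrable_const _),
    integral_indicator_const _ hedge, integral_const, probReal_univ, Measure.real,
    hA.prob i j hij, ENNReal.toReal_ofReal (mu_pos _).le]
  module

lemma integral_resid (hA : IsModel P A Z η₀ γ₀) {i j : Fin n} (hij : i ≠ j) :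
    ∫ ω, resid Z (A ω) η₀ γ₀ i j ∂P = 0 := by
  simp only [resid, if_neg hij]
  rw [hA.integral_entry hij fun b => (if b = true then (1 : ℝ) else 0)
    - mu (linPred Z η₀ γ₀ i j)]
  simp only [if_true, Bool.false_eq_true, if_false, smul_eq_mul]
  ring

lemma hasSubgaussianMGF_resid (hA : IsModel P A Z η₀ γ₀) {i j : Fin n} (hij : i ≠ j) :
    HasSubgaussianMGF (fun ω => resid Z (A ω) η₀ γ₀ i j) (1 / 4) P := by
  have hmem : ∀ ω, resid Z (A ω) η₀ γ₀ i j ∈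
      Set.Icc (-mu (linPred Z η₀ γ₀ i j)) (1 - mu (linPred Z η₀ γ₀ i j)) := fun ω => by
    simp only [resid, if_neg hij]
    split_ifs <;> constructor <;> simp
  convert hasSubgaussianMGF_of_mem_Icc_of_integral_eq_zero
    (hA.measurable_resid i j).aemeasurable (ae_of_all P hmem) (hA.integral_resid hij) using 1
  rw [sub_neg_eq_add, sub_add_cancel, nnnorm_one]
  norm_num

lemma hasSubgaussianMGF_linStat (hA : IsModel P A Z η₀ γ₀) {c : Fin n → Fin n → ℝ} {v : NNReal}
    (hv : ∑ i, ∑ j, c i j ^ 2 ≤ v) :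
    HasSubgaussianMGF (fun ω => linStat Z η₀ γ₀ c (A ω)) (v / 4) P := by
  simp only [linStat_eq_sum_pair]
  refine hasSubgaussianMGF_mono (HasSubgaussianMGF.sum_of_iIndepFun (hA.iIndepFun_mul_resid c)
    fun q _ => (hA.hasSubgaussianMGF_resid q.2).const_mul (c q.1.1 q.1.2)) ?_
  rw [← NNReal.coe_le_coe, NNReal.coe_sum]
  change ∑ q : Pair n, c q.1.1 q.1.2 ^ 2 * (1 / 4) ≤ (v : ℝ) / 4
  rw [← Finset.sum_mul]
  linarith [sum_pair_le (f := fun i j => c i j ^ 2) fun i => sq_nonneg (c i i)]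

lemma measureReal_le_abs_linStat_le (hA : IsModel P A Z η₀ γ₀) {c : Fin n → Fin n → ℝ} {v t : ℝ}
    (hv : ∑ i, ∑ j, c i j ^ 2 ≤ v) (ht : 0 ≤ t) :
    P.real {ω | t ≤ |linStat Z η₀ γ₀ c (A ω)|} ≤ 2 * Real.exp (-2 * t ^ 2 / v) := by
  lift v to NNReal using le_trans (by positivity) hv
  convert measureReal_le_abs_le_of_hasSubgaussianMGF (hA.hasSubgaussianMGF_linStat hv) ht
    using 3
  rw [NNReal.coe_div, NNReal.coe_ofNat]
  ring

lemma measureReal_exists_le_abs_linStat_le (hA : IsModel P A Z η₀ γ₀) {ι : Type*} [Fintype ι]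
    {c : ι → Fin n → Fin n → ℝ} {v : ι → ℝ} (hv_pos : ∀ k, 0 < v k)
    (hv : ∀ k, ∑ i, ∑ j, c k i j ^ 2 ≤ v k) {L : ℝ} (hL : 0 ≤ L) :
    P.real {ω | ∃ k, √(v k * L) ≤ |linStat Z η₀ γ₀ (c k) (A ω)|}
      ≤ Fintype.card ι * (2 * Real.exp (-2 * L)) := by
  have htail : ∀ k, P.real {ω | √(v k * L) ≤ |linStat Z η₀ γ₀ (c k) (A ω)|}
      ≤ 2 * Real.exp (-2 * L) := fun k => by
    have hvk := hv_pos k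
    refine (hA.measureReal_le_abs_linStat_le (hv k) (Real.sqrt_nonneg _)).trans_eq ?_
    rw [Real.sq_sqrt (by positivity)]
    field_simp
  calc P.real {ω | ∃ k, √(v k * L) ≤ |linStat Z η₀ γ₀ (c k) (A ω)|}
      ≤ ∑ k, P.real {ω | √(v k * L) ≤ |linStat Z η₀ γ₀ (c k) (A ω)|} := by
        rw [Set.ofPred_exists]
        exact measureReal_iUnion_fintype_le _
    _ ≤ ∑ _k : ι, 2 * Real.exp (-2 * L) := Finset.sum_le_sum fun k _ => htail k
    _ = Fintype.card ι * (2 * Real.exp (-2 * L)) := by simp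

end IsModel

end LinearStatistics

/-! ### Characteristic functions of linear statistics -/

section CharFun

lemma norm_prod_sub_prod_le {ι R : Type*} [NormedCommRing R] [NormOneClass R] (s : Finset ι)
    {f g : ι → R} (hf : ∀ i ∈ s, ‖f i‖ ≤ 1) (hg : ∀ i ∈ s, ‖g i‖ ≤ 1) :
    ‖∏ i ∈ s, f i - ∏ i ∈ s, g i‖ ≤ ∑ i ∈ s, ‖f i - g i‖ := by
  induction s using Finset.cons_induction with
  | empty => simp
  | cons a s ha ih =>
    rw [Finset.forall_mem_cons] at hf hg
    have hprod : ‖∏ i ∈ s, f i‖ ≤ 1 := (Finset.norm_prod_le s f).trans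
      (Finset.prod_le_one (fun _ _ => norm_nonneg _) hf.2)
    rw [Finset.prod_cons, Finset.prod_cons, Finset.sum_cons]
    calc ‖f a * ∏ i ∈ s, f i - g a * ∏ i ∈ s, g i‖
        = ‖(f a - g a) * ∏ i ∈ s, f i + g a * (∏ i ∈ s, f i - ∏ i ∈ s, g i)‖ := by ring_nf
      _ ≤ ‖f a - g a‖ * ‖∏ i ∈ s, f i‖ + ‖g a‖ * ‖∏ i ∈ s, f i - ∏ i ∈ s, g i‖ :=
          (norm_add_le _ _).trans (add_le_add (norm_mul_le _ _) (norm_mul_le _ _))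
      _ ≤ ‖f a - g a‖ + ∑ i ∈ s, ‖f i - g i‖ :=
          add_le_add (mul_le_of_le_one_right (norm_nonneg _) hprod)
            ((mul_le_of_le_one_left (norm_nonneg _) hg.1).trans (ih hf.2 hg.2))

lemma norm_exp_mul_I_sub_le {x : ℝ} (hx : |x| ≤ 1) :
    ‖Complex.exp (x * Complex.I) - (1 + x * Complex.I - x ^ 2 / 2)‖ ≤ |x| ^ 3 := by
  have hnorm : ‖(x : ℂ) * Complex.I‖ = |x| := by simp
  have htaylor : ∑ m ∈ Finset.range 3, ((x : ℂ) * Complex.I) ^ m / m.factorial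
      = 1 + x * Complex.I - x ^ 2 / 2 := by
    simp only [Finset.sum_range_succ, Finset.sum_range_zero, mul_pow, Complex.I_sq,
      Nat.factorial]
    push_cast
    ring
  have hbound := Complex.exp_bound (hnorm.trans_le hx) (n := 3) (by norm_num)
  rw [htaylor, hnorm] at hbound
  refine hbound.trans (mul_le_of_le_one_right (by positivity) ?_)
  norm_num [Nat.factorial]

lemma norm_exp_neg_sub_le {s : ℝ} (hs : |s| ≤ 1) :
    ‖Complex.exp ((-s : ℝ) : ℂ) - (1 - (s : ℂ))‖ ≤ s ^ 2 := by
  have hreal : Complex.exp ((-s : ℝ) : ℂ) - (1 - (s : ℂ))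
      = ((Real.exp (-s) - 1 - (-s) : ℝ) : ℂ) := by
    push_cast
    ring
  rw [hreal, Complex.norm_real, Real.norm_eq_abs, ← neg_sq s]
  exact Real.abs_exp_sub_one_sub_id_le (by rwa [abs_neg])

/-- The characteristic function `E exp(i c (X - m))` of the centered Bernoulli(`m`) variable. -/
noncomputable def centeredBernoulliCharFun (m c : ℝ) : ℂ :=
  m • Complex.exp ((c * (1 - m) : ℝ) * Complex.I)
    + (1 - m) • Complex.exp ((c * (0 - m) : ℝ) * Complex.I)

lemma norm_centeredBernoulliCharFun_sub_quadratic_le {m c : ℝ} (hm0 : 0 ≤ m) (hm1 : m ≤ 1)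
    (hc : |c| ≤ 1) :
    ‖centeredBernoulliCharFun m c - (1 - ((c ^ 2 * (m * (1 - m)) / 2 : ℝ) : ℂ))‖
      ≤ |c| * (c ^ 2 * (m * (1 - m))) := by
  have hm1' : 0 ≤ 1 - m := sub_nonneg.2 hm1
  have habs1 : |c * (1 - m)| = |c| * (1 - m) := by rw [abs_mul, abs_of_nonneg hm1']
  have habs0 : |c * (0 - m)| = |c| * m := by rw [abs_mul, zero_sub, abs_neg, abs_of_nonneg hm0]
  have htaylor1 := norm_exp_mul_I_sub_le (x := c * (1 - m))
    (by rw [habs1]; nlinarith [abs_nonneg c])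
  have htaylor0 := norm_exp_mul_I_sub_le (x := c * (0 - m))
    (by rw [habs0]; nlinarith [abs_nonneg c])
  rw [habs1] at htaylor1
  rw [habs0] at htaylor0
  have hdecomp : centeredBernoulliCharFun m c - (1 - ((c ^ 2 * (m * (1 - m)) / 2 : ℝ) : ℂ))
      = m • (Complex.exp ((c * (1 - m) : ℝ) * Complex.I)
          - (1 + ((c * (1 - m) : ℝ) : ℂ) * Complex.I - ((c * (1 - m) : ℝ) : ℂ) ^ 2 / 2))
        + (1 - m) • (Complex.exp ((c * (0 - m) : ℝ) * Complex.I)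
          - (1 + ((c * (0 - m) : ℝ) : ℂ) * Complex.I - ((c * (0 - m) : ℝ) : ℂ) ^ 2 / 2)) := by
    simp only [centeredBernoulliCharFun, Complex.real_smul]
    push_cast
    ring
  calc ‖centeredBernoulliCharFun m c - (1 - ((c ^ 2 * (m * (1 - m)) / 2 : ℝ) : ℂ))‖
      ≤ m * (|c| * (1 - m)) ^ 3 + (1 - m) * (|c| * m) ^ 3 := by
        rw [hdecomp]
        refine (norm_add_le _ _).trans ?_
        rw [norm_smul_of_nonneg hm0, norm_smul_of_nonneg hm1']
        gcongr
    _ = |c| * (|c| ^ 2 * (m * (1 - m))) * ((1 - m) ^ 2 + m ^ 2) := by ring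
    _ ≤ |c| * (c ^ 2 * (m * (1 - m))) := by
        rw [sq_abs]
        exact mul_le_of_le_one_right (by positivity) (by nlinarith)

lemma norm_centeredBernoulliCharFun_sub_exp_le {m c : ℝ} (hm0 : 0 ≤ m) (hm1 : m ≤ 1)
    (hc : |c| ≤ 1) :
    ‖centeredBernoulliCharFun m c - Complex.exp ((-(c ^ 2 * (m * (1 - m)) / 2) : ℝ) : ℂ)‖
      ≤ 2 * (|c| * (c ^ 2 * (m * (1 - m)))) := by
  have hvar0 : 0 ≤ m * (1 - m) := mul_nonneg hm0 (sub_nonneg.2 hm1)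
  have hvar1 : m * (1 - m) ≤ 1 := by nlinarith
  have hc2 : c ^ 2 ≤ 1 := (sq_le_one_iff_abs_le_one c).2 hc
  set s := c ^ 2 * (m * (1 - m)) / 2 with hs
  have hs_sq : s ^ 2 ≤ |c| * (c ^ 2 * (m * (1 - m))) :=
    calc s ^ 2 = |c| * (c ^ 2 * (m * (1 - m))) * (|c| * (m * (1 - m)) / 4) := by
          rw [hs, ← sq_abs c]
          ring
      _ ≤ |c| * (c ^ 2 * (m * (1 - m))) :=
          mul_le_of_le_one_right (by positivity) (by nlinarith [abs_nonneg c])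
  have hs_le : |s| ≤ 1 := by
    rw [abs_of_nonneg (by positivity), hs]
    nlinarith
  have hsub := norm_sub_le_norm_sub_add_norm_sub (centeredBernoulliCharFun m c) (1 - (s : ℂ))
    (Complex.exp ((-s : ℝ) : ℂ))
  rw [norm_sub_rev (1 - (s : ℂ))] at hsub
  linarith [norm_centeredBernoulliCharFun_sub_quadratic_le hm0 hm1 hc, norm_exp_neg_sub_le hs_le]

variable {n p : ℕ} {Ω : Type*} [MeasurableSpace Ω] {P : Measure Ω} {A : Ω → Adj n}
  {Z : Fin n → Fin n → Fin p → ℝ} {η₀ : Idx n → ℝ} {γ₀ : Fin p → ℝ}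

namespace IsModel

lemma integral_exp_linStat (hA : IsModel P A Z η₀ γ₀) (c : Fin n → Fin n → ℝ) :
    ∫ ω, Complex.exp ((linStat Z η₀ γ₀ c (A ω) : ℂ) * Complex.I) ∂P
      = ∏ q : Pair n, ∫ ω, Complex.exp
          (((c q.1.1 q.1.2 * resid Z (A ω) η₀ γ₀ q.1.1 q.1.2 : ℝ) : ℂ) * Complex.I) ∂P := by
  rw [← (hA.iIndepFun_mul_resid c).integral_fun_prod_comp
    (f := fun _ (x : ℝ) => Complex.exp ((x : ℂ) * Complex.I))
    (fun q => ((hA.measurable_resid q.1.1 q.1.2).const_mul _).aemeasurable)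
    (fun q => by fun_prop)]
  simp only [linStat_eq_sum_pair, Complex.ofReal_sum, Finset.sum_mul, Complex.exp_sum]

variable [IsProbabilityMeasure P]

lemma integral_exp_mul_resid (hA : IsModel P A Z η₀ γ₀) {i j : Fin n} (hij : i ≠ j) (c : ℝ) :
    ∫ ω, Complex.exp (((c * resid Z (A ω) η₀ γ₀ i j : ℝ) : ℂ) * Complex.I) ∂P
      = centeredBernoulliCharFun (mu (linPred Z η₀ γ₀ i j)) c := by
  simp only [resid, if_neg hij]
  rw [hA.integral_entry hij fun b => Complex.exp (((c * ((if b = true then 1 else 0)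
    - mu (linPred Z η₀ γ₀ i j)) : ℝ) : ℂ) * Complex.I)]
  simp only [if_true, Bool.false_eq_true, if_false, centeredBernoulliCharFun]

lemma norm_integral_exp_mul_resid_sub_le (hA : IsModel P A Z η₀ γ₀) {i j : Fin n} (hij : i ≠ j)
    {c ε : ℝ} (hc : |c| ≤ ε) (hε : ε ≤ 1) :
    ‖∫ ω, Complex.exp (((c * resid Z (A ω) η₀ γ₀ i j : ℝ) : ℂ) * Complex.I) ∂P
        - Complex.exp ((-(c ^ 2 * u Z η₀ γ₀ i j / 2) : ℝ) : ℂ)‖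
      ≤ 2 * ε * (c ^ 2 * u Z η₀ γ₀ i j) := by
  have hu : u Z η₀ γ₀ i j
      = mu (linPred Z η₀ γ₀ i j) * (1 - mu (linPred Z η₀ γ₀ i j)) := by
    rw [u, if_neg hij, muDeriv_eq_mu_mul]
  rw [hA.integral_exp_mul_resid hij, hu]
  refine (norm_centeredBernoulliCharFun_sub_exp_le (mu_pos _).le (mu_lt_one _).le
    (hc.trans hε)).trans ?_
  rw [← hu, mul_assoc]
  have := u_nonneg (Z := Z) (η₀ := η₀) (γ₀ := γ₀) i j
  gcongr

lemma norm_integral_exp_linStat_sub_le (hA : IsModel P A Z η₀ γ₀) {c : Fin n → Fin n → ℝ}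
    {ε : ℝ} (hc : ∀ i j, i ≠ j → |c i j| ≤ ε) (hε : ε ≤ 1) :
    ‖∫ ω, Complex.exp ((linStat Z η₀ γ₀ c (A ω) : ℂ) * Complex.I) ∂P
        - Complex.exp ((-linVar Z η₀ γ₀ c / 2 : ℝ) : ℂ)‖ ≤ 2 * ε * linVar Z η₀ γ₀ c := by
  have hgauss : Complex.exp ((-linVar Z η₀ γ₀ c / 2 : ℝ) : ℂ) = ∏ q : Pair n,
      Complex.exp ((-(c q.1.1 q.1.2 ^ 2 * u Z η₀ γ₀ q.1.1 q.1.2 / 2) : ℝ) : ℂ) := by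
    rw [linVar_eq_sum_pair, ← Complex.exp_sum, ← Complex.ofReal_sum, Finset.sum_neg_distrib,
      neg_div, Finset.sum_div]
  rw [hA.integral_exp_linStat, hgauss]
  refine (norm_prod_sub_prod_le _ (fun q _ => ?_) (fun q _ => ?_)).trans ?_
  · refine (norm_integral_le_integral_norm _).trans ?_
    simp only [Complex.norm_exp_ofReal_mul_I, integral_const, probReal_univ, smul_eq_mul, mul_one,
      le_refl]
  · rw [← Complex.ofReal_exp, Complex.norm_real, Real.norm_eq_abs, Real.abs_exp,
      Real.exp_le_one_iff, neg_nonpos]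
    have := u_nonneg (Z := Z) (η₀ := η₀) (γ₀ := γ₀) q.1.1 q.1.2
    positivity
  · rw [linVar_eq_sum_pair, Finset.mul_sum]
    exact Finset.sum_le_sum fun q _ =>
      hA.norm_integral_exp_mul_resid_sub_le q.2 (hc _ _ q.2) hε

end IsModel

end CharFun

/-! ### The exceptional event -/

section ExceptionalEvent

variable {n p : ℕ} {Z : Fin n → Fin n → Fin p → ℝ} {η₀ : Idx n → ℝ} {γ₀ : Fin p → ℝ}

/-- The `l`-th covariate minus its weighted row and column means, which makes
`∑ covWeight_{ij} w_{ij}` the covariance of the covariate with the interaction part of `w`. -/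
noncomputable def covWeight (Z : Fin n → Fin n → Fin p → ℝ) (η₀ : Idx n → ℝ) (γ₀ : Fin p → ℝ)
    (l : Fin p) (i j : Fin n) : ℝ :=
  (if i = j then 0 else Z i j l) - (∑ k, u Z η₀ γ₀ i k * Z i k l) / uRow Z η₀ γ₀ i
    - (∑ k, u Z η₀ γ₀ k j * Z k j l) / uCol Z η₀ γ₀ j

/-- The index set of the linear statistics that `SmallNoise` controls: the row effects, the column
effects, the weighted row sums of the column effects, the weighted column sums of the row effects,
and the covariances of the interactions with the covariates. -/
abbrev NoiseIdx (n p : ℕ) : Type := (Fin n ⊕ Fin n) ⊕ ((Fin n ⊕ Fin n) ⊕ Fin p)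

/-- The weights of the linear statistics that `SmallNoise` controls. -/
noncomputable def noiseWeight (Z : Fin n → Fin n → Fin p → ℝ) (η₀ : Idx n → ℝ) (γ₀ : Fin p → ℝ) :
    NoiseIdx n p → Fin n → Fin n → ℝ :=
  Sum.elim
    (Sum.elim (fun a i _ => if a = i then 1 / uRow Z η₀ γ₀ a else 0)
      (fun a _ j => if a = j then 1 / uCol Z η₀ γ₀ a else 0))
    (Sum.elim
      (Sum.elim (fun a _ j => u Z η₀ γ₀ a j / uCol Z η₀ γ₀ j)
        (fun a i _ => u Z η₀ γ₀ i a / uRow Z η₀ γ₀ i))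
      (covWeight Z η₀ γ₀))

/-- Upper bounds for the sums of squares of the weights `noiseWeight`. -/
noncomputable def noiseVar (n p : ℕ) (B M : ℝ) : NoiseIdx n p → ℝ :=
  Sum.elim (fun _ => (2 * B) ^ 2 / n) (Sum.elim (fun _ => (B / 2) ^ 2) (fun _ => (3 * M * n) ^ 2))

/-- The high-probability bound for the row and column effects of the residuals. -/
noncomputable def effectBound (n : ℕ) (B : ℝ) : ℝ := 2 * B * √(Real.log n) / √n

/-- The high-probability bound for the weighted means of the effects of the residuals. -/
noncomputable def meanEffectBound (n : ℕ) (B : ℝ) : ℝ := B ^ 2 * √(Real.log n) / n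

/-- The radius of the ball around the true parameter in which the likelihood equations are
solved. -/
noncomputable def newtonRadius (n p : ℕ) (B M κ : ℝ) : ℝ :=
  2 * (2 * effectBound n B + fisherInvBound p B M κ * meanEffectBound n B)

/-- The error in the linear approximation of the outgoingness estimates. -/
noncomputable def expansionError (n p : ℕ) (B M κ : ℝ) : ℝ :=
  fisherInvBound p B M κ * meanEffectBound n B
    + newtonLip p B M κ (newtonRadius n p B M κ) * newtonRadius n p B M κ

lemma linStat_noiseWeight_row (a : Adj n) (i : Fin n) :
    linStat Z η₀ γ₀ (noiseWeight Z η₀ γ₀ (Sum.inl (Sum.inl i))) a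
      = rowEffect Z η₀ γ₀ (resid Z a η₀ γ₀) i := by
  simp only [linStat, noiseWeight, Sum.elim_inl, ite_mul, zero_mul, rowEffect]
  rw [Finset.sum_comm]
  simp only [Finset.sum_ite_eq, Finset.mem_univ, if_true]
  rw [← Finset.mul_sum, one_div_mul_eq_div]

lemma linStat_noiseWeight_col (a : Adj n) (j : Fin n) :
    linStat Z η₀ γ₀ (noiseWeight Z η₀ γ₀ (Sum.inl (Sum.inr j))) a
      = colEffect Z η₀ γ₀ (resid Z a η₀ γ₀) j := by
  simp only [linStat, noiseWeight, Sum.elim_inl, Sum.elim_inr, ite_mul, zero_mul, colEffect,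
    Finset.sum_ite_eq, Finset.mem_univ, if_true]
  rw [← Finset.mul_sum, one_div_mul_eq_div]

lemma linStat_noiseWeight_mean_col (a : Adj n) (i : Fin n) :
    linStat Z η₀ γ₀ (noiseWeight Z η₀ γ₀ (Sum.inr (Sum.inl (Sum.inl i)))) a
      = ∑ j, u Z η₀ γ₀ i j * colEffect Z η₀ γ₀ (resid Z a η₀ γ₀) j := by
  simp only [linStat, noiseWeight, Sum.elim_inl, Sum.elim_inr, colEffect]
  rw [Finset.sum_comm]
  exact Finset.sum_congr rfl fun j _ => by rw [← Finset.mul_sum, div_mul_eq_mul_div, mul_div_assoc]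

lemma linStat_noiseWeight_mean_row (a : Adj n) (j : Fin n) :
    linStat Z η₀ γ₀ (noiseWeight Z η₀ γ₀ (Sum.inr (Sum.inl (Sum.inr j)))) a
      = ∑ i, u Z η₀ γ₀ i j * rowEffect Z η₀ γ₀ (resid Z a η₀ γ₀) i := by
  simp only [linStat, noiseWeight, Sum.elim_inl, Sum.elim_inr, rowEffect]
  exact Finset.sum_congr rfl fun i _ => by rw [← Finset.mul_sum, div_mul_eq_mul_div, mul_div_assoc]

lemma sum_covWeight_mul {w : Fin n → Fin n → ℝ} (hw : ∀ i, w i i = 0) (l : Fin p) :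
    ∑ i, ∑ j, covWeight Z η₀ γ₀ l i j * w i j
      = ∑ i, ∑ j, interaction Z η₀ γ₀ w i j * Z i j l := by
  have hrow : ∑ i, ∑ j, (∑ k, u Z η₀ γ₀ i k * Z i k l) / uRow Z η₀ γ₀ i * w i j
      = ∑ i, ∑ j, u Z η₀ γ₀ i j * rowEffect Z η₀ γ₀ w i * Z i j l := by
    refine Finset.sum_congr rfl fun i _ => ?_
    rw [← Finset.mul_sum, div_mul_eq_mul_div, ← mul_div_assoc', Finset.sum_mul]
    exact Finset.sum_congr rfl fun j _ => mul_right_comm _ _ _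
  have hcol : ∑ i, ∑ j, (∑ k, u Z η₀ γ₀ k j * Z k j l) / uCol Z η₀ γ₀ j * w i j
      = ∑ i, ∑ j, u Z η₀ γ₀ i j * colEffect Z η₀ γ₀ w j * Z i j l := by
    rw [Finset.sum_comm, Finset.sum_comm (f := fun i j => _ * colEffect Z η₀ γ₀ w j * _)]
    refine Finset.sum_congr rfl fun j _ => ?_
    rw [← Finset.mul_sum, div_mul_eq_mul_div, ← mul_div_assoc', Finset.sum_mul]
    exact Finset.sum_congr rfl fun i _ => mul_right_comm _ _ _
  have hdiag : ∀ i j, (if i = j then 0 else Z i j l) * w i j = w i j * Z i j l := fun i j => by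
    split_ifs with hij
    · rw [hij, hw, mul_zero, zero_mul]
    · exact mul_comm _ _
  simp only [covWeight, interaction, sub_mul, mul_add, add_mul, Finset.sum_sub_distrib,
    Finset.sum_add_distrib, hrow, hcol, hdiag]
  ring

lemma linStat_covWeight (a : Adj n) (l : Fin p) :
    linStat Z η₀ γ₀ (noiseWeight Z η₀ γ₀ (Sum.inr (Sum.inr l))) a
      = ∑ i, ∑ j, interaction Z η₀ γ₀ (resid Z a η₀ γ₀) i j * Z i j l :=
  sum_covWeight_mul (fun i => resid_self a η₀ γ₀ i) l

lemma sum_sq_le {c : Fin n → Fin n → ℝ} {C : ℝ} (hc : ∀ i j, |c i j| ≤ C) :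
    ∑ i, ∑ j, c i j ^ 2 ≤ C ^ 2 * (n : ℝ) ^ 2 :=
  (le_abs_self _).trans (abs_sum_sum_le_mul_sq fun i j => by
    rw [abs_of_nonneg (sq_nonneg _)]
    exact sq_le_sq.2 ((hc i j).trans (le_abs_self C)))

namespace VarianceBound

variable {B : ℝ}

lemma abs_u_div_le (h : VarianceBound Z η₀ γ₀ B) {x : ℝ} (hx : n / (2 * B) ≤ x) (i j : Fin n) :
    |u Z η₀ γ₀ i j / x| ≤ B / (2 * n) := by
  have hB := h.B_pos
  have hn := h.n_pos
  have hx_pos : 0 < x := h.half_div_pos.trans_le hx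
  rw [abs_of_nonneg (div_nonneg (u_nonneg i j) hx_pos.le), div_le_iff₀ hx_pos]
  calc u Z η₀ γ₀ i j ≤ 1 / 4 := u_le_quarter i j
    _ = B / (2 * n) * (n / (2 * B)) := by field_simp; norm_num
    _ ≤ B / (2 * n) * x := by gcongr

lemma mul_one_div_sq_le (h : VarianceBound Z η₀ γ₀ B) {x : ℝ} (hx : n / (2 * B) ≤ x) :
    n * (1 / x) ^ 2 ≤ (2 * B) ^ 2 / n := by
  have hB := h.B_pos
  have hn := h.n_pos
  calc n * (1 / x) ^ 2 ≤ n * (1 / (n / (2 * B))) ^ 2 := by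
        have hx_pos : 0 < x := h.half_div_pos.trans_le hx
        have := h.half_div_pos
        gcongr
    _ = (2 * B) ^ 2 / n := by field_simp

lemma half_mul_sqrt_log_le (h : VarianceBound Z η₀ γ₀ B) {x : ℝ} (hx : n / (2 * B) ≤ x) :
    B / 2 * √(Real.log n) ≤ meanEffectBound n B * x := by
  have hB := h.B_pos
  have hn := h.n_pos
  calc B / 2 * √(Real.log n) = meanEffectBound n B * (n / (2 * B)) := by
        rw [meanEffectBound]
        field_simp
    _ ≤ meanEffectBound n B * x := by
        rw [meanEffectBound]
        gcongr

end VarianceBound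

namespace Regular

variable {B M κ : ℝ}

lemma abs_covWeight_le (h : Regular Z η₀ γ₀ B M κ) (l : Fin p) (i j : Fin n) :
    |covWeight Z η₀ γ₀ l i j| ≤ 3 * M := by
  have hentry : |if i = j then 0 else Z i j l| ≤ M := by
    split_ifs with hij
    · rw [abs_zero]
      exact h.M_pos.le
    · exact h.Z_le i j hij l
  have hrow : |(∑ k, u Z η₀ γ₀ i k * Z i k l) / uRow Z η₀ γ₀ i| ≤ M := by
    rw [abs_div, abs_of_pos (h.uRow_pos i), div_le_iff₀ (h.uRow_pos i)]
    exact abs_sum_row_u_mul_le (g := fun i j => Z i j l) (fun i j hij => h.Z_le i j hij l) i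
  have hcol : |(∑ k, u Z η₀ γ₀ k j * Z k j l) / uCol Z η₀ γ₀ j| ≤ M := by
    rw [abs_div, abs_of_pos (h.uCol_pos j), div_le_iff₀ (h.uCol_pos j)]
    exact abs_sum_col_u_mul_le (g := fun i j => Z i j l) (fun i j hij => h.Z_le i j hij l) j
  calc |covWeight Z η₀ γ₀ l i j| ≤ M + M + M :=
        (abs_sub _ _).trans (add_le_add ((abs_sub _ _).trans (add_le_add hentry hrow)) hcol)
    _ = 3 * M := by ring

lemma noiseVar_pos (h : Regular Z η₀ γ₀ B M κ) (k : NoiseIdx n p) : 0 < noiseVar n p B M k := by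
  have hB := h.B_pos
  have hM := h.M_pos
  have hn := h.n_pos
  rcases k with _ | _ | _ <;> simp only [noiseVar, Sum.elim_inl, Sum.elim_inr] <;> positivity

lemma sum_sq_noiseWeight_le (h : Regular Z η₀ γ₀ B M κ) (k : NoiseIdx n p) :
    ∑ i, ∑ j, noiseWeight Z η₀ γ₀ k i j ^ 2 ≤ noiseVar n p B M k := by
  have hn := h.n_pos
  have hmean : (B / (2 * n)) ^ 2 * (n : ℝ) ^ 2 = (B / 2) ^ 2 := by field_simp
  rcases k with (i | j) | (i | j) | l
  · simpa [noiseWeight, noiseVar] using h.mul_one_div_sq_le (h.uRow_ge i)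
  · simpa [noiseWeight, noiseVar] using h.mul_one_div_sq_le (h.uCol_ge j)
  · exact (sum_sq_le fun _ j => h.abs_u_div_le (h.uCol_ge j) i j).trans hmean.le
  · exact (sum_sq_le fun i _ => h.abs_u_div_le (h.uRow_ge i) i j).trans hmean.le
  · refine (sum_sq_le (h.abs_covWeight_le l)).trans_eq ?_
    simp only [noiseVar, Sum.elim_inr]
    ring

lemma smallNoise_of_abs_linStat_le (h : Regular Z η₀ γ₀ B M κ) {a : Adj n}
    (ha : ∀ k, |linStat Z η₀ γ₀ (noiseWeight Z η₀ γ₀ k) a| ≤ √(noiseVar n p B M k * Real.log n)) :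
    SmallNoise Z η₀ γ₀ M (effectBound n B) (meanEffectBound n B) (resid Z a η₀ γ₀) := by
  have hB := h.B_pos
  have hM := h.M_pos
  have hn := h.n_pos
  have heffect : √((2 * B) ^ 2 / n * Real.log n) = effectBound n B := by
    rw [effectBound, Real.sqrt_mul (by positivity), Real.sqrt_div (by positivity),
      Real.sqrt_sq (by positivity), div_mul_eq_mul_div]
  have hmean : √((B / 2) ^ 2 * Real.log n) = B / 2 * √(Real.log n) := by
    rw [Real.sqrt_mul (by positivity), Real.sqrt_sq (by positivity)]
  refine ⟨fun i => ?_, fun j => ?_, fun i => ?_, fun j => ?_, fun l => ?_⟩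
  · rw [← linStat_noiseWeight_row, ← heffect]
    exact ha (Sum.inl (Sum.inl i))
  · rw [← linStat_noiseWeight_col, ← heffect]
    exact ha (Sum.inl (Sum.inr j))
  · rw [← linStat_noiseWeight_mean_col]
    exact ((ha (Sum.inr (Sum.inl (Sum.inl i)))).trans_eq hmean).trans
      (h.half_mul_sqrt_log_le (h.uRow_ge i))
  · rw [← linStat_noiseWeight_mean_row]
    exact ((ha (Sum.inr (Sum.inl (Sum.inr j)))).trans_eq hmean).trans
      (h.half_mul_sqrt_log_le (h.uCol_ge j))
  · rw [← linStat_covWeight]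
    have hB2 : 3 ≤ B ^ 2 := by nlinarith [h.four_le_B]
    calc |linStat Z η₀ γ₀ (noiseWeight Z η₀ γ₀ (Sum.inr (Sum.inr l))) a|
        ≤ √((3 * M * n) ^ 2 * Real.log n) := ha _
      _ = 3 * (M * n * √(Real.log n)) := by
          rw [Real.sqrt_mul (by positivity), Real.sqrt_sq (by positivity)]
          ring
      _ ≤ B ^ 2 * (M * n * √(Real.log n)) := by gcongr
      _ = M * meanEffectBound n B * n ^ 2 := by
          rw [meanEffectBound]
          field_simp

variable {Ω : Type*} [MeasurableSpace Ω] {P : Measure Ω} [IsProbabilityMeasure P] {A : Ω → Adj n}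

lemma measureReal_not_smallNoise_le (h : Regular Z η₀ γ₀ B M κ) (hA : IsModel P A Z η₀ γ₀) :
    P.real {ω | ¬ SmallNoise Z η₀ γ₀ M (effectBound n B) (meanEffectBound n B)
      (resid Z (A ω) η₀ γ₀)} ≤ (4 * n + p) * (2 * Real.exp (-2 * Real.log n)) := by
  have hcard : ((Fintype.card (NoiseIdx n p) : ℕ) : ℝ) = 4 * n + p := by
    simp only [Fintype.card_sum, Fintype.card_fin]
    push_cast
    ring
  rw [← hcard]
  refine (measureReal_mono fun ω hω => ?_).trans (hA.measureReal_exists_le_abs_linStat_le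
    h.noiseVar_pos h.sum_sq_noiseWeight_le (Real.log_natCast_nonneg n))
  contrapose! hω
  simp only [Set.mem_ofPred_eq, not_exists, not_le, not_not] at hω ⊢
  exact h.smallNoise_of_abs_linStat_le fun k => (hω k).le

lemma measureReal_not_mleExpansion_le (h : Regular Z η₀ γ₀ B M κ) (hA : IsModel P A Z η₀ γ₀)
    {last : Fin n} (hlast : (last : ℕ) = n - 1)
    (hr : (2 + p * M) * newtonRadius n p B M κ ≤ 1)
    (hq : newtonLip p B M κ (newtonRadius n p B M κ) ≤ 1 / 2) :
    P.real {ω | ¬ MLEExpansion Z η₀ γ₀ last (expansionError n p B M κ) (A ω)}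
      ≤ (4 * n + p) * (2 * Real.exp (-2 * Real.log n)) := by
  refine (measureReal_mono fun ω => mt fun hsmall => ?_).trans (h.measureReal_not_smallNoise_le hA)
  exact h.mleExpansion hsmall hlast (by rw [newtonRadius]; linarith) hr hq

end Regular

end ExceptionalEvent

/-! ### The covariance block and its square root -/

section Sqrt

variable {ι : Type*} [Fintype ι] [DecidableEq ι]

lemma transpose_inv_sqrt (C : Matrix ι ι ℝ) : ((CFC.sqrt C)⁻¹)ᵀ = (CFC.sqrt C)⁻¹ := by
  have isHermitian_sqrt : (CFC.sqrt C).IsHermitian :=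
    (Matrix.nonneg_iff_posSemidef.1 (CFC.sqrt_nonneg C)).isHermitian
  rw [Matrix.transpose_nonsing_inv, ← Matrix.conjTranspose_eq_transpose_of_trivial,
    isHermitian_sqrt.eq]

lemma dotProduct_inv_sqrt_mulVec (C : Matrix ι ι ℝ) (x t : ι → ℝ) :
    t ⬝ᵥ ((CFC.sqrt C)⁻¹ *ᵥ x) = ((CFC.sqrt C)⁻¹ *ᵥ t) ⬝ᵥ x := by
  rw [Matrix.dotProduct_mulVec, ← Matrix.mulVec_transpose, transpose_inv_sqrt]

lemma isUnit_sqrt {C : Matrix ι ι ℝ} (hC : C.PosDef) : IsUnit (CFC.sqrt C) :=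
  (CFC.isUnit_sqrt_iff C (Matrix.nonneg_iff_posSemidef.2 hC.posSemidef)).2 hC.isUnit

lemma mulVec_inv_sqrt_mulVec {C : Matrix ι ι ℝ} (hC : C.PosDef) (t : ι → ℝ) :
    C *ᵥ ((CFC.sqrt C)⁻¹ *ᵥ t) = CFC.sqrt C *ᵥ t := by
  have sqrt_mul_sqrt : CFC.sqrt C * CFC.sqrt C = C :=
    CFC.sqrt_mul_sqrt_self C (Matrix.nonneg_iff_posSemidef.2 hC.posSemidef)
  calc C *ᵥ ((CFC.sqrt C)⁻¹ *ᵥ t)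
      = CFC.sqrt C *ᵥ (CFC.sqrt C *ᵥ ((CFC.sqrt C)⁻¹ *ᵥ t)) := by
        rw [Matrix.mulVec_mulVec _ (CFC.sqrt C), sqrt_mul_sqrt]
    _ = CFC.sqrt C *ᵥ t := by rw [mulVec_inv_mulVec (isUnit_sqrt hC)]

lemma inv_sqrt_mulVec_dotProduct_mulVec {C : Matrix ι ι ℝ} (hC : C.PosDef) (t : ι → ℝ) :
    ((CFC.sqrt C)⁻¹ *ᵥ t) ⬝ᵥ (C *ᵥ ((CFC.sqrt C)⁻¹ *ᵥ t)) = t ⬝ᵥ t := by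
  rw [mulVec_inv_sqrt_mulVec hC, ← dotProduct_inv_sqrt_mulVec,
    inv_mulVec_mulVec (isUnit_sqrt hC)]

end Sqrt

section Covariance

variable {n p k : ℕ} {Z : Fin n → Fin n → Fin p → ℝ} {η₀ : Idx n → ℝ} {γ₀ : Fin p → ℝ}
  {B : ℝ} {last : Fin n}

/-- Extension by zero of a vector indexed by the first `k` nodes to all `n` nodes. -/
noncomputable def zeroExtend (hk : k ≤ n) (x : Fin k → ℝ) : Fin n → ℝ :=
  Function.extend (Fin.castLE hk) x 0

lemma zeroExtend_castLE (hk : k ≤ n) (x : Fin k → ℝ) (a : Fin k) :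
    zeroExtend hk x (Fin.castLE hk a) = x a :=
  (Fin.castLE_injective hk).extend_apply _ _ _

lemma sum_zeroExtend (hk : k ≤ n) (x : Fin k → ℝ) {F : Fin n → ℝ → ℝ} (hF : ∀ i, F i 0 = 0) :
    ∑ i, F i (zeroExtend hk x i) = ∑ a, F (Fin.castLE hk a) (x a) := by
  refine (Fintype.sum_of_injective _ (Fin.castLE_injective hk) _ _ (fun i hi => ?_)
    fun a => by rw [zeroExtend_castLE]).symm
  rw [zeroExtend, Function.extend_apply' _ _ _ hi, Pi.zero_apply, hF]

lemma zeroExtend_ne_zero (hk : k ≤ n) {x : Fin k → ℝ} (hx : x ≠ 0) : zeroExtend hk x ≠ 0 := by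
  obtain ⟨a, ha⟩ := Function.ne_iff.1 hx
  exact Function.ne_iff.2 ⟨Fin.castLE hk a, by rwa [zeroExtend_castLE]⟩

/-- The quadratic form at `x` of the block of `S` that belongs to the outgoingness parameters. -/
noncomputable def alphaVar (Z : Fin n → Fin n → Fin p → ℝ) (η₀ : Idx n → ℝ) (γ₀ : Fin p → ℝ)
    (last : Fin n) (x : Fin n → ℝ) : ℝ :=
  ∑ i, x i ^ 2 / uRow Z η₀ γ₀ i + (∑ i, x i) ^ 2 / uCol Z η₀ γ₀ last

lemma uLast_eq (hlast : (last : ℕ) = n - 1) : uLast Z η₀ γ₀ = uCol Z η₀ γ₀ last := by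
  rw [uLast, dif_pos last.pos]
  exact congrArg (uCol Z η₀ γ₀) (Fin.ext hlast.symm)

lemma upperLeft_S_mulVec (hlast : (last : ℕ) = n - 1) (hk : k ≤ n) (x : Fin k → ℝ) (a : Fin k) :
    (upperLeft k (S Z η₀ γ₀) *ᵥ x) a
      = x a / uRow Z η₀ γ₀ (Fin.castLE hk a) + (∑ b, x b) / uCol Z η₀ γ₀ last := by
  simp only [Matrix.mulVec, dotProduct, upperLeft, S, Matrix.of_apply, dif_pos hk,
    Matrix.fromBlocks_apply₁₁, uLast_eq hlast, add_mul, Finset.sum_add_distrib, ← Finset.mul_sum,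
    Fin.castLE_inj, ite_mul, zero_mul, Finset.sum_ite_eq, Finset.mem_univ, if_true]
  ring

lemma dotProduct_upperLeft_S_mulVec (hlast : (last : ℕ) = n - 1) (hk : k ≤ n) (x : Fin k → ℝ) :
    x ⬝ᵥ (upperLeft k (S Z η₀ γ₀) *ᵥ x) = alphaVar Z η₀ γ₀ last (zeroExtend hk x) := by
  rw [alphaVar, sum_zeroExtend hk x (F := fun i t => t ^ 2 / uRow Z η₀ γ₀ i) (by simp),
    sum_zeroExtend hk x (F := fun _ t => t) (fun _ => rfl)]
  simp only [dotProduct, upperLeft_S_mulVec hlast hk, mul_add, Finset.sum_add_distrib,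
    ← Finset.sum_mul]
  congr 1
  · exact Finset.sum_congr rfl fun a _ => by ring
  · ring

lemma isHermitian_upperLeft_S (hk : k ≤ n) : (upperLeft k (S Z η₀ γ₀)).IsHermitian := by
  ext a b
  simp only [Matrix.conjTranspose_apply, upperLeft, S, Matrix.of_apply, dif_pos hk,
    Matrix.fromBlocks_apply₁₁, star_trivial]
  rcases eq_or_ne a b with rfl | hab
  · rfl
  · rw [if_neg (by simpa using hab.symm), if_neg (by simpa using hab)]

namespace VarianceBound

lemma sq_div_uRow_le_alphaVar (h : VarianceBound Z η₀ γ₀ B) (last : Fin n) (x : Fin n → ℝ)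
    (i : Fin n) : x i ^ 2 / uRow Z η₀ γ₀ i ≤ alphaVar Z η₀ γ₀ last x := by
  have single_le := Finset.single_le_sum (f := fun i => x i ^ 2 / uRow Z η₀ γ₀ i)
    (fun i _ => div_nonneg (sq_nonneg _) (h.uRow_pos i).le) (Finset.mem_univ i)
  exact single_le.trans (le_add_of_nonneg_right (div_nonneg (sq_nonneg _) (h.uCol_pos last).le))

lemma alphaVar_pos (h : VarianceBound Z η₀ γ₀ B) (last : Fin n) {x : Fin n → ℝ} (hx : x ≠ 0) :
    0 < alphaVar Z η₀ γ₀ last x := by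
  obtain ⟨i, hi⟩ := Function.ne_iff.1 hx
  exact (div_pos (sq_pos_of_ne_zero hi) (h.uRow_pos i)).trans_le
    (h.sq_div_uRow_le_alphaVar last x i)

lemma posDef_upperLeft_S (h : VarianceBound Z η₀ γ₀ B) (hk : k ≤ n) :
    (upperLeft k (S Z η₀ γ₀)).PosDef := by
  have hn := h.four_le
  refine Matrix.PosDef.of_dotProduct_mulVec_pos (isHermitian_upperLeft_S hk) fun x hx => ?_
  rw [star_trivial, dotProduct_upperLeft_S_mulVec (last := ⟨n - 1, by omega⟩) rfl hk]
  exact h.alphaVar_pos _ (zeroExtend_ne_zero hk hx)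

lemma abs_le_of_alphaVar_eq (h : VarianceBound Z η₀ γ₀ B) {x : Fin n → ℝ} {N : ℝ} (hN : 0 ≤ N)
    (hx : alphaVar Z η₀ γ₀ last x = N ^ 2) (i : Fin n) : |x i| ≤ N * √n := by
  refine abs_le_of_sq_le_sq ?_ (by positivity)
  calc x i ^ 2 ≤ N ^ 2 * uRow Z η₀ γ₀ i :=
        (div_le_iff₀ (h.uRow_pos i)).1 (hx ▸ h.sq_div_uRow_le_alphaVar last x i)
    _ ≤ N ^ 2 * n := by
        gcongr
        linarith [uRow_le (Z := Z) (η₀ := η₀) (γ₀ := γ₀) i, h.n_pos]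
    _ = (N * √n) ^ 2 := by rw [mul_pow, Real.sq_sqrt h.n_pos.le]

lemma sum_abs_zeroExtend_le (h : VarianceBound Z η₀ γ₀ B) (hk : k ≤ n) {x : Fin k → ℝ} {N : ℝ}
    (hN : 0 ≤ N) (hx : alphaVar Z η₀ γ₀ last (zeroExtend hk x) = N ^ 2) :
    ∑ i, |zeroExtend hk x i| ≤ k * N * √n := by
  calc ∑ i, |zeroExtend hk x i| = ∑ a, |x a| :=
        sum_zeroExtend hk x (F := fun _ t => |t|) fun _ => abs_zero
    _ ≤ ∑ _ : Fin k, N * √n := Finset.sum_le_sum fun a _ =>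
        zeroExtend_castLE hk x a ▸ h.abs_le_of_alphaVar_eq hN hx (Fin.castLE hk a)
    _ = k * N * √n := by
        rw [Finset.sum_const, Finset.card_univ, Fintype.card_fin, nsmul_eq_mul, mul_assoc]

end VarianceBound

/-- The weights of the linear approximation to `∑ i, x i * (α̂_i - α_i)`. -/
noncomputable def alphaWeight (Z : Fin n → Fin n → Fin p → ℝ) (η₀ : Idx n → ℝ) (γ₀ : Fin p → ℝ)
    (last : Fin n) (x : Fin n → ℝ) (i j : Fin n) : ℝ :=
  x i / uRow Z η₀ γ₀ i + if last = j then (∑ i, x i) / uCol Z η₀ γ₀ last else 0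

lemma linStat_alphaWeight (x : Fin n → ℝ) (a : Adj n) :
    linStat Z η₀ γ₀ (alphaWeight Z η₀ γ₀ last x) a
      = ∑ i, x i * (rowEffect Z η₀ γ₀ (resid Z a η₀ γ₀) i
        + colEffect Z η₀ γ₀ (resid Z a η₀ γ₀) last) := by
  simp only [linStat, alphaWeight, rowEffect, colEffect, add_mul, Finset.sum_add_distrib,
    ← Finset.mul_sum, ite_mul, zero_mul, Finset.sum_ite_eq, Finset.mem_univ, if_true, mul_add,
    ← Finset.sum_mul]
  congr 1
  · exact Finset.sum_congr rfl fun a _ => by ring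
  · ring

namespace VarianceBound

lemma sum_row_alphaWeight_sq_mul_u (h : VarianceBound Z η₀ γ₀ B) (x : Fin n → ℝ) (i : Fin n) :
    ∑ j, alphaWeight Z η₀ γ₀ last x i j ^ 2 * u Z η₀ γ₀ i j
      = x i ^ 2 / uRow Z η₀ γ₀ i
        + 2 * (x i * ((∑ i, x i)
          * (u Z η₀ γ₀ i last / (uRow Z η₀ γ₀ i * uCol Z η₀ γ₀ last))))
        + ((∑ i, x i) / uCol Z η₀ γ₀ last) ^ 2 * u Z η₀ γ₀ i last := by
  have hrow := (h.uRow_pos i).ne'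
  have hcol := (h.uCol_pos last).ne'
  set c := x i / uRow Z η₀ γ₀ i with hc
  set s := (∑ i, x i) / uCol Z η₀ γ₀ last with hs
  have expand_sq (j : Fin n) : alphaWeight Z η₀ γ₀ last x i j ^ 2 * u Z η₀ γ₀ i j
      = c ^ 2 * u Z η₀ γ₀ i j + if last = j then (2 * c * s + s ^ 2) * u Z η₀ γ₀ i j else 0 := by
    rw [alphaWeight, ← hc, ← hs]
    split_ifs <;> ring
  rw [Finset.sum_congr rfl fun j _ => expand_sq j, Finset.sum_add_distrib, ← Finset.mul_sum,
    Finset.sum_ite_eq, if_pos (Finset.mem_univ _), ← uRow, hc, hs]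
  field_simp
  ring

lemma linVar_alphaWeight (h : VarianceBound Z η₀ γ₀ B) (x : Fin n → ℝ) :
    linVar Z η₀ γ₀ (alphaWeight Z η₀ γ₀ last x)
      = alphaVar Z η₀ γ₀ last x + 2 * ∑ i, x i * ((∑ i, x i)
        * (u Z η₀ γ₀ i last / (uRow Z η₀ γ₀ i * uCol Z η₀ γ₀ last))) := by
  have hcol := (h.uCol_pos last).ne'
  have sum_last : ∑ i, ((∑ i, x i) / uCol Z η₀ γ₀ last) ^ 2 * u Z η₀ γ₀ i last
      = (∑ i, x i) ^ 2 / uCol Z η₀ γ₀ last := by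
    rw [← Finset.mul_sum, ← uCol]
    field_simp
  rw [linVar, Finset.sum_congr rfl fun i _ => h.sum_row_alphaWeight_sq_mul_u x i,
    Finset.sum_add_distrib, Finset.sum_add_distrib, sum_last, ← Finset.mul_sum, alphaVar]
  ring

lemma abs_u_div_mul_le (h : VarianceBound Z η₀ γ₀ B) (i j : Fin n) :
    |u Z η₀ γ₀ i j / (uRow Z η₀ γ₀ i * uCol Z η₀ γ₀ j)| ≤ (B / n) ^ 2 := by
  have hB := h.B_pos
  have hn := h.n_pos
  have hcol := h.uCol_pos j
  rw [← div_div, abs_div, abs_of_pos hcol, div_le_iff₀ hcol]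
  calc |u Z η₀ γ₀ i j / uRow Z η₀ γ₀ i| ≤ B / (2 * n) := h.abs_u_div_le (h.uRow_ge i) i j
    _ = (B / n) ^ 2 * (n / (2 * B)) := by field_simp
    _ ≤ (B / n) ^ 2 * uCol Z η₀ γ₀ j := by gcongr; exact h.uCol_ge j

lemma abs_linVar_alphaWeight_sub_le (h : VarianceBound Z η₀ γ₀ B) {x : Fin n → ℝ} {T : ℝ}
    (hT : ∑ i, |x i| ≤ T) :
    |linVar Z η₀ γ₀ (alphaWeight Z η₀ γ₀ last x) - alphaVar Z η₀ γ₀ last x|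
      ≤ 2 * (T * (B / n)) ^ 2 := by
  have abs_sum_le : |∑ i, x i| ≤ T := (Finset.abs_sum_le_sum_abs _ _).trans hT
  have T_nonneg : 0 ≤ T := (abs_nonneg _).trans abs_sum_le
  rw [h.linVar_alphaWeight, add_sub_cancel_left, abs_mul, abs_two]
  gcongr
  calc |∑ i, x i * ((∑ i, x i) * (u Z η₀ γ₀ i last / (uRow Z η₀ γ₀ i * uCol Z η₀ γ₀ last)))|
      ≤ ∑ i, |x i| * (T * (B / n) ^ 2) := by
        refine (Finset.abs_sum_le_sum_abs _ _).trans (Finset.sum_le_sum fun i _ => ?_)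
        rw [abs_mul, abs_mul]
        gcongr
        exact h.abs_u_div_mul_le i last
    _ = (∑ i, |x i|) * (T * (B / n) ^ 2) := (Finset.sum_mul ..).symm
    _ ≤ T * (T * (B / n) ^ 2) := by gcongr
    _ = (T * (B / n)) ^ 2 := by ring

lemma abs_div_le (h : VarianceBound Z η₀ γ₀ B) {y T U : ℝ} (hy : |y| ≤ T)
    (hU : n / (2 * B) ≤ U) : |y / U| ≤ 2 * (T * (B / n)) := by
  have hB := h.B_pos
  have hn := h.n_pos
  rw [abs_div, abs_of_pos (h.half_div_pos.trans_le hU)]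
  calc |y| / U ≤ T / (n / (2 * B)) := div_le_div₀ ((abs_nonneg y).trans hy) hy h.half_div_pos hU
    _ = 2 * (T * (B / n)) := by field_simp

lemma abs_alphaWeight_le (h : VarianceBound Z η₀ γ₀ B) {x : Fin n → ℝ} {T : ℝ}
    (hT : ∑ i, |x i| ≤ T) (i j : Fin n) :
    |alphaWeight Z η₀ γ₀ last x i j| ≤ 4 * (T * (B / n)) := by
  have abs_coord_le : |x i| ≤ T :=
    (Finset.single_le_sum (f := fun i => |x i|) (fun i _ => abs_nonneg _)
      (Finset.mem_univ i)).trans hT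
  have row_le := h.abs_div_le abs_coord_le (h.uRow_ge i)
  have col_le : |if last = j then (∑ i, x i) / uCol Z η₀ γ₀ last else 0| ≤ 2 * (T * (B / n)) := by
    split_ifs
    · exact h.abs_div_le ((Finset.abs_sum_le_sum_abs _ _).trans hT) (h.uCol_ge _)
    · rw [abs_zero]
      exact (abs_nonneg _).trans row_le
  rw [alphaWeight]
  linarith [abs_add_le (x i / uRow Z η₀ γ₀ i)
    (if last = j then (∑ i, x i) / uCol Z η₀ γ₀ last else 0)]

end VarianceBound

end Covariance

/-! ### Comparison of characteristic functions -/

lemma norm_exp_mul_I_sub_exp_mul_I_le (x y : ℝ) :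
    ‖Complex.exp (x * Complex.I) - Complex.exp (y * Complex.I)‖ ≤ |x - y| := by
  have factor : Complex.exp (x * Complex.I) - Complex.exp (y * Complex.I)
      = Complex.exp (y * Complex.I) * (Complex.exp (Complex.I * ((x - y : ℝ) : ℂ)) - 1) := by
    rw [mul_sub, ← Complex.exp_add, mul_one]
    congr 2
    push_cast
    ring
  rw [factor, norm_mul, Complex.norm_exp_ofReal_mul_I, one_mul]
  exact Real.norm_exp_I_mul_ofReal_sub_one_le

lemma norm_exp_mul_I_sub_exp_mul_I_le_two (x y : ℝ) :
    ‖Complex.exp (x * Complex.I) - Complex.exp (y * Complex.I)‖ ≤ 2 := by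
  calc _ ≤ ‖Complex.exp (x * Complex.I)‖ + ‖Complex.exp (y * Complex.I)‖ := norm_sub_le _ _
    _ = 2 := by rw [Complex.norm_exp_ofReal_mul_I, Complex.norm_exp_ofReal_mul_I]; norm_num

lemma norm_integral_exp_mul_I_sub_le {Ω : Type*} [MeasurableSpace Ω] {P : Measure Ω}
    [IsProbabilityMeasure P] {X Y : Ω → ℝ} (hX : Measurable X) (hY : Measurable Y) {s : Set Ω}
    (hs : MeasurableSet s) {D : ℝ} (hD : 0 ≤ D) (h : ∀ ω ∉ s, |X ω - Y ω| ≤ D) :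
    ‖∫ ω, Complex.exp (X ω * Complex.I) ∂P - ∫ ω, Complex.exp (Y ω * Complex.I) ∂P‖
      ≤ D + 2 * P.real s := by
  have integrable_exp {X : Ω → ℝ} (hX : Measurable X) :
      Integrable (fun ω => Complex.exp (X ω * Complex.I)) P :=
    Integrable.of_bound (by fun_prop) 1
      (ae_of_all _ fun ω => (Complex.norm_exp_ofReal_mul_I _).le)
  have integrable_indicator : Integrable (s.indicator fun _ => (2 : ℝ)) P :=
    (integrable_const _).indicator hs
  have norm_sub_le (ω : Ω) : ‖Complex.exp (X ω * Complex.I) - Complex.exp (Y ω * Complex.I)‖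
      ≤ D + s.indicator (fun _ => (2 : ℝ)) ω := by
    by_cases hω : ω ∈ s
    · rw [Set.indicator_of_mem hω]
      linarith [norm_exp_mul_I_sub_exp_mul_I_le_two (X ω) (Y ω)]
    · rw [Set.indicator_of_notMem hω, add_zero]
      exact (norm_exp_mul_I_sub_exp_mul_I_le _ _).trans (h ω hω)
  rw [← integral_sub (integrable_exp hX) (integrable_exp hY)]
  calc _ ≤ ∫ ω, ‖Complex.exp (X ω * Complex.I) - Complex.exp (Y ω * Complex.I)‖ ∂P :=
        norm_integral_le_integral_norm _
    _ ≤ ∫ ω, (D + s.indicator (fun _ => (2 : ℝ)) ω) ∂P :=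
        integral_mono ((integrable_exp hX).sub (integrable_exp hY)).norm
          ((integrable_const _).add integrable_indicator) norm_sub_le
    _ = D + 2 * P.real s := by
        rw [integral_add (integrable_const _) integrable_indicator, integral_indicator_const _ hs]
        simp [mul_comm]

lemma norm_exp_neg_sub_exp_neg_le {x y : ℝ} (hx : 0 ≤ x) (hy : 0 ≤ y) :
    ‖Complex.exp ((-x : ℝ) : ℂ) - Complex.exp ((-y : ℝ) : ℂ)‖ ≤ |x - y| := by
  rw [← Complex.ofReal_exp, ← Complex.ofReal_exp, ← Complex.ofReal_sub, Complex.norm_real,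
    Real.norm_eq_abs]
  wlog hxy : x ≤ y generalizing x y
  · rw [abs_sub_comm, abs_sub_comm x]
    exact this hy hx (le_of_not_ge hxy)
  have exp_le_exp : Real.exp (-y) ≤ Real.exp (-x) := Real.exp_le_exp.2 (by linarith)
  rw [abs_of_nonneg (by linarith), abs_of_nonpos (by linarith)]
  calc Real.exp (-x) - Real.exp (-y) = Real.exp (-x) * (1 - Real.exp (-(y - x))) := by
        rw [mul_sub, ← Real.exp_add, mul_one]; ring_nf
    _ ≤ 1 * (y - x) :=
        mul_le_mul (Real.exp_le_one_iff.2 (by linarith))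
          (by linarith [Real.one_sub_le_exp_neg (y - x)])
          (sub_nonneg.2 (Real.exp_le_one_iff.2 (by linarith))) zero_le_one
    _ = -(x - y) := by ring

/-! ### The standardized estimation error -/

section StdError

variable {n p k : ℕ} {Ω : Type*} [MeasurableSpace Ω] {P : Measure Ω} {A : Ω → Adj n}
  {Z : Fin n → Fin n → Fin p → ℝ} {η₀ : Idx n → ℝ} {γ₀ : Fin p → ℝ} {B M κ : ℝ} {last : Fin n}

/-- The standardized error `S_k^{-1/2} (η_1 - η₀_1, …, η_k - η₀_k)` of an estimate `η` of `η₀`. -/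
noncomputable def stdError (k : ℕ) (Z : Fin n → Fin n → Fin p → ℝ) (η₀ : Idx n → ℝ)
    (γ₀ : Fin p → ℝ) (η : Idx n → ℝ) : EuclideanSpace ℝ (Fin k) :=
  WithLp.toLp 2 ((CFC.sqrt (upperLeft k (S Z η₀ γ₀)))⁻¹ *ᵥ firstCoords k (η - η₀))

/-- The coefficients, as functions of the outgoingness errors, of the coordinate of the
standardized error in the direction `t`. -/
noncomputable def stdDirection (Z : Fin n → Fin n → Fin p → ℝ) (η₀ : Idx n → ℝ) (γ₀ : Fin p → ℝ)
    (hk : k ≤ n) (t : EuclideanSpace ℝ (Fin k)) : Fin n → ℝ :=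
  zeroExtend hk ((CFC.sqrt (upperLeft k (S Z η₀ γ₀)))⁻¹ *ᵥ t.ofLp)

lemma inner_stdError (hk : k ≤ n) (η : Idx n → ℝ) (t : EuclideanSpace ℝ (Fin k)) :
    inner ℝ (stdError k Z η₀ γ₀ η) t
      = ∑ i, stdDirection Z η₀ γ₀ hk t i * (η (Sum.inl i) - η₀ (Sum.inl i)) := by
  rw [EuclideanSpace.inner_eq_star_dotProduct, star_trivial, stdError,
    dotProduct_inv_sqrt_mulVec, stdDirection, sum_zeroExtend hk _
      (F := fun i x => x * (η (Sum.inl i) - η₀ (Sum.inl i))) fun i => zero_mul _]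
  simp only [dotProduct, firstCoords, dif_pos hk, Pi.sub_apply]

namespace VarianceBound

lemma alphaVar_stdDirection (h : VarianceBound Z η₀ γ₀ B) (hlast : (last : ℕ) = n - 1)
    (hk : k ≤ n) (t : EuclideanSpace ℝ (Fin k)) :
    alphaVar Z η₀ γ₀ last (stdDirection Z η₀ γ₀ hk t) = ‖t‖ ^ 2 := by
  rw [stdDirection, ← dotProduct_upperLeft_S_mulVec hlast hk,
    inv_sqrt_mulVec_dotProduct_mulVec (h.posDef_upperLeft_S hk), ← real_inner_self_eq_norm_sq,
    EuclideanSpace.inner_eq_star_dotProduct, star_trivial]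

lemma sum_abs_stdDirection_le (h : VarianceBound Z η₀ γ₀ B) (hk : k ≤ n)
    (t : EuclideanSpace ℝ (Fin k)) :
    ∑ i, |stdDirection Z η₀ γ₀ hk t i| ≤ k * ‖t‖ * √n := by
  have hn := h.four_le
  exact h.sum_abs_zeroExtend_le hk (norm_nonneg t)
    (h.alphaVar_stdDirection (last := ⟨n - 1, by omega⟩) rfl hk t)

lemma abs_inner_stdError_sub_linStat_le (h : VarianceBound Z η₀ γ₀ B) (hk : k ≤ n) {e : ℝ}
    {a : Adj n} (ha : MLEExpansion Z η₀ γ₀ last e a) {η : Idx n → ℝ} {γ : Fin p → ℝ}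
    (hMLE : IsMLE Z a η γ) (t : EuclideanSpace ℝ (Fin k)) :
    |inner ℝ (stdError k Z η₀ γ₀ η) t
        - linStat Z η₀ γ₀ (alphaWeight Z η₀ γ₀ last (stdDirection Z η₀ γ₀ hk t)) a|
      ≤ k * ‖t‖ * (√n * e) := by
  have expansion := ha.2 η γ hMLE
  have e_nonneg : 0 ≤ e := (abs_nonneg _).trans (expansion last)
  rw [inner_stdError hk, linStat_alphaWeight, ← Finset.sum_sub_distrib]
  calc _ ≤ ∑ i, |stdDirection Z η₀ γ₀ hk t i| * e := by
        refine (Finset.abs_sum_le_sum_abs _ _).trans (Finset.sum_le_sum fun i _ => ?_)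
        rw [← mul_sub, abs_mul]
        exact mul_le_mul_of_nonneg_left (expansion i) (abs_nonneg _)
    _ = (∑ i, |stdDirection Z η₀ γ₀ hk t i|) * e := (Finset.sum_mul ..).symm
    _ ≤ k * ‖t‖ * √n * e := mul_le_mul_of_nonneg_right (h.sum_abs_stdDirection_le hk t) e_nonneg
    _ = k * ‖t‖ * (√n * e) := by ring

lemma norm_integral_exp_linStat_stdDirection_sub_le [IsProbabilityMeasure P]
    (h : VarianceBound Z η₀ γ₀ B) (hA : IsModel P A Z η₀ γ₀) (hlast : (last : ℕ) = n - 1)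
    (hk : k ≤ n) (t : EuclideanSpace ℝ (Fin k)) {q : ℝ} (hq : k * ‖t‖ * (B / √n) = q)
    (hq_le : 4 * q ≤ 1) :
    ‖∫ ω, Complex.exp (linStat Z η₀ γ₀
            (alphaWeight Z η₀ γ₀ last (stdDirection Z η₀ γ₀ hk t)) (A ω) * Complex.I) ∂P
        - Complex.exp (-‖t‖ ^ 2 / 2)‖
      ≤ 8 * q * (‖t‖ ^ 2 + 2 * q ^ 2) + q ^ 2 := by
  set c := alphaWeight Z η₀ γ₀ last (stdDirection Z η₀ γ₀ hk t)
  have hB := h.B_pos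
  have q_nonneg : 0 ≤ q := by rw [← hq]; positivity
  have scale : k * ‖t‖ * √n * (B / n) = q := by
    rw [← hq, mul_assoc, mul_div_left_comm, Real.sqrt_div_self']
    ring
  have sum_abs_le := h.sum_abs_stdDirection_le hk t
  have abs_c_le (i j : Fin n) : |c i j| ≤ 4 * q :=
    scale ▸ h.abs_alphaWeight_le sum_abs_le i j
  have abs_var_sub_le : |linVar Z η₀ γ₀ c - ‖t‖ ^ 2| ≤ 2 * q ^ 2 := by
    rw [← scale, ← h.alphaVar_stdDirection hlast hk t]
    exact h.abs_linVar_alphaWeight_sub_le sum_abs_le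
  have var_nonneg : 0 ≤ linVar Z η₀ γ₀ c := Finset.sum_nonneg fun i _ =>
    Finset.sum_nonneg fun j _ => mul_nonneg (sq_nonneg _) (u_nonneg i j)
  have clt := hA.norm_integral_exp_linStat_sub_le (fun i j _ => abs_c_le i j) hq_le
  have gaussian_sub_le : ‖Complex.exp ((-linVar Z η₀ γ₀ c / 2 : ℝ) : ℂ)
      - Complex.exp (-‖t‖ ^ 2 / 2)‖ ≤ q ^ 2 := by
    have exp_sub_le := norm_exp_neg_sub_exp_neg_le (x := linVar Z η₀ γ₀ c / 2)
      (y := ‖t‖ ^ 2 / 2) (by positivity) (by positivity)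
    rw [← sub_div, abs_div, abs_two, ← neg_div, ← neg_div] at exp_sub_le
    push_cast at exp_sub_le ⊢
    linarith
  calc _ ≤ 2 * (4 * q) * linVar Z η₀ γ₀ c + q ^ 2 :=
        (norm_sub_le_norm_sub_add_norm_sub _ _ _).trans (add_le_add clt gaussian_sub_le)
    _ ≤ 2 * (4 * q) * (‖t‖ ^ 2 + 2 * q ^ 2) + q ^ 2 := by
        gcongr
        linarith [le_abs_self (linVar Z η₀ γ₀ c - ‖t‖ ^ 2)]
    _ = 8 * q * (‖t‖ ^ 2 + 2 * q ^ 2) + q ^ 2 := by ring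

end VarianceBound

lemma IsModel.measurable_comp (hA : IsModel P A Z η₀ γ₀) {E : Type*} [MeasurableSpace E]
    (f : Adj n → E) : Measurable fun ω => f (A ω) :=
  (Measurable.of_discrete (f := f)).comp hA.measurable

lemma IsModel.measurableSet_setOf (hA : IsModel P A Z η₀ γ₀) (s : Adj n → Prop) :
    MeasurableSet {ω | s (A ω)} :=
  hA.measurable (MeasurableSet.of_discrete (s := {a | s a}))

lemma IsModel.charFun_map_stdError (hA : IsModel P A Z η₀ γ₀) (ηhat : Adj n → Idx n → ℝ)
    (t : EuclideanSpace ℝ (Fin k)) :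
    charFun (P.map fun ω => stdError k Z η₀ γ₀ (ηhat (A ω))) t
      = ∫ ω, Complex.exp (inner ℝ (stdError k Z η₀ γ₀ (ηhat (A ω))) t * Complex.I) ∂P := by
  rw [charFun_apply, integral_map
    (hA.measurable_comp fun a => stdError k Z η₀ γ₀ (ηhat a)).aemeasurable (by fun_prop)]

lemma Regular.newtonRadius_nonneg (h : Regular Z η₀ γ₀ B M κ) : 0 ≤ newtonRadius n p B M κ := by
  have hB := h.B_pos
  have hΛ := h.fisherInvBound_nonneg
  unfold newtonRadius effectBound meanEffectBound
  positivity

lemma Regular.expansionError_nonneg (h : Regular Z η₀ γ₀ B M κ) :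
    0 ≤ expansionError n p B M κ := by
  have hΛ := h.fisherInvBound_nonneg
  have hr := h.newtonRadius_nonneg
  have hlip := h.newtonLip_nonneg hr
  unfold expansionError meanEffectBound
  positivity

theorem Regular.norm_charFun_stdError_sub_le [IsProbabilityMeasure P]
    (h : Regular Z η₀ γ₀ B M κ) (hA : IsModel P A Z η₀ γ₀) (hk : k ≤ n)
    (hr : (2 + p * M) * newtonRadius n p B M κ ≤ 1)
    (hlip : newtonLip p B M κ (newtonRadius n p B M κ) ≤ 1 / 2)
    {ηhat : Adj n → Idx n → ℝ} {γhat : Adj n → Fin p → ℝ}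
    (hMLE : ∀ a, (∃ η γ, IsMLE Z a η γ) → IsMLE Z a (ηhat a) (γhat a))
    (t : EuclideanSpace ℝ (Fin k)) {q : ℝ} (hq : k * ‖t‖ * (B / √n) = q) (hq_le : 4 * q ≤ 1) :
    ‖charFun (P.map fun ω => stdError k Z η₀ γ₀ (ηhat (A ω))) t - Complex.exp (-‖t‖ ^ 2 / 2)‖
      ≤ k * ‖t‖ * (√n * expansionError n p B M κ)
        + 2 * ((4 * n + p) * (2 * Real.exp (-2 * Real.log n)))
        + (8 * q * (‖t‖ ^ 2 + 2 * q ^ 2) + q ^ 2) := by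
  have hn := h.four_le
  let last : Fin n := ⟨n - 1, by omega⟩
  set e := expansionError n p B M κ
  let X (ω : Ω) : ℝ := inner ℝ (stdError k Z η₀ γ₀ (ηhat (A ω))) t
  let Y (ω : Ω) : ℝ := linStat Z η₀ γ₀
    (alphaWeight Z η₀ γ₀ last (stdDirection Z η₀ γ₀ hk t)) (A ω)
  let bad : Set Ω := {ω | ¬ MLEExpansion Z η₀ γ₀ last e (A ω)}
  have close (ω : Ω) (hω : ω ∉ bad) : |X ω - Y ω| ≤ k * ‖t‖ * (√n * e) :=
    have expansion : MLEExpansion Z η₀ γ₀ last e (A ω) := not_not.1 hω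
    h.abs_inner_stdError_sub_linStat_le hk expansion (hMLE _ expansion.1) t
  have linearization : ‖∫ ω, Complex.exp (X ω * Complex.I) ∂P
      - ∫ ω, Complex.exp (Y ω * Complex.I) ∂P‖ ≤ k * ‖t‖ * (√n * e) + 2 * P.real bad :=
    norm_integral_exp_mul_I_sub_le
      (hA.measurable_comp fun a => inner ℝ (stdError k Z η₀ γ₀ (ηhat a)) t)
      (hA.measurable_comp (linStat Z η₀ γ₀ _))
      (hA.measurableSet_setOf fun a => ¬ MLEExpansion Z η₀ γ₀ last e a)
      (by have := h.expansionError_nonneg; positivity) close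
  have bad_le : P.real bad ≤ (4 * n + p) * (2 * Real.exp (-2 * Real.log n)) :=
    h.measureReal_not_mleExpansion_le hA rfl hr hlip
  have clt := h.norm_integral_exp_linStat_stdDirection_sub_le hA (last := last) rfl hk t hq hq_le
  rw [hA.charFun_map_stdError]
  refine (norm_sub_le_norm_sub_add_norm_sub _ (∫ ω, Complex.exp (Y ω * Complex.I) ∂P) _).trans ?_
  linarith

end StdError

/-! ### Asymptotics -/

/-- The rate `κ B⁴ log n / √n` which controls all error terms. -/
noncomputable def rate (n : ℕ) (B κ : ℝ) : ℝ := κ * B ^ 4 * Real.log n / √n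

section Rate

variable {n p : ℕ} {Z : Fin n → Fin n → Fin p → ℝ} {η₀ : Idx n → ℝ} {γ₀ : Fin p → ℝ} {B M κ : ℝ}

lemma VarianceBound.one_le_log (h : VarianceBound Z η₀ γ₀ B) : 1 ≤ Real.log n := by
  have exp_one_le : Real.exp 1 ≤ n := by
    have : (4 : ℝ) ≤ n := by exact_mod_cast h.four_le
    linarith [Real.exp_one_lt_three]
  exact (Real.le_log_iff_exp_le h.n_pos).2 exp_one_le

lemma meanEffectBound_eq (n : ℕ) (B : ℝ) :
    meanEffectBound n B = B * √(Real.log n) / √n * (B / √n) := by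
  rw [div_mul_div_comm, Real.mul_self_sqrt n.cast_nonneg, meanEffectBound]
  ring

namespace Regular

lemma kappa_mul_pow_three_div_sqrt_le_rate (h : Regular Z η₀ γ₀ B M κ) :
    κ * B ^ 3 / √n ≤ rate n B κ := by
  have hκ := h.kappa_pos
  have hB := h.four_le_B
  have one_le : 1 ≤ B * Real.log n := one_le_mul_of_one_le_of_one_le (by linarith) h.one_le_log
  calc κ * B ^ 3 / √n ≤ κ * B ^ 3 / √n * (B * Real.log n) :=
        le_mul_of_one_le_right (by positivity) one_le
    _ = rate n B κ := by rw [rate]; ring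

lemma div_sqrt_le_rate (h : Regular Z η₀ γ₀ B M κ) : B / √n ≤ 2 * p * M ^ 2 * rate n B κ := by
  have hκ := h.kappa_pos
  have hB := h.four_le_B
  calc B / √n ≤ B / √n * (κ * (2 * p * M ^ 2 * B)) :=
        le_mul_of_one_le_right (by positivity) h.one_le_kappa_mul
    _ = 2 * p * M ^ 2 * (κ * B ^ 2 / √n) := by ring
    _ ≤ 2 * p * M ^ 2 * (κ * B ^ 3 / √n) := by gcongr <;> linarith
    _ ≤ 2 * p * M ^ 2 * rate n B κ := by gcongr; exact h.kappa_mul_pow_three_div_sqrt_le_rate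

lemma newtonRadius_le (h : Regular Z η₀ γ₀ B M κ) (hrate : rate n B κ ≤ 1) :
    newtonRadius n p B M κ ≤ 26 * p * M ^ 2 * (B * √(Real.log n) / √n) := by
  have hB := h.B_pos
  have one_le : 1 ≤ p * M ^ 2 := one_le_mul_of_one_le_of_one_le
    (by exact_mod_cast h.one_le_p) (one_le_pow₀ h.one_le_M)
  calc newtonRadius n p B M κ
      = (8 + 18 * p * M ^ 2 * (κ * B ^ 3 / √n)) * (B * √(Real.log n) / √n) := by
        rw [newtonRadius, effectBound, meanEffectBound_eq, fisherInvBound]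
        ring
    _ ≤ (8 + 18 * p * M ^ 2 * 1) * (B * √(Real.log n) / √n) := by
        gcongr
        exact h.kappa_mul_pow_three_div_sqrt_le_rate.trans hrate
    _ ≤ 26 * p * M ^ 2 * (B * √(Real.log n) / √n) := by gcongr; linarith

lemma kappa_mul_sq_mul_newtonRadius_le (h : Regular Z η₀ γ₀ B M κ) (hrate : rate n B κ ≤ 1) :
    κ * B ^ 2 * newtonRadius n p B M κ ≤ 26 * p * M ^ 2 * rate n B κ := by
  have hκ := h.kappa_pos
  have hB := h.four_le_B
  have hlog := h.one_le_log
  have one_le : 1 ≤ B * √(Real.log n) :=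
    one_le_mul_of_one_le_of_one_le (by linarith) (Real.one_le_sqrt.2 hlog)
  calc κ * B ^ 2 * newtonRadius n p B M κ
      ≤ κ * B ^ 2 * (26 * p * M ^ 2 * (B * √(Real.log n) / √n)) := by
        gcongr
        exact h.newtonRadius_le hrate
    _ ≤ κ * B ^ 2 * (26 * p * M ^ 2 * (B * √(Real.log n) / √n)) * (B * √(Real.log n)) :=
        le_mul_of_one_le_right (by positivity) one_le
    _ = 26 * p * M ^ 2 * (κ * B ^ 4 * √(Real.log n) ^ 2 / √n) := by ring
    _ = 26 * p * M ^ 2 * rate n B κ := by rw [Real.sq_sqrt (by linarith), rate]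

lemma newtonRadius_le_rate (h : Regular Z η₀ γ₀ B M κ) (hrate : rate n B κ ≤ 1) :
    newtonRadius n p B M κ ≤ 2 * p * M ^ 2 * (26 * p * M ^ 2) * rate n B κ := by
  have hκ := h.kappa_pos
  have hB := h.four_le_B
  have hr := h.newtonRadius_nonneg
  calc newtonRadius n p B M κ
      ≤ newtonRadius n p B M κ * (κ * (2 * p * M ^ 2 * B)) :=
        le_mul_of_one_le_right hr h.one_le_kappa_mul
    _ = 2 * p * M ^ 2 * (κ * B ^ 1 * newtonRadius n p B M κ) := by ring
    _ ≤ 2 * p * M ^ 2 * (κ * B ^ 2 * newtonRadius n p B M κ) := by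
        gcongr <;> linarith
    _ ≤ 2 * p * M ^ 2 * (26 * p * M ^ 2 * rate n B κ) :=
        mul_le_mul_of_nonneg_left (h.kappa_mul_sq_mul_newtonRadius_le hrate) (by positivity)
    _ = 2 * p * M ^ 2 * (26 * p * M ^ 2) * rate n B κ := by ring

lemma newtonLip_newtonRadius_le (h : Regular Z η₀ γ₀ B M κ) (hrate : rate n B κ ≤ 1) :
    newtonLip p B M κ (newtonRadius n p B M κ)
      ≤ 18 * p * M ^ 2 * (2 + p * M) ^ 2 * (26 * p * M ^ 2) * rate n B κ := by
  calc newtonLip p B M κ (newtonRadius n p B M κ)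
      = 18 * p * M ^ 2 * (2 + p * M) ^ 2 * (κ * B ^ 2 * newtonRadius n p B M κ) := by
        rw [newtonLip, fisherInvBound]; ring
    _ ≤ 18 * p * M ^ 2 * (2 + p * M) ^ 2 * (26 * p * M ^ 2 * rate n B κ) :=
        mul_le_mul_of_nonneg_left (h.kappa_mul_sq_mul_newtonRadius_le hrate) (by positivity)
    _ = _ := by ring

lemma sqrt_mul_fisherInvBound_mul_meanEffectBound_le (h : Regular Z η₀ γ₀ B M κ) :
    √n * (fisherInvBound p B M κ * meanEffectBound n B) ≤ 9 * p * M ^ 2 * rate n B κ := by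
  have hκ := h.kappa_pos
  have hB := h.B_pos
  have hn := h.n_pos
  have hlog := h.one_le_log
  have sqrt_log_le : √(Real.log n) ≤ Real.log n := by
    rw [Real.sqrt_le_left (by linarith)]
    exact le_self_pow₀ hlog two_ne_zero
  calc √n * (fisherInvBound p B M κ * meanEffectBound n B)
      = 9 * p * M ^ 2 * (κ * B ^ 4 * √(Real.log n) / √n) := by
        rw [meanEffectBound_eq, fisherInvBound]
        field_simp
    _ ≤ 9 * p * M ^ 2 * rate n B κ := by rw [rate]; gcongr

lemma sqrt_mul_newtonLip_mul_newtonRadius_le (h : Regular Z η₀ γ₀ B M κ) (hrate : rate n B κ ≤ 1) :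
    √n * (newtonLip p B M κ (newtonRadius n p B M κ) * newtonRadius n p B M κ)
      ≤ 18 * p * M ^ 2 * (2 + p * M) ^ 2 * (26 * p * M ^ 2) ^ 2 * rate n B κ := by
  have hκ := h.kappa_pos
  have hn := h.n_pos
  have hr := h.newtonRadius_nonneg
  have hlog := h.one_le_log
  calc √n * (newtonLip p B M κ (newtonRadius n p B M κ) * newtonRadius n p B M κ)
      = 18 * p * M ^ 2 * (2 + p * M) ^ 2 * (√n * (κ * B ^ 2) * newtonRadius n p B M κ ^ 2) := by
        rw [newtonLip, fisherInvBound]; ring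
    _ ≤ 18 * p * M ^ 2 * (2 + p * M) ^ 2
          * (√n * (κ * B ^ 2) * (26 * p * M ^ 2 * (B * √(Real.log n) / √n)) ^ 2) := by
        gcongr
        exact h.newtonRadius_le hrate
    _ = 18 * p * M ^ 2 * (2 + p * M) ^ 2 * (26 * p * M ^ 2) ^ 2
          * (κ * B ^ 4 * √(Real.log n) ^ 2 / √n) := by field_simp
    _ = _ := by rw [Real.sq_sqrt (by linarith), rate]

lemma sqrt_mul_expansionError_le (h : Regular Z η₀ γ₀ B M κ) (hrate : rate n B κ ≤ 1) :
    √n * expansionError n p B M κ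
      ≤ (9 * p * M ^ 2 + 18 * p * M ^ 2 * (2 + p * M) ^ 2 * (26 * p * M ^ 2) ^ 2)
        * rate n B κ := by
  rw [expansionError, mul_add, add_mul]
  exact add_le_add h.sqrt_mul_fisherInvBound_mul_meanEffectBound_le
    (h.sqrt_mul_newtonLip_mul_newtonRadius_le hrate)

end Regular

end Rate

section Limits

variable {p : ℕ} {Z : ∀ n : ℕ, Fin n → Fin n → Fin p → ℝ} {η₀ : ∀ n : ℕ, Idx n → ℝ}
  {γ₀ : ℕ → Fin p → ℝ} {M : ℝ} {b κ : ℕ → ℝ}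

lemma eventually_one_le_of_inv_muDeriv_le
    (hb : ∀ᶠ n in atTop, ∀ i j, i ≠ j → (muDeriv (linPred (Z n) (η₀ n) (γ₀ n) i j))⁻¹ ≤ b n) :
    ∀ᶠ n in atTop, 1 ≤ b n := by
  filter_upwards [hb, eventually_ge_atTop 2] with n hbn hn
  refine le_trans ?_ (hbn ⟨0, by omega⟩ ⟨1, by omega⟩ (by simp))
  exact (one_le_inv₀ (muDeriv_pos _)).2 ((muDeriv_le_quarter _).trans (by norm_num))

lemma eventually_regular (hp : 1 ≤ p) (hM : 1 ≤ M)
    (hZ : ∀ n (i j : Fin n), i ≠ j → ∀ l, |Z n i j l| ≤ M)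
    (hb : ∀ᶠ n in atTop, ∀ i j, i ≠ j → (muDeriv (linPred (Z n) (η₀ n) (γ₀ n) i j))⁻¹ ≤ b n)
    (hH : ∀ᶠ n : ℕ in atTop, (H (Z n) (η₀ n) (γ₀ n)).PosDef ∧
      infNorm (H (Z n) (η₀ n) (γ₀ n))⁻¹ ≤ κ n / (n : ℝ) ^ 2) :
    ∀ᶠ n in atTop, Regular (Z n) (η₀ n) (γ₀ n) (b n) M (κ n) := by
  filter_upwards [hb, eventually_one_le_of_inv_muDeriv_le hb, hH, eventually_ge_atTop 4]
    with n hbn one_le_b hHn hn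
  have u_ge (i j : Fin n) (hij : i ≠ j) : 1 / b n ≤ u (Z n) (η₀ n) (γ₀ n) i j := by
    rw [u, if_neg hij, one_div]
    exact inv_le_of_inv_le₀ (muDeriv_pos _) (hbn i j hij)
  exact {
    four_le := hn
    B_pos := zero_lt_one.trans_le one_le_b
    u_ge := u_ge
    one_le_p := hp
    one_le_M := hM
    Z_le := hZ n
    H_posDef := hHn.1
    H_inv_le := hHn.2 }

lemma eventually_newton (hreg : ∀ᶠ n in atTop, Regular (Z n) (η₀ n) (γ₀ n) (b n) M (κ n))
    (hrate : Tendsto (fun n => rate n (b n) (κ n)) atTop (𝓝 0)) :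
    ∀ᶠ n in atTop, (2 + p * M) * newtonRadius n p (b n) M (κ n) ≤ 1 ∧
      newtonLip p (b n) M (κ n) (newtonRadius n p (b n) M (κ n)) ≤ 1 / 2 := by
  have radius_lim := hrate.const_mul ((2 + p * M) * (2 * p * M ^ 2 * (26 * p * M ^ 2)))
  have lip_lim := hrate.const_mul (18 * p * M ^ 2 * (2 + p * M) ^ 2 * (26 * p * M ^ 2))
  rw [mul_zero] at radius_lim lip_lim
  filter_upwards [hreg, hrate.eventually_le_const one_pos, radius_lim.eventually_le_const one_pos,
    lip_lim.eventually_le_const one_half_pos] with n h hrate_le hradius hlip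
  have hM := h.M_pos
  refine ⟨le_trans ?_ hradius, (h.newtonLip_newtonRadius_le hrate_le).trans hlip⟩
  rw [mul_assoc (2 + p * M)]
  gcongr
  exact h.newtonRadius_le_rate hrate_le

lemma tendsto_sqrt_mul_expansionError
    (hreg : ∀ᶠ n in atTop, Regular (Z n) (η₀ n) (γ₀ n) (b n) M (κ n))
    (hrate : Tendsto (fun n => rate n (b n) (κ n)) atTop (𝓝 0)) :
    Tendsto (fun n : ℕ => √n * expansionError n p (b n) M (κ n)) atTop (𝓝 0) := by
  have bound_lim := hrate.const_mul
    (9 * p * M ^ 2 + 18 * p * M ^ 2 * (2 + p * M) ^ 2 * (26 * p * M ^ 2) ^ 2)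
  rw [mul_zero] at bound_lim
  refine squeeze_zero' ?_ ?_ bound_lim
  · filter_upwards [hreg] with n h
    exact mul_nonneg (Real.sqrt_nonneg _) h.expansionError_nonneg
  · filter_upwards [hreg, hrate.eventually_le_const one_pos] with n h hrate_le
    exact h.sqrt_mul_expansionError_le hrate_le

lemma tendsto_div_sqrt (hreg : ∀ᶠ n in atTop, Regular (Z n) (η₀ n) (γ₀ n) (b n) M (κ n))
    (hrate : Tendsto (fun n => rate n (b n) (κ n)) atTop (𝓝 0)) :
    Tendsto (fun n : ℕ => b n / √n) atTop (𝓝 0) := by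
  refine squeeze_zero' ?_ (hreg.mono fun n h => h.div_sqrt_le_rate)
    (by simpa using hrate.const_mul (2 * p * M ^ 2))
  filter_upwards [hreg] with n h
  exact div_nonneg h.B_pos.le (Real.sqrt_nonneg _)

lemma tendsto_linear_mul_exp_neg_two_mul_log (p : ℕ) :
    Tendsto (fun n : ℕ => (4 * (n : ℝ) + p) * (2 * Real.exp (-2 * Real.log n))) atTop (𝓝 0) := by
  have inv_lim := tendsto_inv_atTop_nhds_zero_nat (𝕜 := ℝ)
  have inv_poly_lim : Tendsto (fun n : ℕ => 8 * (n : ℝ)⁻¹ + 2 * p * (n : ℝ)⁻¹ ^ 2)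
      atTop (𝓝 0) := by
    simpa using (inv_lim.const_mul 8).add ((inv_lim.pow 2).const_mul (2 * (p : ℝ)))
  refine inv_poly_lim.congr' ?_
  filter_upwards [eventually_gt_atTop 0] with n hn
  have exp_eq : Real.exp (-2 * Real.log n) = (n : ℝ)⁻¹ ^ 2 := by
    rw [neg_mul, ← mul_neg, ← Real.log_inv, ← Nat.cast_two, Real.exp_nat_mul,
      Real.exp_log (by positivity)]
  rw [exp_eq]
  field_simp
  ring

variable {Ω : ℕ → Type*} [∀ n, MeasurableSpace (Ω n)] {P : ∀ n, Measure (Ω n)}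
  [∀ n, IsProbabilityMeasure (P n)] {A : ∀ n, Ω n → Adj n}

theorem tendsto_measure_exists_isMLE
    (hreg : ∀ᶠ n in atTop, Regular (Z n) (η₀ n) (γ₀ n) (b n) M (κ n))
    (hrate : Tendsto (fun n => rate n (b n) (κ n)) atTop (𝓝 0))
    (hA : ∀ n, IsModel (P n) (A n) (Z n) (η₀ n) (γ₀ n)) :
    Tendsto (fun n => P n {ω | ∃ η γ, IsMLE (Z n) (A n ω) η γ}) atTop (𝓝 1) := by
  have hmeas (n : ℕ) : MeasurableSet {ω | ∃ η γ, IsMLE (Z n) (A n ω) η γ} :=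
    (hA n).measurableSet_setOf fun a => ∃ η γ, IsMLE (Z n) a η γ
  have compl_lim : Tendsto (fun n => P n {ω | ∃ η γ, IsMLE (Z n) (A n ω) η γ}ᶜ) atTop (𝓝 0) := by
    have tail_lim := ENNReal.tendsto_ofReal (tendsto_linear_mul_exp_neg_two_mul_log p)
    rw [ENNReal.ofReal_zero] at tail_lim
    refine tendsto_of_tendsto_of_tendsto_of_le_of_le' tendsto_const_nhds tail_lim
      (Eventually.of_forall fun n => zero_le) ?_
    filter_upwards [hreg, eventually_newton hreg hrate] with n h ⟨hr, hlip⟩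
    have hn := h.four_le
    have bad_le := h.measureReal_not_mleExpansion_le (hA n) (last := ⟨n - 1, by omega⟩) rfl hr hlip
    rw [← ofReal_measureReal]
    refine ENNReal.ofReal_le_ofReal (le_trans (measureReal_mono ?_) bad_le)
    exact fun ω hω expansion => hω expansion.1
  have one_sub_lim := ENNReal.Tendsto.sub (tendsto_const_nhds (x := 1)) compl_lim
    (Or.inl ENNReal.one_ne_top)
  simpa only [← prob_compl_eq_one_sub (hmeas _).compl, compl_compl, tsub_zero] using one_sub_lim

theorem tendsto_charFun_stdError {k : ℕ}
    (hreg : ∀ᶠ n in atTop, Regular (Z n) (η₀ n) (γ₀ n) (b n) M (κ n))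
    (hrate : Tendsto (fun n => rate n (b n) (κ n)) atTop (𝓝 0))
    (hA : ∀ n, IsModel (P n) (A n) (Z n) (η₀ n) (γ₀ n))
    {ηhat : ∀ n, Adj n → Idx n → ℝ} {γhat : ∀ n, Adj n → Fin p → ℝ}
    (hMLE : ∀ n (a : Adj n), (∃ η γ, IsMLE (Z n) a η γ) → IsMLE (Z n) a (ηhat n a) (γhat n a))
    (t : EuclideanSpace ℝ (Fin k)) :
    Tendsto (fun n => charFun
        ((P n).map fun ω => stdError k (Z n) (η₀ n) (γ₀ n) (ηhat n (A n ω))) t)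
      atTop (𝓝 (Complex.exp (-‖t‖ ^ 2 / 2))) := by
  let q (n : ℕ) : ℝ := k * ‖t‖ * (b n / √n)
  have q_lim : Tendsto q atTop (𝓝 0) := by
    simpa using (tendsto_div_sqrt hreg hrate).const_mul (k * ‖t‖)
  have bound_lim : Tendsto (fun n : ℕ => k * ‖t‖ * (√n * expansionError n p (b n) M (κ n))
      + 2 * ((4 * n + p) * (2 * Real.exp (-2 * Real.log n)))
      + (8 * q n * (‖t‖ ^ 2 + 2 * q n ^ 2) + q n ^ 2)) atTop (𝓝 0) := by
    have linearization_lim := (tendsto_sqrt_mul_expansionError hreg hrate).const_mul (k * ‖t‖)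
    have tail_lim := (tendsto_linear_mul_exp_neg_two_mul_log p).const_mul 2
    have clt_lim := ((q_lim.const_mul 8).mul (((q_lim.pow 2).const_mul 2).const_add
      (‖t‖ ^ 2))).add (q_lim.pow 2)
    simpa using (linearization_lim.add tail_lim).add clt_lim
  rw [tendsto_iff_norm_sub_tendsto_zero]
  refine squeeze_zero' (Eventually.of_forall fun n => norm_nonneg _) ?_ bound_lim
  filter_upwards [hreg, eventually_newton hreg hrate, eventually_ge_atTop k,
    q_lim.eventually_le_const (by norm_num : (0 : ℝ) < 1 / 4)] with n h ⟨hr, hlip⟩ hk hq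
  exact h.norm_charFun_stdError_sub_le (hA n) hk hr hlip (hMLE n) t rfl (by linarith)

theorem asympNormal_firstCoords
    (hreg : ∀ᶠ n in atTop, Regular (Z n) (η₀ n) (γ₀ n) (b n) M (κ n))
    (hrate : Tendsto (fun n => rate n (b n) (κ n)) atTop (𝓝 0))
    (hA : ∀ n, IsModel (P n) (A n) (Z n) (η₀ n) (γ₀ n))
    {ηhat : ∀ n, Adj n → Idx n → ℝ} {γhat : ∀ n, Adj n → Fin p → ℝ}
    (hMLE : ∀ n (a : Adj n), (∃ η γ, IsMLE (Z n) a η γ) → IsMLE (Z n) a (ηhat n a) (γhat n a))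
    (k : ℕ) :
    AsympNormal P (fun n ω => firstCoords k (ηhat n (A n ω) - η₀ n))
      (fun n => upperLeft k (S (Z n) (η₀ n) (γ₀ n))) := by
  refine ⟨?_, ⟨fun n => ?_, aemeasurable_id, ?_⟩⟩
  · filter_upwards [hreg, eventually_ge_atTop k] with n h hk
    exact h.posDef_upperLeft_S hk
  · exact ((hA n).measurable_comp fun a => stdError k (Z n) (η₀ n) (γ₀ n)
      (ηhat n a)).aemeasurable
  · refine ProbabilityMeasure.tendsto_iff_tendsto_charFun.2 fun t => ?_
    simp only [ProbabilityMeasure.coe_mk, Measure.map_id]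
    rw [charFun_stdGaussian]
    exact tendsto_charFun_stdError hreg hrate hA hMLE t

end Limits

section SupremumBound

variable {n p : ℕ} {Z : Fin n → Fin n → Fin p → ℝ} {M : ℝ}

lemma abs_linPred_le (hZ : ∀ i j, i ≠ j → ∀ l, |Z i j l| ≤ M) (η : Idx n → ℝ) (γ : Fin p → ℝ)
    {i j : Fin n} (hij : i ≠ j) : |linPred Z η γ i j| ≤ 2 * ‖η‖ + p * M * ‖γ‖ := by
  have := abs_add_three (alpha η i) (beta η j) (Z i j ⬝ᵥ γ)
  rw [linPred]
  linarith [abs_alpha_le η i, abs_beta_le η j, abs_dotProduct_le (y := γ) (hZ i j hij)]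

lemma inv_muDeriv_le_of_abs_le {x R : ℝ} (hx : |x| ≤ R) : (muDeriv x)⁻¹ ≤ 2 * Real.exp R + 2 := by
  have hexp : Real.exp x ≤ Real.exp R := Real.exp_le_exp.2 ((le_abs_self x).trans hx)
  have hexp_neg : Real.exp (-x) ≤ Real.exp R := Real.exp_le_exp.2 ((neg_le_abs x).trans hx)
  rw [inv_muDeriv]
  linarith

lemma inv_muDeriv_le_bn {ε₁ ε₂ : ℝ} (hε₁ : 0 ≤ ε₁) (hε₂ : 0 ≤ ε₂)
    (hZ : ∀ i j, i ≠ j → ∀ l, |Z i j l| ≤ M) (η₀ : Idx n → ℝ) (γ₀ : Fin p → ℝ)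
    {i j : Fin n} (hij : i ≠ j) :
    (muDeriv (linPred Z η₀ γ₀ i j))⁻¹ ≤ bn Z η₀ γ₀ ε₁ ε₂ := by
  have muDeriv_inv_eq (x : ℝ) : (1 + Real.exp x) ^ 2 / Real.exp x = (muDeriv x)⁻¹ := by
    rw [muDeriv, inv_div]
  simp only [bn, muDeriv_inv_eq]
  refine le_csSup ⟨2 * Real.exp (2 * (‖η₀‖ + ε₁) + |p * M| * (‖γ₀‖ + ε₂)) + 2, ?_⟩
    ⟨η₀, Metric.mem_closedBall_self hε₁, γ₀, Metric.mem_closedBall_self hε₂, i, j, hij, rfl⟩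
  rintro _ ⟨η, hη, γ, hγ, i, j, hij, rfl⟩
  refine inv_muDeriv_le_of_abs_le ((abs_linPred_le hZ η γ hij).trans ?_)
  gcongr
  · exact norm_le_of_mem_closedBall hη
  · exact le_abs_self _
  · exact norm_le_of_mem_closedBall hγ

lemma eventually_inv_muDeriv_le_bn {Z : ∀ n : ℕ, Fin n → Fin n → Fin p → ℝ} {ε₁ ε₂ : ℕ → ℝ}
    (hε₁ : ∀ᶠ n in atTop, 0 < ε₁ n) (hε₂ : ∀ᶠ n in atTop, 0 < ε₂ n)
    (hZ : ∀ n (i j : Fin n), i ≠ j → ∀ l, |Z n i j l| ≤ M)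
    (η₀ : ∀ n : ℕ, Idx n → ℝ) (γ₀ : ℕ → Fin p → ℝ) :
    ∀ᶠ n in atTop, ∀ i j, i ≠ j → (muDeriv (linPred (Z n) (η₀ n) (γ₀ n) i j))⁻¹
      ≤ bn (Z n) (η₀ n) (γ₀ n) (ε₁ n) (ε₂ n) := by
  filter_upwards [hε₁, hε₂] with n hε₁n hε₂n i j hij
  exact inv_muDeriv_le_bn hε₁n.le hε₂n.le (hZ n) (η₀ n) (γ₀ n) hij

end SupremumBound

lemma isBigO_mul_pow_of_one_le {α : Type*} {l : Filter α} {b : α → ℝ} (hb : ∀ᶠ x in l, 1 ≤ b x)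
    (κ : α → ℝ) {m m' : ℕ} (hm : m ≤ m') :
    (fun x => κ x * b x ^ m) =O[l] fun x => κ x * b x ^ m' := by
  refine (isBigO_refl κ l).mul (IsBigO.of_bound 1 ?_)
  filter_upwards [hb] with x hx
  rw [one_mul, norm_pow, norm_pow]
  exact pow_le_pow_right₀ (hx.trans (Real.le_norm_self _)) hm

end CovP0

open CovP0 in
theorem theorem2_general {p : ℕ} (hp : 1 ≤ p)
    (Z : ∀ n : ℕ, Fin n → Fin n → Fin p → ℝ) {M : ℝ}
    (hZ : ∀ n (i j : Fin n), i ≠ j → ∀ l, |Z n i j l| ≤ M)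
    (η₀ : ∀ n : ℕ, Idx n → ℝ) (γ₀ : ℕ → Fin p → ℝ)
    {Ω : ℕ → Type*} [∀ n, MeasurableSpace (Ω n)]
    (P : ∀ n, Measure (Ω n)) [∀ n, IsProbabilityMeasure (P n)]
    (A : ∀ n, Ω n → Adj n) (hA : ∀ n, IsModel (P n) (A n) (Z n) (η₀ n) (γ₀ n))
    {b κ : ℕ → ℝ}
    (hb : ∀ᶠ n in atTop, ∀ i j, i ≠ j → (muDeriv (linPred (Z n) (η₀ n) (γ₀ n) i j))⁻¹ ≤ b n)
    (hH : ∀ᶠ n : ℕ in atTop, (H (Z n) (η₀ n) (γ₀ n)).PosDef ∧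
      infNorm (H (Z n) (η₀ n) (γ₀ n))⁻¹ ≤ κ n / (n : ℝ) ^ 2)
    (hrate : (fun n : ℕ => κ n * b n ^ 4) =o[atTop] fun n : ℕ => √n / Real.log n)
    (ηhat : ∀ n, Adj n → Idx n → ℝ) (γhat : ∀ n, Adj n → Fin p → ℝ)
    (hMLE : ∀ n (a : Adj n), (∃ η γ, IsMLE (Z n) a η γ) → IsMLE (Z n) a (ηhat n a) (γhat n a)) :
    Tendsto (fun n => P n {ω | ∃ η γ, IsMLE (Z n) (A n ω) η γ}) atTop (𝓝 1) ∧
    ∀ k : ℕ, AsympNormal P (fun n ω => firstCoords k (ηhat n (A n ω) - η₀ n))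
      (fun n => upperLeft k (S (Z n) (η₀ n) (γ₀ n))) := by
  have hreg : ∀ᶠ n in atTop, Regular (Z n) (η₀ n) (γ₀ n) (b n) (max 1 M) (κ n) :=
    eventually_regular hp (le_max_left 1 M)
      (fun n i j hij l => (hZ n i j hij l).trans (le_max_right 1 M)) hb hH
  have rate_lim : Tendsto (fun n => rate n (b n) (κ n)) atTop (𝓝 0) := by
    simpa only [rate, div_div_eq_mul_div] using hrate.tendsto_div_nhds_zero
  exact ⟨tendsto_measure_exists_isMLE hreg rate_lim hA,
    asympNormal_firstCoords hreg rate_lim hA hMLE⟩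

open CovP0 in
theorem theorem2 {p : ℕ} (hp : 1 ≤ p)
    -- the covariates, with entries in a fixed compact set
    (Z : ∀ n : ℕ, Fin n → Fin n → Fin p → ℝ)
    (K : Set ℝ) (hK : IsCompact K)
    (hZ : ∀ n (i j : Fin n), i ≠ j → ∀ l, Z n i j l ∈ K)
    -- the true parameters
    (η₀ : ∀ n : ℕ, CovP0.Idx n → ℝ) (γ₀ : ℕ → Fin p → ℝ)
    -- the random graphs
    {Ω : ℕ → Type*} [∀ n, MeasurableSpace (Ω n)]
    (P : ∀ n, Measure (Ω n)) [∀ n, IsProbabilityMeasure (P n)]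
    (A : ∀ n, Ω n → CovP0.Adj n)
    (hA : ∀ n, CovP0.IsModel (P n) (A n) (Z n) (η₀ n) (γ₀ n))
    -- the radii in the definitions of `b_n` and `κ_n`
    (ε₁ ε₂ : ℕ → ℝ)
    (hε₁ : ∀ᶠ n in atTop, 0 < ε₁ n) (hε₁_lim : Tendsto ε₁ atTop (𝓝 0))
    (hε₂ : ∀ᶠ n in atTop, 0 < ε₂ n)
    (hε₂_le : ∀ᶠ n : ℕ in atTop,
      ε₂ n ≤ Real.sqrt (Real.log n / n) / (p * CovP0.zmax (Z n)))
    -- `H` is positive definite near the true parameter, and `κ_n` bounds its inverse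
    (κ : ℕ → ℝ)
    (hH : ∀ᶠ n : ℕ in atTop, ∀ η ∈ Metric.closedBall (η₀ n) (ε₁ n),
      (CovP0.H (Z n) η (γ₀ n)).PosDef ∧
      CovP0.infNorm (CovP0.H (Z n) η (γ₀ n))⁻¹ ≤ κ n / (n : ℝ) ^ 2)
    (hrate : (fun n : ℕ => κ n * CovP0.bn (Z n) (η₀ n) (γ₀ n) (ε₁ n) (ε₂ n) ^ 12)
      =o[atTop] fun n : ℕ => Real.sqrt n / Real.log n)
    -- the estimators: a maximum likelihood estimate whenever one exists
    (ηhat : ∀ n, CovP0.Adj n → CovP0.Idx n → ℝ) (γhat : ∀ n, CovP0.Adj n → Fin p → ℝ)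
    (hMLE : ∀ n (a : CovP0.Adj n), (∃ η γ, CovP0.IsMLE (Z n) a η γ) →
      CovP0.IsMLE (Z n) a (ηhat n a) (γhat n a)) :
    Tendsto (fun n => P n {ω | ∃ η γ, CovP0.IsMLE (Z n) (A n ω) η γ}) atTop (𝓝 1) ∧
    ∀ k : ℕ, 1 ≤ k →
      CovP0.AsympNormal P
        (fun n ω => CovP0.firstCoords k (ηhat n (A n ω) - η₀ n))
        (fun n => CovP0.upperLeft k (CovP0.S (Z n) (η₀ n) (γ₀ n))) := by
  obtain ⟨M, hM⟩ := hK.isBounded.exists_norm_le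
  have Z_le n (i j : Fin n) (hij : i ≠ j) l : |Z n i j l| ≤ M := hM _ (hZ n i j hij l)
  have b_bound := eventually_inv_muDeriv_le_bn hε₁ hε₂ Z_le η₀ γ₀
  have H_bound := (hε₁.and hH).mono fun n h => h.2 (η₀ n) (Metric.mem_closedBall_self h.1.le)
  have rate_four := (isBigO_mul_pow_of_one_le (eventually_one_le_of_inv_muDeriv_le b_bound) κ
    (by norm_num : 4 ≤ 12)).trans_isLittleO hrate
  obtain ⟨mle_exists, normal⟩ :=
    theorem2_general hp Z Z_le η₀ γ₀ P A hA b_bound H_bound rate_four ηhat γhat hMLE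
  exact ⟨mle_exists, fun k _ => normal k⟩
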